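/- **Setting.** The metatheory is the internal language of a regular locally cartesian closed category $\mathcal E$ with disjoint finite coproducts and a natural numbers object $\mathbb N$; write $2=1+1$, and let $\mathbb Q$ be the object of rationals of $\mathcal E$. A monomorphism $A\rightarrowtail B$ of $\mathcal E$ is $\Pi^0_1$ if there is $g:B\times\mathbb N\to 2$ such that, internally, $b\in A\leftrightarrow\forall n\;g(b,n)=0$. A map $t:1\to\Omega$ is a *classifier for $\Pi^0_1$ monomorphisms* if every monomorphism is the pullback of $t$ along at most one map, and every $\Pi^0_1$ monomorphism is the pullback of $t$ along some map. Let $\square$ be a category of cubes in $\mathcal E$: an internal category with objects $[n]$, $n\in\mathbb N$, where $[0]$ is terminal and $[n+1]$ is a product of $[n]$ and $I=[1]$. Cubical sets are the internal presheaves on $\square$; $\Delta$ is the constant presheaf functor, $\Gamma(X)=X_0$, and $\mathbb I$ is the presheaf represented by $I$, with two endpoints $0,1:1\to\mathbb I$ that are separated by some map $\Gamma(\mathbb I)\to 2$. Fix a class of Kan fibrations of cubical sets such that: fibrations are closed under pullback, composition and dependent products; maps between constant cubical sets are fibrations; fibrations are Hurewicz fibrations (for every $A$ and every point $d$ of $\mathbb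 I$, also in a context $\Delta K$, the inclusion $A\to A\times\mathbb I$ at $d$ has the left lifting property against all fibrations); every map in which all open boxes can be filled is a fibration (an open box being a subobject of some $A\times\mathbb I$ that contains the graph of a map $A\to\mathbb I$ and is complemented on global points); and every fibration $W\to Z$ has a propositional truncation, stable under reindexing. Homotopy type theory is interpreted in the standard way: contexts are cubical sets, types are fibrations, terms are sections, and paths are maps out of $\mathbb I$. A fibration $X\to Y$ is an h-proposition if $\mathrm{Path}_Y(X)\to X\times_YX$ has a section. A *cocut* in context $Y$ is a family of h-propositions $C\to Y\times\Delta\mathbb Q$ for which the following hold in the interpretation of homotopy type theory: (boundedness) there merely exist $a\notin C$ and $b\in C$; (closedness) for all $a$, if $b\in C$ for all $b>a$, then $a\in C$; (locatedness) for all $a<b$, $\|(a\notin C)+(b\in C)\|$. **Theorem.** Let $t:1\to\Omega$ be a classifier for $\Pi^0_1$ monomorphisms in $\mathcal E$. Then cubical sets contain a type of all Dedekind real numbers (presented as cocuts), which is a subtype of $\Delta(\Omega)^{\Delta\mathbb Q}$. That is, the exponential $\Delta(\Omega)^{\Delta\mathbb Q}$ exists, and there are a fibrant cubical set $R$ and an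 h-propositional fibration $\iota:R\to\Delta(\Omega)^{\Delta\mathbb Q}$ such that, writing $\mathrm{El}(\chi)\to Y\times\Delta\mathbb Q$ for the pullback of $\Delta(t):\Delta(1)\to\Delta(\Omega)$ along the transpose of $\chi:Y\to\Delta(\Omega)^{\Delta\mathbb Q}$, for every cubical set $Y$: 1. a map $\chi:Y\to\Delta(\Omega)^{\Delta\mathbb Q}$ factors through $\iota$ if and only if $\mathrm{El}(\chi)$ is a cocut in context $Y$; 2. every cocut in context $Y$ is homotopy equivalent over $Y\times\Delta\mathbb Q$ to $\mathrm{El}(\iota r)$ for some $r:Y\to R$; 3. if $r,r':Y\to R$ are such that $\mathrm{El}(\iota r)$ and $\mathrm{El}(\iota r')$ are homotopy equivalent over $Y\times\Delta\mathbb Q$, then $r$ and $r'$ are homotopic. -/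

import Mathlib

open CategoryTheory CategoryTheory.Limits

attribute [-instance] CategoryTheory.catToReflQuiver

universe v u

namespace CubicalReals

noncomputable section

/-! ## The metatheory

The metatheory is the internal language of a regular, locally cartesian closed category `E` with
disjoint finite coproducts and a natural numbers object.  A morphism `K ⟶ A` is thought of as an
element of the type `A` in context `K`. -/

/-- Every pullback functor between slices has a right adjoint. -/
class LocallyCartesianClosed (E : Type u) [Category.{v} E] [HasFiniteLimits E] : Prop where
  isLeftAdjoint_pullback {X Y : E} (f : X ⟶ Y) : (Over.pullback f).IsLeftAdjoint

/-- A (parametrised) natural numbers object. -/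
structure NNO (E : Type u) [Category.{v} E] [HasFiniteLimits E] where
  N : E
  zero : ⊤_ E ⟶ N
  succ : N ⟶ N
  iter {A X : E} (x : A ⟶ X) (s : X ⟶ X) : A ⨯ N ⟶ X
  iter_zero {A X : E} (x : A ⟶ X) (s : X ⟶ X) :
    prod.lift (𝟙 A) (terminal.from A ≫ zero) ≫ iter x s = x
  iter_succ {A X : E} (x : A ⟶ X) (s : X ⟶ X) :
    prod.map (𝟙 A) succ ≫ iter x s = iter x s ≫ s
  iter_unique {A X : E} (x : A ⟶ X) (s : X ⟶ X) (h : A ⨯ N ⟶ X) :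
    prod.lift (𝟙 A) (terminal.from A ≫ zero) ≫ h = x →
    prod.map (𝟙 A) succ ≫ h = h ≫ s → h = iter x s

section Metatheory

variable {E : Type u} [Category.{v} E] [HasFiniteLimits E]

namespace NNO

variable (NN : NNO E)

/-- The element `0` in context `K`. -/
def zeroAt (K : E) : K ⟶ NN.N := terminal.from K ≫ NN.zero

/-- The element `1` in context `K`. -/
def oneAt (K : E) : K ⟶ NN.N := NN.zeroAt K ≫ NN.succ

/-- Addition, by `m + 0 = m` and `m + (n + 1) = (m + n) + 1`. -/
def addMap : NN.N ⨯ NN.N ⟶ NN.N := NN.iter (𝟙 NN.N) NN.succ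

/-- Addition of elements in context `K`. -/
def add {K : E} (x y : K ⟶ NN.N) : K ⟶ NN.N := prod.lift x y ≫ NN.addMap

/-- Multiplication, by iterating `(m, k) ↦ (m, k + m)` from `(m, 0)`. -/
def mulMap : NN.N ⨯ NN.N ⟶ NN.N :=
  NN.iter (prod.lift (𝟙 NN.N) (NN.zeroAt NN.N)) (prod.lift prod.fst (NN.add prod.snd prod.fst)) ≫
    prod.snd

/-- Multiplication of elements in context `K`. -/
def mul {K : E} (x y : K ⟶ NN.N) : K ⟶ NN.N := prod.lift x y ≫ NN.mulMap

/-- The object of fractions; `((a, b), c)` stands for the fraction `(a - b) / (c + 1)`. -/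
abbrev Frac : E := (NN.N ⨯ NN.N) ⨯ NN.N

/-- For fractions `x = (a - b) / (c + 1)` and `y = (a' - b') / (c' + 1)` in context `K`, the
natural number `a (c' + 1) + b' (c + 1)`.  Thus `x = y` as rationals iff `cross x y = cross y x`
and `x < y` iff `cross x y < cross y x`. -/
def cross {K : E} (x y : K ⟶ NN.Frac) : K ⟶ NN.N :=
  NN.add
    (NN.mul (x ≫ prod.fst ≫ prod.fst) (y ≫ prod.snd ≫ NN.succ))
    (NN.mul (y ≫ prod.fst ≫ prod.snd) (x ≫ prod.snd ≫ NN.succ))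

/-- The strict order on fractions. -/
def FracLt {K : E} (x y : K ⟶ NN.Frac) : Prop :=
  ∃ d : K ⟶ NN.N, NN.add (NN.cross x y) d ≫ NN.succ = NN.cross y x

end NNO

/-- The rational numbers: the quotient of the object of fractions by equality of fractions.
Since that relation is decidable, the quotient map is split (by a choice of normal forms); a split
epimorphism with the given kernel is the quotient, so `Q` is determined up to unique isomorphism. -/
structure Rationals (NN : NNO E) where
  Q : E
  frac : NN.Frac ⟶ Q
  rep : Q ⟶ NN.Frac
  rep_frac : rep ≫ frac = 𝟙 Q
  frac_eq_iff {K : E} (x y : K ⟶ NN.Frac) :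
    x ≫ frac = y ≫ frac ↔ NN.cross x y = NN.cross y x

/-- The strict order on rationals in context `K`. -/
def Rationals.Lt {NN : NNO E} (QQ : Rationals NN) {K : E} (x y : K ⟶ QQ.Q) : Prop :=
  ∃ f g : K ⟶ NN.Frac, f ≫ QQ.frac = x ∧ g ≫ QQ.frac = y ∧ NN.FracLt f g

/-- A monomorphism `f : A ⟶ B` is `Π⁰₁` if there is `g : B × ℕ → 2` such that `b` lies in `A` iff
`g (b, n) = 0` for all `n`.  Here `2` is `1 + 1`, whose element `0` is the left inclusion. -/
def IsPi01 [HasFiniteCoproducts E] (NN : NNO E) {A B : E} (f : A ⟶ B) : Prop :=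
  Mono f ∧ ∃ g : B ⨯ NN.N ⟶ (⊤_ E) ⨿ (⊤_ E), ∀ (K : E) (b : K ⟶ B),
    (∃ a : K ⟶ A, a ≫ f = b) ↔
      prod.map b (𝟙 NN.N) ≫ g = terminal.from (K ⨯ NN.N) ≫ coprod.inl

/-- `t : 1 ⟶ Ω` is extensional: a monomorphism has at most one classifying map into `Ω`. -/
def IsExtensional {Ω : E} (t : ⊤_ E ⟶ Ω) : Prop :=
  ∀ ⦃X Y : E⦄ (f : X ⟶ Y), Mono f → ∀ χ χ' : Y ⟶ Ω,
    IsPullback (terminal.from X) f t χ → IsPullback (terminal.from X) f t χ' → χ = χ'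

/-- `t : 1 ⟶ Ω` is a classifier for `Π⁰₁` monomorphisms: it is extensional and every `Π⁰₁`
monomorphism is a pullback of it. -/
def IsPi01Classifier [HasFiniteCoproducts E] (NN : NNO E) {Ω : E} (t : ⊤_ E ⟶ Ω) : Prop :=
  IsExtensional t ∧ ∀ ⦃X Y : E⦄ (f : X ⟶ Y), IsPi01 NN f →
    ∃ χ : Y ⟶ Ω, IsPullback (terminal.from X) f t χ

/-! ## The category of cubes and cubical sets -/

/-- A category of cubes in the metatheory: an internal category with object of objects `ℕ` (the
object `n` is written `[n]`), such that `[0]` is terminal and `[n + 1]` is a product of `[n]` and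
`I = [1]`.  Composition (in diagrammatic order) is given on elements in an arbitrary context `K`,
naturally in `K`; by the Yoneda lemma this is a map out of the object of composable pairs. -/
structure CubeCategory (NN : NNO E) where
  Mor : E
  dom : Mor ⟶ NN.N
  cod : Mor ⟶ NN.N
  ident : NN.N ⟶ Mor
  comp {K : E} (f g : K ⟶ Mor) (h : f ≫ cod = g ≫ dom) : K ⟶ Mor
  ident_dom : ident ≫ dom = 𝟙 NN.N
  ident_cod : ident ≫ cod = 𝟙 NN.N
  comp_dom {K : E} (f g : K ⟶ Mor) (h : f ≫ cod = g ≫ dom) : comp f g h ≫ dom = f ≫ dom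
  comp_cod {K : E} (f g : K ⟶ Mor) (h : f ≫ cod = g ≫ dom) : comp f g h ≫ cod = g ≫ cod
  comp_nat {L K : E} (σ : L ⟶ K) (f g : K ⟶ Mor) (h : f ≫ cod = g ≫ dom)
    (h' : (σ ≫ f) ≫ cod = (σ ≫ g) ≫ dom) : σ ≫ comp f g h = comp (σ ≫ f) (σ ≫ g) h'
  ident_comp {K : E} (f : K ⟶ Mor) (h : ((f ≫ dom) ≫ ident) ≫ cod = f ≫ dom) :
    comp ((f ≫ dom) ≫ ident) f h = f
  comp_ident {K : E} (f : K ⟶ Mor) (h : f ≫ cod = ((f ≫ cod) ≫ ident) ≫ dom) :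
    comp f ((f ≫ cod) ≫ ident) h = f
  assoc {K : E} (f g k : K ⟶ Mor) (h₁ : f ≫ cod = g ≫ dom) (h₂ : g ≫ cod = k ≫ dom)
    (h₃ : comp f g h₁ ≫ cod = k ≫ dom) (h₄ : f ≫ cod = comp g k h₂ ≫ dom) :
    comp (comp f g h₁) k h₃ = comp f (comp g k h₂) h₄
  /-- `[0]` is terminal. -/
  existsUnique_toZero {K : E} (n : K ⟶ NN.N) :
    ∃! f : K ⟶ Mor, f ≫ dom = n ∧ f ≫ cod = NN.zeroAt K
  /-- The projections `[n + 1] ⟶ [n]`. -/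
  proj₁ : NN.N ⟶ Mor
  /-- The projections `[n + 1] ⟶ [1]`. -/
  proj₂ : NN.N ⟶ Mor
  proj₁_dom : proj₁ ≫ dom = NN.succ
  proj₁_cod : proj₁ ≫ cod = 𝟙 NN.N
  proj₂_dom : proj₂ ≫ dom = NN.succ
  proj₂_cod : proj₂ ≫ cod = NN.oneAt NN.N
  /-- `[n + 1]` is a product of `[n]` and `[1]`. -/
  existsUnique_pair {K : E} (n : K ⟶ NN.N) (f g : K ⟶ Mor) (hfg : f ≫ dom = g ≫ dom)
    (hf : f ≫ cod = n) (hg : g ≫ cod = NN.oneAt K) :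
    ∃! h : K ⟶ Mor, ∃ (h₁ : h ≫ cod = (n ≫ proj₁) ≫ dom) (h₂ : h ≫ cod = (n ≫ proj₂) ≫ dom),
      comp h (n ≫ proj₁) h₁ = f ∧ comp h (n ≫ proj₂) h₂ = g

variable {NN : NNO E}

/-- Cubical sets: internal presheaves on the category of cubes.  The carrier is the disjoint union
of the sets `X_n`, and `dim` sends an element of `X_n` to `n`.  For `x : X_n` and `s : [m] ⟶ [n]`
in context `K`, `act x s` is the restriction `X_s x : X_m`. -/
structure CubicalSet (C : CubeCategory NN) where
  carrier : E
  dim : carrier ⟶ NN.N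
  act {K : E} (x : K ⟶ carrier) (s : K ⟶ C.Mor) (h : s ≫ C.cod = x ≫ dim) : K ⟶ carrier
  act_dim {K : E} (x : K ⟶ carrier) (s : K ⟶ C.Mor) (h : s ≫ C.cod = x ≫ dim) :
    act x s h ≫ dim = s ≫ C.dom
  act_nat {L K : E} (σ : L ⟶ K) (x : K ⟶ carrier) (s : K ⟶ C.Mor) (h : s ≫ C.cod = x ≫ dim)
    (h' : (σ ≫ s) ≫ C.cod = (σ ≫ x) ≫ dim) : σ ≫ act x s h = act (σ ≫ x) (σ ≫ s) h'
  act_ident {K : E} (x : K ⟶ carrier) (h : ((x ≫ dim) ≫ C.ident) ≫ C.cod = x ≫ dim) :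
    act x ((x ≫ dim) ≫ C.ident) h = x
  act_comp {K : E} (x : K ⟶ carrier) (s r : K ⟶ C.Mor) (h : s ≫ C.cod = x ≫ dim)
    (h₁ : r ≫ C.cod = act x s h ≫ dim) (h₂ : r ≫ C.cod = s ≫ C.dom)
    (h₃ : C.comp r s h₂ ≫ C.cod = x ≫ dim) :
    act (act x s h) r h₁ = act x (C.comp r s h₂) h₃

namespace CubicalSet

variable {C : CubeCategory NN}

/-- Morphisms of cubical sets. -/
@[ext]
structure Hom (X Y : CubicalSet C) where
  hom : X.carrier ⟶ Y.carrier
  hom_dim : hom ≫ Y.dim = X.dim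
  act_hom {K : E} (x : K ⟶ X.carrier) (s : K ⟶ C.Mor) (h : s ≫ C.cod = x ≫ X.dim)
    (h' : s ≫ C.cod = (x ≫ hom) ≫ Y.dim) : X.act x s h ≫ hom = Y.act (x ≫ hom) s h'

instance : Category.{v} (CubicalSet C) where
  Hom := Hom
  id X :=
    { hom := 𝟙 _
      hom_dim := by simp
      act_hom := by intros; simp }
  comp f g :=
    { hom := f.hom ≫ g.hom
      hom_dim := by simp [f.hom_dim, g.hom_dim]
      act_hom := by
        intro K x s h h'
        rw [← Category.assoc, f.act_hom x s h (by simp [f.hom_dim, h]),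
          g.act_hom _ _ _ (by simpa using h')]
        simp }
  id_comp f := Hom.ext (Category.id_comp _)
  comp_id f := Hom.ext (Category.comp_id _)
  assoc f g h := Hom.ext (Category.assoc _ _ _)

@[simp] theorem id_hom (X : CubicalSet C) : Hom.hom (𝟙 X) = 𝟙 X.carrier := rfl

@[simp] theorem comp_hom {X Y Z : CubicalSet C} (f : X ⟶ Y) (g : Y ⟶ Z) :
    Hom.hom (f ≫ g) = Hom.hom f ≫ Hom.hom g := rfl

@[ext] theorem hom_ext {X Y : CubicalSet C} {f g : X ⟶ Y} (h : Hom.hom f = Hom.hom g) : f = g :=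
  Hom.ext h

theorem act_congr (X : CubicalSet C) {K : E} {x x' : K ⟶ X.carrier} {s s' : K ⟶ C.Mor}
    (hx : x = x') (hs : s = s') (h : s ≫ C.cod = x ≫ X.dim) (h' : s' ≫ C.cod = x' ≫ X.dim) :
    X.act x s h = X.act x' s' h' := by subst hx hs; rfl

/-- The terminal cubical set. -/
def point (C : CubeCategory NN) : CubicalSet C where
  carrier := NN.N
  dim := 𝟙 _
  act _ s _ := s ≫ C.dom
  act_dim := by intros; simp
  act_nat := by intros; simp
  act_ident := by intros; simp [C.ident_dom]
  act_comp := by intros; simp [C.comp_dom]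

instance : HasTerminal (CubicalSet C) :=
  IsTerminal.hasTerminal (X := point C) <| IsTerminal.ofUniqueHom
    (fun X => { hom := X.dim
                hom_dim := Category.comp_id _
                act_hom := fun x s h _ => X.act_dim x s h })
    (fun X m => Hom.ext (by have := m.hom_dim; exact (Category.comp_id _).symm.trans this))

/-- Pullbacks of cubical sets are computed on carriers. -/
def pb {X Y Z : CubicalSet C} (f : X ⟶ Z) (g : Y ⟶ Z) : CubicalSet C where
  carrier := pullback f.hom g.hom
  dim := pullback.fst _ _ ≫ X.dim
  act {K} x s h := pullback.lift
    (X.act (x ≫ pullback.fst _ _) s (by rw [h, Category.assoc]))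
    (Y.act (x ≫ pullback.snd _ _) s (by
      rw [h, ← f.hom_dim, ← g.hom_dim, pullback.condition_assoc]; simp))
    (by
      rw [f.act_hom _ _ _ (by simp [f.hom_dim, h]),
        g.act_hom _ _ _ (by
          rw [h, ← f.hom_dim, pullback.condition_assoc]; simp)]
      exact act_congr _ (by simp [pullback.condition]) rfl _ _)
  act_dim := by intro K x s h; rw [pullback.lift_fst_assoc, X.act_dim]
  act_nat := by
    intro L K σ x s h h'
    apply pullback.hom_ext
    · simp only [Category.assoc, pullback.lift_fst]
      have e : (σ ≫ s) ≫ C.cod = (σ ≫ x ≫ pullback.fst _ _) ≫ X.dim := by rw [h']; simp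
      rw [X.act_nat σ _ _ _ e]
    · simp only [Category.assoc, pullback.lift_snd]
      have e : (σ ≫ s) ≫ C.cod = (σ ≫ x ≫ pullback.snd _ _) ≫ Y.dim := by
        rw [h', ← f.hom_dim, ← g.hom_dim, pullback.condition_assoc]; simp
      rw [Y.act_nat σ _ _ _ e]
  act_ident := by
    intro K x h
    have eY : x ≫ pullback.fst f.hom g.hom ≫ X.dim = (x ≫ pullback.snd f.hom g.hom) ≫ Y.dim := by
      rw [← f.hom_dim, ← g.hom_dim, pullback.condition_assoc]; simp
    have hX : (((x ≫ pullback.fst f.hom g.hom) ≫ X.dim) ≫ C.ident) ≫ C.cod =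
        (x ≫ pullback.fst f.hom g.hom) ≫ X.dim := by
      simp only [Category.assoc] at h ⊢; exact h
    have hY : (((x ≫ pullback.snd f.hom g.hom) ≫ Y.dim) ≫ C.ident) ≫ C.cod =
        (x ≫ pullback.snd f.hom g.hom) ≫ Y.dim := by
      rw [← eY]; exact h
    apply pullback.hom_ext
    · simp only [pullback.lift_fst]
      exact (act_congr X rfl (by simp) _ hX).trans (X.act_ident _ hX)
    · simp only [pullback.lift_snd]
      exact (act_congr Y rfl (by rw [eY]) _ hY).trans (Y.act_ident _ hY)
  act_comp := by
    intro K x s r h h₁ h₂ h₃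
    have hX : s ≫ C.cod = (x ≫ pullback.fst f.hom g.hom) ≫ X.dim := by rw [h, Category.assoc]
    have hY : s ≫ C.cod = (x ≫ pullback.snd f.hom g.hom) ≫ Y.dim := by
      rw [h, ← f.hom_dim, ← g.hom_dim, pullback.condition_assoc]; simp
    apply pullback.hom_ext
    · simp only [pullback.lift_fst]
      exact X.act_comp _ _ _ hX (by rw [X.act_dim, h₂]) h₂ (by rw [C.comp_cod, hX])
    · simp only [pullback.lift_snd]
      exact Y.act_comp _ _ _ hY (by rw [Y.act_dim, h₂]) h₂ (by rw [C.comp_cod, hY])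

/-- The first projection. -/
def pbFst {X Y Z : CubicalSet C} (f : X ⟶ Z) (g : Y ⟶ Z) : pb f g ⟶ X where
  hom := pullback.fst f.hom g.hom
  hom_dim := rfl
  act_hom := by intro K x s h h'; exact pullback.lift_fst _ _ _

/-- The second projection. -/
def pbSnd {X Y Z : CubicalSet C} (f : X ⟶ Z) (g : Y ⟶ Z) : pb f g ⟶ Y where
  hom := pullback.snd f.hom g.hom
  hom_dim := by
    change _ = pullback.fst f.hom g.hom ≫ X.dim
    rw [← f.hom_dim, ← g.hom_dim]
    exact (pullback.condition_assoc _).symm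
  act_hom := by intro K x s h h'; exact pullback.lift_snd _ _ _

/-- The map into the pullback induced by a commutative square. -/
def pbLift {X Y Z W : CubicalSet C} (f : X ⟶ Z) (g : Y ⟶ Z) (a : W ⟶ X) (b : W ⟶ Y)
    (w : a ≫ f = b ≫ g) : W ⟶ pb f g where
  hom := pullback.lift a.hom b.hom (congrArg Hom.hom w)
  hom_dim := by
    change pullback.lift _ _ _ ≫ pullback.fst f.hom g.hom ≫ X.dim = _
    rw [pullback.lift_fst_assoc, a.hom_dim]
  act_hom := by
    intro K x s h h'
    have ha : s ≫ C.cod = (x ≫ a.hom) ≫ X.dim := by rw [h, Category.assoc, a.hom_dim]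
    have hb : s ≫ C.cod = (x ≫ b.hom) ≫ Y.dim := by rw [h, Category.assoc, b.hom_dim]
    apply pullback.hom_ext
    · refine Eq.trans ?_ (pullback.lift_fst _ _ _).symm
      refine (Category.assoc _ _ _).trans ((congrArg _ (pullback.lift_fst _ _ _)).trans ?_)
      exact (a.act_hom x s h ha).trans (act_congr X
        ((Category.assoc _ _ _).trans (congrArg _ (pullback.lift_fst _ _ _))).symm rfl _ _)
    · refine Eq.trans ?_ (pullback.lift_snd _ _ _).symm
      refine (Category.assoc _ _ _).trans ((congrArg _ (pullback.lift_snd _ _ _)).trans ?_)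
      exact (b.act_hom x s h hb).trans (act_congr Y
        ((Category.assoc _ _ _).trans (congrArg _ (pullback.lift_snd _ _ _))).symm rfl _ _)

theorem isPullback_pb {X Y Z : CubicalSet C} (f : X ⟶ Z) (g : Y ⟶ Z) :
    IsPullback (pbFst f g) (pbSnd f g) f g where
  w := hom_ext pullback.condition
  isLimit' := ⟨PullbackCone.IsLimit.mk (hom_ext pullback.condition)
    (fun s => pbLift f g s.fst s.snd s.condition)
    (fun _ => hom_ext (pullback.lift_fst _ _ _))
    (fun _ => hom_ext (pullback.lift_snd _ _ _))
    (fun _ _ h₁ h₂ => hom_ext (pullback.hom_ext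
      ((congrArg Hom.hom h₁).trans (pullback.lift_fst _ _ _).symm)
      ((congrArg Hom.hom h₂).trans (pullback.lift_snd _ _ _).symm)))⟩

instance : HasPullbacks (CubicalSet C) :=
  have : ∀ {X Y Z : CubicalSet C} {f : X ⟶ Z} {g : Y ⟶ Z}, HasLimit (cospan f g) :=
    fun {_ _ _ f g} => (isPullback_pb f g).hasPullback
  hasPullbacks_of_hasLimit_cospan _

instance : HasFiniteLimits (CubicalSet C) := hasFiniteLimits_of_hasTerminal_and_pullbacks

/-! ### Constant cubical sets, global points and the interval -/

/-- The constant cubical set functor `Δ`: the fibre of `Δ A` over every `n` is `A`. -/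
def Δ (C : CubeCategory NN) : E ⥤ CubicalSet C where
  obj A :=
    { carrier := A ⨯ NN.N
      dim := prod.snd
      act := fun x s _ => prod.lift (x ≫ prod.fst) (s ≫ C.dom)
      act_dim := by intros; rw [prod.lift_snd]
      act_nat := by intros; ext <;> simp [prod.lift_fst, prod.lift_snd]
      act_ident := by intros; ext <;> simp [prod.lift_fst, prod.lift_snd, C.ident_dom]
      act_comp := by intros; ext <;> simp [prod.lift_fst, prod.lift_snd, C.comp_dom] }
  map f :=
    { hom := prod.map f (𝟙 _)
      hom_dim := by simp
      act_hom := by intros; ext <;> simp [prod.lift_fst, prod.lift_snd] }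
  map_id A := hom_ext (by simp)
  map_comp f g := hom_ext (by simp)

/-- The global points functor `Γ`, sending `X` to `X_0`. -/
def Γ (C : CubeCategory NN) : CubicalSet C ⥤ E where
  obj X := pullback X.dim NN.zero
  map f := pullback.lift (pullback.fst _ _ ≫ f.hom) (pullback.snd _ _)
    (by rw [Category.assoc, f.hom_dim, pullback.condition])
  map_id X := by apply pullback.hom_ext <;> simp
  map_comp f g := by apply pullback.hom_ext <;> simp [pullback.lift_fst, pullback.lift_snd, pullback.lift_fst_assoc]

/-- The interval: the cubical set represented by `I = [1]`.  Its elements are the morphisms of the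
category of cubes with codomain `[1]`, and restriction is composition. -/
def interval (C : CubeCategory NN) : CubicalSet C where
  carrier := pullback C.cod (NN.oneAt (⊤_ E))
  dim := pullback.fst _ _ ≫ C.dom
  act {K} x s h := pullback.lift (C.comp s (x ≫ pullback.fst _ _) (by rw [h, Category.assoc]))
    (x ≫ pullback.snd _ _) (by
      rw [C.comp_cod, Category.assoc, pullback.condition, Category.assoc])
  act_dim := by
    intro K x s h
    rw [pullback.lift_fst_assoc, C.comp_dom]
  act_nat := by
    intro L K σ x s h h'
    apply pullback.hom_ext
    · have e : (σ ≫ s) ≫ C.cod = (σ ≫ x ≫ pullback.fst _ _) ≫ C.dom := by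
        rw [h']; simp
      simp only [Category.assoc, pullback.lift_fst]
      rw [C.comp_nat σ _ _ _ e]
    · exact terminal.hom_ext _ _
  act_ident := by
    intro K x h
    apply pullback.hom_ext
    · rw [pullback.lift_fst]
      have e : (((x ≫ pullback.fst C.cod (NN.oneAt (⊤_ E))) ≫ C.dom) ≫ C.ident) ≫ C.cod =
          (x ≫ pullback.fst C.cod (NN.oneAt (⊤_ E))) ≫ C.dom := by
        simp only [Category.assoc] at h ⊢; exact h
      have := C.ident_comp _ e
      simp only [Category.assoc] at this ⊢
      exact this
    · exact terminal.hom_ext _ _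
  act_comp := by
    intro K x s r h h₁ h₂ h₃
    apply pullback.hom_ext
    · simp only [pullback.lift_fst]
      rw [C.assoc _ _ _ h₂ (by rw [h, Category.assoc])]
    · exact terminal.hom_ext _ _

/-- The element of `A` underlying a map into `Δ A`. -/
def val {X : CubicalSet C} {A : E} (a : X ⟶ (Δ C).obj A) : X.carrier ⟶ A :=
  (show X.carrier ⟶ A ⨯ NN.N from a.hom) ≫ prod.fst

/-! ### Dependent products, negation and exponentials in cubical sets -/

/-- `p : P ⟶ Y`, with evaluation map `ev`, is the dependent product `Π_f g` of `g : W ⟶ X` along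
`f : X ⟶ Y`: maps `Z ⟶ P` over `Y` correspond to maps `Z ×_Y X ⟶ W` over `X`. -/
structure IsDependentProduct {W X Y P : CubicalSet C} (f : X ⟶ Y) (g : W ⟶ X) (p : P ⟶ Y)
    (ev : pullback p f ⟶ W) : Prop where
  ev_comp : ev ≫ g = pullback.snd p f
  existsUnique {Z : CubicalSet C} (z : Z ⟶ Y) (k : pullback z f ⟶ W)
    (hk : k ≫ g = pullback.snd z f) :
    ∃! u : Z ⟶ P, ∃ h : u ≫ p = z,
      pullback.lift (pullback.fst z f ≫ u) (pullback.snd z f)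
        (by rw [Category.assoc, h, pullback.condition]) ≫ ev = k

/-- `n : N ⟶ B` is the negation of `c : A ⟶ B`, i.e. the exponential `⊥ ^ A` over `B`: it is a
subobject of `B`, and `z : Z ⟶ B` factors through it iff there is a map `Z ×_B A ⟶ ⊥`, i.e. iff
`Z ×_B A` is empty. -/
def IsNegation {A B N : CubicalSet C} (c : A ⟶ B) (n : N ⟶ B) : Prop :=
  Mono n ∧ ∀ (Z : CubicalSet C) (z : Z ⟶ B),
    (∃ l : Z ⟶ N, l ≫ n = z) ↔ Nonempty (IsInitial (pullback c z))

/-- `P`, with evaluation map `ev`, is the exponential `B ^ A`. -/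
def IsExponential {A B P : CubicalSet C} (ev : P ⨯ A ⟶ B) : Prop :=
  ∀ (Y : CubicalSet C) (k : Y ⨯ A ⟶ B), ∃! u : Y ⟶ P, prod.map u (𝟙 A) ≫ ev = k

/-- The family over `B` classified by `χ : B ⟶ Δ Ω`: the pullback of `Δ t : Δ 1 ⟶ Δ Ω`. -/
abbrev classified {Ω : E} (t : ⊤_ E ⟶ Ω) {B : CubicalSet C} (χ : B ⟶ (Δ C).obj Ω) :
    pullback χ ((Δ C).map t) ⟶ B :=
  pullback.fst χ ((Δ C).map t)

end CubicalSet

open CubicalSet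

/-! ## Paths, Kan fibrations and propositional truncation -/

/-- The two endpoints of the interval, i.e. (by the Yoneda lemma) two morphisms `[0] ⟶ [1]`; they
are told apart by some function from the points of the interval to `2 = 1 + 1`. -/
structure Endpoints [HasFiniteCoproducts E] (C : CubeCategory NN) where
  i₀ : ⊤_ (CubicalSet C) ⟶ interval C
  i₁ : ⊤_ (CubicalSet C) ⟶ interval C
  separated : ∃ e : (Γ C).obj (interval C) ⟶ (⊤_ E) ⨿ (⊤_ E),
    (Γ C).map i₀ ≫ e = terminal.from _ ≫ coprod.inl ∧
    (Γ C).map i₁ ≫ e = terminal.from _ ≫ coprod.inr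

section Homotopy

variable [HasFiniteCoproducts E] {C : CubeCategory NN} (J : Endpoints C)

/-- `f` and `g` are homotopic over `B`: there is a map `A × I ⟶ X`, equivalently `A ⟶ X ^ I`, from
`f` to `g` lying over a constant path in `B`. -/
def HomotopicOver {A X B : CubicalSet C} (p : X ⟶ B) (f g : A ⟶ X) : Prop :=
  ∃ H : A ⨯ interval C ⟶ X, H ≫ p = prod.fst ≫ f ≫ p ∧
    prod.lift (𝟙 A) (terminal.from A ≫ J.i₀) ≫ H = f ∧
    prod.lift (𝟙 A) (terminal.from A ≫ J.i₁) ≫ H = g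

/-- `p : X ⟶ Y` is an h-proposition: the map `Path_Y(X) ⟶ X ×_Y X` has a section, or in transposed
form, the two projections `X ×_Y X ⟶ X` are homotopic over `Y`. -/
def IsHProp {X Y : CubicalSet C} (p : X ⟶ Y) : Prop :=
  HomotopicOver J p (pullback.fst p p) (pullback.snd p p)

/-- `p : X ⟶ B` and `q : Y ⟶ B` are homotopy equivalent over `B`. -/
def EquivalentOver {X Y B : CubicalSet C} (p : X ⟶ B) (q : Y ⟶ B) : Prop :=
  ∃ (u : X ⟶ Y) (w : Y ⟶ X), u ≫ q = p ∧ w ≫ p = q ∧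
    HomotopicOver J p (u ≫ w) (𝟙 X) ∧ HomotopicOver J q (w ≫ u) (𝟙 Y)

/-- `t : T ⟶ Z` with unit `η` is the propositional truncation of `w : W ⟶ Z` relative to a class of
fibrations: it is an h-propositional fibration under `w` which, stably under reindexing, can be
eliminated into every h-propositional fibration. -/
structure IsPropTrunc (Fib : MorphismProperty (CubicalSet C)) {W T Z : CubicalSet C}
    (w : W ⟶ Z) (t : T ⟶ Z) (η : W ⟶ T) : Prop where
  fib : Fib t
  hprop : IsHProp J t
  fac : η ≫ t = w
  elim {Z' P : CubicalSet C} (σ : Z' ⟶ Z) (p : P ⟶ Z') : Fib p → IsHProp J p →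
    (∃ k : pullback w σ ⟶ P, k ≫ p = pullback.snd w σ) →
    ∃ k : pullback t σ ⟶ P, k ≫ p = pullback.snd t σ

/-- An open box in `A × I`: a subobject which contains the graph of some `r : A ⟶ I` and which is
decidable on points, i.e. has a complement after applying `Γ`. -/
structure IsOpenBox {S A : CubicalSet C} (m : S ⟶ A ⨯ interval C) : Prop where
  mono : Mono m
  graph : ∃ (r : A ⟶ interval C) (l : A ⟶ S), l ≫ m = prod.lift (𝟙 A) r
  decidable : ∃ (D : E) (d : D ⟶ (Γ C).obj (A ⨯ interval C)),
    Nonempty (IsColimit (BinaryCofan.mk ((Γ C).map m) d))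

/-- A notion of Kan fibration, `Fib f` meaning that `f` admits a Kan fibration structure, for which
cubical sets interpret homotopy type theory in the standard way: contexts are cubical sets, types
in context `Y` are fibrations over `Y`, terms are sections, substitution is pullback, `Σ` is
composition, `Π` is the dependent product, and paths are maps out of the interval. -/
structure KanFibrations where
  Fib : MorphismProperty (CubicalSet C)
  isStableUnderBaseChange : Fib.IsStableUnderBaseChange
  isStableUnderComposition : Fib.IsStableUnderComposition
  /-- Fibrations are closed under dependent products. -/
  pi {W X Y P : CubicalSet C} (f : X ⟶ Y) (g : W ⟶ X) (p : P ⟶ Y) (ev : pullback p f ⟶ W) :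
    Fib f → Fib g → IsDependentProduct f g p ev → Fib p
  /-- Maps between constant cubical sets (such as the empty type and the natural numbers) are
  fibrations. -/
  constant {A B : E} (f : (Δ C).obj A ⟶ (Δ C).obj B) : Fib f
  /-- Fibrations are Hurewicz fibrations: for a point `d` of the interval in a context `K` of the
  metatheory and a family `A` of cubical sets in context `K`, the inclusion `A ⟶ A × I` at `d` is a
  trivial cofibration. -/
  hurewicz {K : E} {A X Y : CubicalSet C} (d : (Δ C).obj K ⟶ interval C) (a : A ⟶ (Δ C).obj K)
    (f : X ⟶ Y) : Fib f → HasLiftingProperty (prod.lift (𝟙 A) (a ≫ d)) f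
  /-- A map in which all open boxes can be filled is a fibration. -/
  fib_of_boxes {X Y : CubicalSet C} (f : X ⟶ Y) :
    (∀ {S A : CubicalSet C} (m : S ⟶ A ⨯ interval C), IsOpenBox m → HasLiftingProperty m f) →
    Fib f
  /-- Types have propositional truncations. -/
  trunc {W Z : CubicalSet C} (w : W ⟶ Z) : Fib w →
    ∃ (T : CubicalSet C) (t : T ⟶ Z) (η : W ⟶ T), IsPropTrunc J Fib w t η

end Homotopy

/-! ## Cocuts in homotopy type theory, interpreted in cubical sets -/

section Cocuts

variable [HasFiniteCoproducts E] {C : CubeCategory NN} {J : Endpoints C} (M : KanFibrations J)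

/-- The propositional truncation of the type `w : W ⟶ Z` has a term in context `Z`. -/
def MerelyInhabited {W Z : CubicalSet C} (w : W ⟶ Z) : Prop :=
  ∃ (T : CubicalSet C) (t : T ⟶ Z) (η : W ⟶ T), IsPropTrunc J M.Fib w t η ∧
    ∃ s : Z ⟶ T, s ≫ t = 𝟙 Z

/-- The strict order on the rationals `Δ Q` of cubical sets, on elements in context `Z`. -/
def RatLt (QQ : Rationals NN) {Z : CubicalSet C} (a b : Z ⟶ (Δ C).obj QQ.Q) : Prop :=
  QQ.Lt (val a) (val b)

/-- A family `c : A ⟶ Y × Q` is a term `Q → hProp` in context `Y`, given by its total space, which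
is a cocut according to the interpretation of homotopy type theory.  Quantifiers over rationals and
implications are unfolded through the universal properties of `Π`-types and substitution: they
range over elements `a b : Z ⟶ Δ Q` in all contexts `(Z, y : Z ⟶ Y)` over `Y`. -/
structure IsCocut (QQ : Rationals NN) {Y A : CubicalSet C} (c : A ⟶ Y ⨯ (Δ C).obj QQ.Q) :
    Prop where
  fib : M.Fib c
  hprop : IsHProp J c
  /-- There merely exist rationals `a` and `b` with `a ∉ c` and `b ∈ c`. -/
  bounded : ∃ (N : CubicalSet C) (n : N ⟶ Y ⨯ (Δ C).obj QQ.Q), IsNegation c n ∧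
    MerelyInhabited M (pullback.fst (n ≫ prod.fst) (c ≫ prod.fst) ≫ n ≫ prod.fst)
  /-- If `b ∈ c` for all `b > a`, then `a ∈ c`. -/
  closed {Z : CubicalSet C} (y : Z ⟶ Y) (a : Z ⟶ (Δ C).obj QQ.Q) :
    (∀ {Z' : CubicalSet C} (ρ : Z' ⟶ Z) (b : Z' ⟶ (Δ C).obj QQ.Q), RatLt QQ (ρ ≫ a) b →
      ∃ l : Z' ⟶ A, l ≫ c = prod.lift (ρ ≫ y) b) →
    ∃ l : Z ⟶ A, l ≫ c = prod.lift y a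
  /-- If `a < b` then the propositional truncation of the sum `(a ∉ c) + (b ∈ c)` has a term. -/
  located : ∃ (N : CubicalSet C) (n : N ⟶ Y ⨯ (Δ C).obj QQ.Q), IsNegation c n ∧
    ∀ {Z : CubicalSet C} (y : Z ⟶ Y) (a b : Z ⟶ (Δ C).obj QQ.Q), RatLt QQ a b →
      ∃ (S : CubicalSet C) (i : pullback n (prod.lift y a) ⟶ S)
        (j : pullback c (prod.lift y b) ⟶ S) (s : S ⟶ Z),
        Nonempty (IsColimit (BinaryCofan.mk i j)) ∧
        i ≫ s = pullback.snd n (prod.lift y a) ∧ j ≫ s = pullback.snd c (prod.lift y b) ∧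
        MerelyInhabited M s

end Cocuts

end Metatheory

end

end CubicalReals

open CubicalReals CubicalReals.CubicalSet

set_option linter.unusedSectionVars false

/-! ### The internal language of the metatheory: membership, quantifiers, case distinctions. -/

namespace CubicalReals
noncomputable section

section Metatheory

variable {E : Type u} [Category.{v} E]

/-! Arguments are phrased with elements: a map `K ⟶ A` is an element of `A` in context `K`, and `Mem
m x` says that `x` lifts along `m`.

The candidate for the type of reals can be written down directly. With `U.obj` the exponential of
`Ω` by the rationals in `E`, `Δ(U.obj)` is the exponential in cubical sets, because maps into a
constant cubical set do not change under restriction. For `Ω`-valued predicates, closedness is a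
universal statement, so it cuts out a subobject already in `E`. Boundedness is the truncation of a
map between constant cubical sets, and locatedness is a dependent product, over pairs `a < b`, of
such a truncation. The inclusion `ι` is the fibre product of these three h-propositional fibrations.
That `χ` factors through `ι` exactly when `El(χ)` is a cocut then follows by comparing universal
properties (`CutData.mem_incl_iff_isCocut`). Maps in both directions between `El(χ)` and `El(χ')`
force `χ = χ'` by extensionality of `t`, which gives uniqueness up to homotopy since `ι` is
h-propositional.

The substance is that every cocut `c` over `Y` has the same sections as some `El(χ)`
(`IsCocut.exists_represents`). Three facts carry this.

First, mere existence is actual existence on global points (`MerelyInhabited.exists_points`). For `w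
: W ⟶ Z`, the right adjoint `codisc` of `Γ` yields a universal `P` over `Z` whose global points are
lifted to `W`. It is an h-proposition: a homotopy in `P` only has to be given on points, where a map
to `2` separates the endpoints. If paths lift along `w`, it is a fibration: open boxes are
complemented on points, and the missing points receive values by path lifting. Hence a truncation of
`w` maps to `P`.

Second, applied to locatedness in the constant context of all points of `Y` and all pairs `a < b`,
this gives a function to `2` that decides between `a ∉ c` and `b ∈ c` (`IsLocated.exists_decision`).
By closedness, `q ∈ c` at a point holds iff for all `n` the decision for `q < q + 1/(n+1)` is in
favour of membership. This is a `Π⁰₁` condition, so `c` restricted to points is classified by a map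
`θ` from `Γ Y` to `U.obj`.

Third, fibrations lift paths, so `θ` takes equal values at the vertices of a line in `Y`. Any two
vertices of a cube are joined by lines (`restrict_eq_restrictZero`), so evaluation of `θ` at the
vertex with all coordinates `0` is a map `χ : Y ⟶ Δ(U.obj)`. It represents `c` in all dimensions.
Membership restricts to vertices; conversely, if `a` belongs to `c` at that vertex, then `a ∉ c` is
impossible, so locatedness gives `b ∈ c` for all `b > a`, and closedness gives `a ∈ c`. -/

/-- The element `x` of `B` lies in the subobject `m`. -/
def Mem {A B K : E} (m : A ⟶ B) (x : K ⟶ B) : Prop := ∃ l : K ⟶ A, l ≫ m = x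

theorem Mem.comp {A B K L : E} {m : A ⟶ B} {x : K ⟶ B} (h : Mem m x) (σ : L ⟶ K) :
    Mem m (σ ≫ x) := by
  obtain ⟨l, rfl⟩ := h
  exact ⟨σ ≫ l, by simp⟩

variable [HasFiniteLimits E]

attribute [local simp] pullback.lift_fst pullback.lift_snd pullback.lift_fst_assoc
  pullback.lift_snd_assoc prod.lift_fst prod.lift_snd prod.lift_fst_assoc prod.lift_snd_assoc

theorem mem_equalizer_iff {A X K : E} (f g : A ⟶ X) (x : K ⟶ A) :
    Mem (equalizer.ι f g) x ↔ x ≫ f = x ≫ g := by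
  constructor
  · rintro ⟨l, rfl⟩
    rw [Category.assoc, equalizer.condition, Category.assoc]
  · intro h
    exact ⟨equalizer.lift x h, equalizer.lift_ι _ _⟩

theorem prod_lift_eta {A B K : E} (x : K ⟶ A ⨯ B) :
    prod.lift (x ≫ prod.fst) (x ≫ prod.snd) = x := by
  ext <;> simp [prod.lift_fst, prod.lift_snd]

/-! ### Dependent products -/

/-- A dependent product of `g : T ⟶ A` along `f : A ⟶ B`, in terms of elements. -/
structure DepProd {T A B : E} (f : A ⟶ B) (g : T ⟶ A) where
  obj : E
  p : obj ⟶ B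
  app {K : E} (d : K ⟶ obj) (a : K ⟶ A) (h : d ≫ p = a ≫ f) : K ⟶ T
  app_over {K : E} (d : K ⟶ obj) (a : K ⟶ A) (h : d ≫ p = a ≫ f) : app d a h ≫ g = a
  app_nat {L K : E} (σ : L ⟶ K) (d : K ⟶ obj) (a : K ⟶ A) (h : d ≫ p = a ≫ f)
    (h' : (σ ≫ d) ≫ p = (σ ≫ a) ≫ f) : σ ≫ app d a h = app (σ ≫ d) (σ ≫ a) h'
  lam {K : E} (b : K ⟶ B) (k : pullback b f ⟶ T) (hk : k ≫ g = pullback.snd b f) : K ⟶ obj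
  lam_p {K : E} (b : K ⟶ B) (k : pullback b f ⟶ T) (hk : k ≫ g = pullback.snd b f) :
    lam b k hk ≫ p = b
  app_lam {L K : E} (σ : L ⟶ K) (b : K ⟶ B) (k : pullback b f ⟶ T)
    (hk : k ≫ g = pullback.snd b f) (a : L ⟶ A) (h : (σ ≫ lam b k hk) ≫ p = a ≫ f)
    (h' : σ ≫ b = a ≫ f) : app (σ ≫ lam b k hk) a h = pullback.lift σ a h' ≫ k
  ext {K : E} (d d' : K ⟶ obj) (h : d ≫ p = d' ≫ p)
    (w : ∀ {L : E} (σ : L ⟶ K) (a : L ⟶ A) (h₁ : (σ ≫ d) ≫ p = a ≫ f)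
      (h₂ : (σ ≫ d') ≫ p = a ≫ f), app (σ ≫ d) a h₁ = app (σ ≫ d') a h₂) : d = d'

theorem DepProd.app_congr {T A B : E} {f : A ⟶ B} {g : T ⟶ A} (D : DepProd f g) {K : E}
    {d d' : K ⟶ D.obj} {a a' : K ⟶ A} (hd : d = d') (ha : a = a') (h : d ≫ D.p = a ≫ f)
    (h' : d' ≫ D.p = a' ≫ f) : D.app d a h = D.app d' a' h' := by
  subst hd ha; rfl

/-- This is the right adjoint of the pullback functor, unwound. The counit is evaluation,
transposition is `lam`, and injectivity of transposition is extensionality. -/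
theorem exists_depProd [LocallyCartesianClosed E] {T A B : E} (f : A ⟶ B) (g : T ⟶ A) :
    Nonempty (DepProd f g) := by
  have := LocallyCartesianClosed.isLeftAdjoint_pullback f
  let adj := Adjunction.ofIsLeftAdjoint (Over.pullback f)
  let D := (Over.pullback f).rightAdjoint.obj (Over.mk g)
  let e : (Over.pullback f).obj D ⟶ Over.mk g := adj.counit.app (Over.mk g)
  have he : e.left ≫ g = pullback.snd D.hom f := Over.w e
  have huniv : ∀ {K : E} (b : K ⟶ B) (k : pullback b f ⟶ T) (hk : k ≫ g = pullback.snd b f),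
      ∃ (u : K ⟶ D.left) (h : u ≫ D.hom = b), pullback.lift (pullback.fst b f ≫ u)
        (pullback.snd b f) (by rw [Category.assoc, h, pullback.condition]) ≫ e.left = k := by
    intro K b k hk
    let k' : (Over.pullback f).obj (Over.mk b) ⟶ Over.mk g := Over.homMk k hk
    let u := adj.homEquiv _ _ k'
    have hu : (Over.pullback f).map u ≫ e = k' := by
      have := (adj.homEquiv _ _).symm_apply_apply k'
      rwa [Adjunction.homEquiv_counit] at this
    refine ⟨u.left, Over.w u, ?_⟩
    have := congrArg CommaMorphism.left hu
    exact this
  have hext : ∀ {K : E} (b : K ⟶ B) (u u' : K ⟶ D.left) (h : u ≫ D.hom = b)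
      (h' : u' ≫ D.hom = b), pullback.lift (pullback.fst b f ≫ u)
        (pullback.snd b f) (by rw [Category.assoc, h, pullback.condition]) ≫ e.left =
        pullback.lift (pullback.fst b f ≫ u')
        (pullback.snd b f) (by rw [Category.assoc, h', pullback.condition]) ≫ e.left → u = u' := by
    intro K b u u' h h' w
    let v : Over.mk b ⟶ D := Over.homMk u h
    let v' : Over.mk b ⟶ D := Over.homMk u' h'
    have : v = v' := by
      apply (adj.homEquiv _ _).symm.injective
      rw [Adjunction.homEquiv_counit, Adjunction.homEquiv_counit]
      ext
      exact w
    exact congrArg CommaMorphism.left this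
  exact ⟨{
    obj := D.left
    p := D.hom
    app := fun d a h => pullback.lift d a h ≫ e.left
    app_over := by intro K d a h; rw [Category.assoc, he, pullback.lift_snd]
    app_nat := by
      intro L K σ d a h h'
      rw [← Category.assoc]; congr 1
      apply pullback.hom_ext <;> simp
    lam := fun b k hk => (huniv b k hk).choose
    lam_p := fun b k hk => (huniv b k hk).choose_spec.choose
    app_lam := by
      intro L K σ b k hk a h h'
      refine Eq.trans ?_ (congrArg _ (huniv b k hk).choose_spec.choose_spec)
      rw [← Category.assoc]; congr 1
      apply pullback.hom_ext <;> simp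
    ext := by
      intro K d d' h w
      refine hext _ d d' h rfl ?_
      have := w (pullback.fst (d' ≫ D.hom) f) (pullback.snd _ _)
        (by rw [Category.assoc, h, pullback.condition])
        (by rw [Category.assoc, pullback.condition])
      exact this }⟩

/-- A choice of dependent products. -/
def depProd [LocallyCartesianClosed E] {T A B : E} (f : A ⟶ B) (g : T ⟶ A) : DepProd f g :=
  (exists_depProd f g).some

/-- Universal quantification of a subobject. -/
theorem exists_forall_sub [LocallyCartesianClosed E] {A B T : E} (f : A ⟶ B) (m : T ⟶ A)
    [Mono m] : ∃ (D : E) (i : D ⟶ B), Mono i ∧ ∀ {K : E} (b : K ⟶ B), Mem i b ↔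
      ∀ {L : E} (σ : L ⟶ K) (a : L ⟶ A), a ≫ f = σ ≫ b → Mem m a := by
  let P := depProd f m
  refine ⟨P.obj, P.p, ⟨fun d d' h => ?_⟩, ?_⟩
  · refine P.ext d d' h fun _ a h₁ h₂ => ?_
    rw [← cancel_mono m, P.app_over, P.app_over]
  · intro K b
    constructor
    · rintro ⟨l, rfl⟩ L σ a h
      exact ⟨P.app (σ ≫ l) a (by rw [h, Category.assoc]), P.app_over _ _ _⟩
    · intro h
      -- The hypothesis is needed only at the generic argument over `b`.
      obtain ⟨k, hk⟩ := h (pullback.fst b f) (pullback.snd b f) pullback.condition.symm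
      exact ⟨P.lam b k hk, P.lam_p _ _ _⟩

/-! ### Case distinctions -/

section Extensive

variable [FinitaryExtensive E]

omit [HasFiniteLimits E] in
-- The van Kampen property of coproducts in an extensive category: a decomposition of `S'` lying
-- over a decomposition of `S` is the same as two pullback squares.
theorem isColimit_iff_isPullback {X Y S X' Y' S' : E} {i : X ⟶ S} {j : Y ⟶ S}
    (hc : IsColimit (BinaryCofan.mk i j)) {i' : X' ⟶ S'} {j' : Y' ⟶ S'} {a : X' ⟶ X}
    {b : Y' ⟶ Y} {f : S' ⟶ S} (h₁ : i' ≫ f = a ≫ i) (h₂ : j' ≫ f = b ≫ j) :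
    Nonempty (IsColimit (BinaryCofan.mk i' j')) ↔ IsPullback i' a f i ∧ IsPullback j' b f j :=
  (BinaryCofan.isVanKampen_iff (BinaryCofan.mk i j)).mp (FinitaryExtensive.vanKampen _ hc)
    (BinaryCofan.mk i' j') a b f h₁.symm h₂.symm

omit [HasFiniteLimits E] in
theorem isColimit_cases {K X Y : E} (e : K ⟶ X ⨿ Y) :
    Nonempty (IsColimit (BinaryCofan.mk (pullback.fst e (coprod.inl : X ⟶ X ⨿ Y))
      (pullback.fst e (coprod.inr : Y ⟶ X ⨿ Y)))) :=
  (isColimit_iff_isPullback (coprodIsCoprod X Y) pullback.condition pullback.condition).mpr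
    ⟨IsPullback.of_hasPullback _ _, IsPullback.of_hasPullback _ _⟩

/-- Proof by cases in the internal language. The two pullbacks of `e` cover `K`, so an equation may
be tested in contexts where `e` is known to be on one side. -/
theorem hom_ext_cases {K X Y Z : E} (e : K ⟶ X ⨿ Y) {x y : K ⟶ Z}
    (h₁ : ∀ {L : E} (σ : L ⟶ K) (a : L ⟶ X), σ ≫ e = a ≫ coprod.inl → σ ≫ x = σ ≫ y)
    (h₂ : ∀ {L : E} (σ : L ⟶ K) (a : L ⟶ Y), σ ≫ e = a ≫ coprod.inr → σ ≫ x = σ ≫ y) :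
    x = y :=
  BinaryCofan.IsColimit.hom_ext (isColimit_cases e).some
    (h₁ _ _ pullback.condition) (h₂ _ _ pullback.condition)

omit [HasFiniteLimits E] in
theorem isInitial_of_inl_eq_inr {K X Y : E} (a : K ⟶ X) (b : K ⟶ Y)
    (h : a ≫ (coprod.inl : X ⟶ X ⨿ Y) = b ≫ coprod.inr) : Nonempty (IsInitial K) := by
  have := FinitaryExtensive.isPullback_initial_to_binaryCofan (coprodIsCoprod X Y)
  exact ⟨initialIsInitial.ofStrict (this.lift (W := K) a b h)⟩

/-- The object `2`. -/
abbrev two (E : Type u) [Category.{v} E] [HasFiniteLimits E] [FinitaryExtensive E] : E :=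
  (⊤_ E) ⨿ (⊤_ E)

/-- The left element of `2` in context `K`. -/
def left (K : E) : K ⟶ two E := terminal.from K ≫ coprod.inl

/-- The right element of `2` in context `K`. -/
def right (K : E) : K ⟶ two E := terminal.from K ≫ coprod.inr

@[simp] theorem comp_left {K L : E} (σ : L ⟶ K) : σ ≫ left K = left L := by
  simp [left]

@[simp] theorem comp_right {K L : E} (σ : L ⟶ K) : σ ≫ right K = right L := by
  simp [right]

theorem comp_inl_eq_left {K : E} (a : K ⟶ ⊤_ E) : a ≫ (coprod.inl : _ ⟶ two E) = left K := by
  rw [left, Subsingleton.elim a (terminal.from K)]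

theorem comp_inr_eq_right {K : E} (a : K ⟶ ⊤_ E) : a ≫ (coprod.inr : _ ⟶ two E) = right K := by
  rw [right, Subsingleton.elim a (terminal.from K)]

theorem hom_ext_two {K Z : E} (e : K ⟶ two E) {x y : K ⟶ Z}
    (h₁ : ∀ {L : E} (σ : L ⟶ K), σ ≫ e = left L → σ ≫ x = σ ≫ y)
    (h₂ : ∀ {L : E} (σ : L ⟶ K), σ ≫ e = right L → σ ≫ x = σ ≫ y) : x = y :=
  hom_ext_cases e (fun σ a h => h₁ σ (h.trans (comp_inl_eq_left a)))
    (fun σ a h => h₂ σ (h.trans (comp_inr_eq_right a)))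

theorem isInitial_of_left_eq_right {K : E} (h : left K = right K) : Nonempty (IsInitial K) :=
  isInitial_of_inl_eq_inr _ _ h

omit [HasFiniteLimits E] [FinitaryExtensive E] in
theorem hom_ext_isInitial {K Z : E} (h : Nonempty (IsInitial K)) (x y : K ⟶ Z) : x = y :=
  h.some.hom_ext x y

/-- Since `2` has only two elements, an element of it is determined by refuting the other value;
this is the source of all arguments by contradiction below. -/
theorem eq_right_of_not_left {K : E} (e : K ⟶ two E)
    (h : ∀ {L : E} (σ : L ⟶ K), σ ≫ e = left L → Nonempty (IsInitial L)) : e = right K :=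
  hom_ext_two e (fun σ hσ => hom_ext_isInitial (h σ hσ) _ _) (fun σ hσ => by simp [hσ])

theorem eq_left_of_not_right {K : E} (e : K ⟶ two E)
    (h : ∀ {L : E} (σ : L ⟶ K), σ ≫ e = right L → Nonempty (IsInitial L)) : e = left K :=
  hom_ext_two e (fun σ hσ => by simp [hσ]) (fun σ hσ => hom_ext_isInitial (h σ hσ) _ _)

/-- Case distinction. -/
def ite {K Z : E} (e : K ⟶ two E) (x y : K ⟶ Z) : K ⟶ Z :=
  BinaryCofan.IsColimit.desc (isColimit_cases e).some
    (pullback.fst e coprod.inl ≫ x) (pullback.fst e coprod.inr ≫ y)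

theorem ite_left {K L Z : E} (e : K ⟶ two E) (x y : K ⟶ Z) (σ : L ⟶ K) (h : σ ≫ e = left L) :
    σ ≫ ite e x y = σ ≫ x := by
  have := BinaryCofan.IsColimit.inl_desc (isColimit_cases e).some
    (pullback.fst e coprod.inl ≫ x) (pullback.fst e coprod.inr ≫ y)
  change pullback.fst e coprod.inl ≫ ite e x y = _ at this
  rw [← pullback.lift_fst σ (terminal.from L) h, Category.assoc, this, Category.assoc]

theorem ite_right {K L Z : E} (e : K ⟶ two E) (x y : K ⟶ Z) (σ : L ⟶ K) (h : σ ≫ e = right L) :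
    σ ≫ ite e x y = σ ≫ y := by
  have := BinaryCofan.IsColimit.inr_desc (isColimit_cases e).some
    (pullback.fst e coprod.inl ≫ x) (pullback.fst e coprod.inr ≫ y)
  change pullback.fst e coprod.inr ≫ ite e x y = _ at this
  rw [← pullback.lift_fst σ (terminal.from L) h, Category.assoc, this, Category.assoc]

theorem ite_comp {K Z Z' : E} (e : K ⟶ two E) (x y : K ⟶ Z) (f : Z ⟶ Z') :
    ite e x y ≫ f = ite e (x ≫ f) (y ≫ f) :=
  hom_ext_two e (fun σ h => by rw [ite_left _ _ _ _ h, reassoc_of% ite_left e x y σ h])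
    (fun σ h => by rw [ite_right _ _ _ _ h, reassoc_of% ite_right e x y σ h])

theorem ite_self {K Z : E} (e : K ⟶ two E) (x : K ⟶ Z) : ite e x x = x :=
  hom_ext_two e (fun _ h => ite_left _ _ _ _ h) (fun _ h => ite_right _ _ _ _ h)

end Extensive

end Metatheory
end
end CubicalReals

/-! ### Arithmetic of the natural numbers object. -/

namespace CubicalReals
noncomputable section

section Arithmetic

variable {E : Type u} [Category.{v} E] [HasFiniteLimits E]

attribute [local simp] pullback.lift_fst pullback.lift_snd pullback.lift_fst_assoc
  pullback.lift_snd_assoc prod.lift_fst prod.lift_snd prod.lift_fst_assoc prod.lift_snd_assoc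

namespace NNO

variable (NN : NNO E)

@[simp] theorem comp_zeroAt {K L : E} (σ : L ⟶ K) : σ ≫ NN.zeroAt K = NN.zeroAt L := by
  simp [zeroAt]

@[simp] theorem comp_oneAt {K L : E} (σ : L ⟶ K) : σ ≫ NN.oneAt K = NN.oneAt L := by
  simp [oneAt, ← Category.assoc]

theorem lift_iter_zero {K A X : E} (x : A ⟶ X) (s : X ⟶ X) (a : K ⟶ A) :
    prod.lift a (NN.zeroAt K) ≫ NN.iter x s = a ≫ x := by
  have := congrArg (a ≫ ·) (NN.iter_zero x s)
  simp only [← Category.assoc, prod.comp_lift] at this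
  simpa [zeroAt] using this

theorem lift_iter_succ {K A X : E} (x : A ⟶ X) (s : X ⟶ X) (a : K ⟶ A) (n : K ⟶ NN.N) :
    prod.lift a (n ≫ NN.succ) ≫ NN.iter x s = prod.lift a n ≫ NN.iter x s ≫ s := by
  rw [← NN.iter_succ x s, prod.lift_map_assoc, Category.comp_id]

/-- Induction over `ℕ` for subobjects of `ℕ`. -/
theorem mem_of_induction {D : E} (m : D ⟶ NN.N) [Mono m] (h0 : Mem m NN.zero)
    (hs : ∀ {K : E} (n : K ⟶ NN.N), Mem m n → Mem m (n ≫ NN.succ)) {K : E} (n : K ⟶ NN.N) :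
    Mem m n := by
  obtain ⟨d₀, h₀⟩ := h0
  obtain ⟨s, hs⟩ := hs m ⟨𝟙 _, by simp⟩
  -- Iterating the successor inside the subobject and then including satisfies the recursion of the
  -- second projection, so by uniqueness every natural number lies in the subobject.
  have key : NN.iter d₀ s ≫ m = prod.snd := by
    have e₁ := NN.iter_unique NN.zero NN.succ (NN.iter d₀ s ≫ m)
      (by rw [← Category.assoc, NN.iter_zero, h₀])
      (by rw [← Category.assoc, NN.iter_succ, Category.assoc, Category.assoc, hs])
    have e₂ := NN.iter_unique NN.zero NN.succ (prod.snd : (⊤_ E) ⨯ NN.N ⟶ NN.N)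
      (by rw [prod.lift_snd, Subsingleton.elim (terminal.from (⊤_ E)) (𝟙 _), Category.id_comp])
      (by simp)
    rw [e₁, e₂]
  exact ⟨prod.lift (terminal.from K) n ≫ NN.iter d₀ s, by rw [Category.assoc, key]; simp⟩

/-- Induction over `ℕ` for equations, universally quantified over the fibres of `π`. -/
theorem eq_of_induction [LocallyCartesianClosed E] {F X : E} (π : F ⟶ NN.N) (f g : F ⟶ X)
    (h0 : ∀ {K : E} (x : K ⟶ F), x ≫ π = NN.zeroAt K → x ≫ f = x ≫ g)
    (hs : ∀ {K : E} (n : K ⟶ NN.N), (∀ {L : E} (σ : L ⟶ K) (x : L ⟶ F), x ≫ π = σ ≫ n →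
        x ≫ f = x ≫ g) → ∀ (x : K ⟶ F), x ≫ π = n ≫ NN.succ → x ≫ f = x ≫ g) : f = g := by
  -- Induction runs over the subobject of those `n` on whose whole fibre `f` and `g` agree, and is
  -- then evaluated at the generic element `π`.
  obtain ⟨D, i, hi, h⟩ := exists_forall_sub π (equalizer.ι f g)
  have := (h π).mp (NN.mem_of_induction i ?_ ?_ π) (𝟙 F) (𝟙 F) rfl
  · simpa using (mem_equalizer_iff f g (𝟙 F)).mp this
  · rw [h]
    intro L σ a ha
    exact (mem_equalizer_iff _ _ _).mpr (h0 a (by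
      rw [ha, Subsingleton.elim σ (terminal.from L)]; rfl))
  · intro K n hn
    rw [h] at hn ⊢
    intro L σ a ha
    refine (mem_equalizer_iff _ _ _).mpr (hs (σ ≫ n) ?_ a (by simpa using ha))
    intro L' σ' x hx
    exact (mem_equalizer_iff _ _ _).mp (hn (σ' ≫ σ) x (by simpa using hx))

/-- Induction over `ℕ` for equations with parameters. -/
theorem eq_of_induction_prod [LocallyCartesianClosed E] {A X : E} (f g : A ⨯ NN.N ⟶ X)
    (h0 : ∀ {K : E} (a : K ⟶ A), prod.lift a (NN.zeroAt K) ≫ f = prod.lift a (NN.zeroAt K) ≫ g)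
    (hs : ∀ {K : E} (a : K ⟶ A) (n : K ⟶ NN.N), prod.lift a n ≫ f = prod.lift a n ≫ g →
      prod.lift a (n ≫ NN.succ) ≫ f = prod.lift a (n ≫ NN.succ) ≫ g) : f = g := by
  refine NN.eq_of_induction prod.snd f g ?_ ?_
  · intro K x hx
    rw [← prod_lift_eta x, hx]
    exact h0 _
  · intro K n ih x hx
    rw [← prod_lift_eta x, hx]
    exact hs _ _ (ih (𝟙 K) _ (by simp))

theorem comp_add {K L : E} (σ : L ⟶ K) (x y : K ⟶ NN.N) :
    σ ≫ NN.add x y = NN.add (σ ≫ x) (σ ≫ y) := by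
  simp [add, ← Category.assoc, prod.comp_lift]

theorem comp_mul {K L : E} (σ : L ⟶ K) (x y : K ⟶ NN.N) :
    σ ≫ NN.mul x y = NN.mul (σ ≫ x) (σ ≫ y) := by
  simp [mul, ← Category.assoc, prod.comp_lift]

variable {NN}

theorem add_zero' {K : E} (x : K ⟶ NN.N) : NN.add x (NN.zeroAt K) = x := by
  rw [add, addMap, lift_iter_zero, Category.comp_id]

theorem add_succ {K : E} (x y : K ⟶ NN.N) : NN.add x (y ≫ NN.succ) = NN.add x y ≫ NN.succ := by
  rw [add, addMap, lift_iter_succ, add, addMap, Category.assoc]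

/-- The state of the iteration that defines multiplication is a pair; its first component merely
carries the fixed factor along. -/
theorem lift_mulIter_fst {K : E} [LocallyCartesianClosed E] (x y : K ⟶ NN.N) : prod.lift x y ≫
    NN.iter (prod.lift (𝟙 NN.N) (NN.zeroAt NN.N))
      (prod.lift prod.fst (NN.add prod.snd prod.fst)) ≫ prod.fst = x := by
  have : NN.iter (prod.lift (𝟙 NN.N) (NN.zeroAt NN.N))
      (prod.lift prod.fst (NN.add prod.snd prod.fst)) ≫ prod.fst = prod.fst := by
    refine NN.eq_of_induction_prod _ _ ?_ ?_
    · intro K a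
      rw [← Category.assoc, lift_iter_zero]; simp
    · intro K a n ih
      rw [← Category.assoc, lift_iter_succ]
      simpa using ih
  rw [this, prod.lift_fst]

theorem mul_zero' {K : E} (x : K ⟶ NN.N) : NN.mul x (NN.zeroAt K) = NN.zeroAt K := by
  rw [mul, mulMap, ← Category.assoc, lift_iter_zero]; simp

theorem mul_succ {K : E} [LocallyCartesianClosed E] (x y : K ⟶ NN.N) :
    NN.mul x (y ≫ NN.succ) = NN.add (NN.mul x y) x := by
  rw [mul, mulMap, ← Category.assoc, lift_iter_succ]
  simp only [Category.assoc, prod.lift_snd, comp_add]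
  rw [lift_mulIter_fst]
  simp [mul, mulMap]

section

variable [LocallyCartesianClosed E]

/-- Induction over `ℕ` for an equation between elements. -/
theorem eq_of_induction_elements {K X : E} (F G : ∀ {L : E} (_ : L ⟶ K) (_ : L ⟶ NN.N), (L ⟶ X))
    (hF : ∀ {L L' : E} (τ : L' ⟶ L) (σ : L ⟶ K) (n : L ⟶ NN.N), τ ≫ F σ n = F (τ ≫ σ) (τ ≫ n))
    (hG : ∀ {L L' : E} (τ : L' ⟶ L) (σ : L ⟶ K) (n : L ⟶ NN.N), τ ≫ G σ n = G (τ ≫ σ) (τ ≫ n))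
    (h0 : ∀ {L : E} (σ : L ⟶ K), F σ (NN.zeroAt L) = G σ (NN.zeroAt L))
    (hs : ∀ {L : E} (σ : L ⟶ K) (n : L ⟶ NN.N), F σ n = G σ n →
      F σ (n ≫ NN.succ) = G σ (n ≫ NN.succ)) (n : K ⟶ NN.N) : F (𝟙 K) n = G (𝟙 K) n := by
  have := NN.eq_of_induction_prod (A := K) (F prod.fst prod.snd) (G prod.fst prod.snd)
    (by intro L a; simpa [hF, hG] using h0 a) (by
      intro L a n ih
      simp only [hF, hG, prod.lift_fst, prod.lift_snd] at ih ⊢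
      exact hs a n ih)
  have := congrArg (prod.lift (𝟙 K) n ≫ ·) this
  simpa [hF, hG] using this

theorem zero_add' {K : E} (x : K ⟶ NN.N) : NN.add (NN.zeroAt K) x = x :=
  eq_of_induction_elements (fun {L} _ n => NN.add (NN.zeroAt L) n) (fun _ n => n)
    (by simp [comp_add]) (by simp) (by simp [add_zero']) (by intro L _ n h; rw [add_succ, h]) x

theorem succ_add {K : E} (x y : K ⟶ NN.N) : NN.add (x ≫ NN.succ) y = NN.add x y ≫ NN.succ := by
  have := eq_of_induction_elements (NN := NN) (fun {L} σ n => NN.add (σ ≫ x ≫ NN.succ) n)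
    (fun σ n => NN.add (σ ≫ x) n ≫ NN.succ)
    (by simp [comp_add]) (by intros; simp [← Category.assoc, comp_add])
    (by simp [add_zero'])
    (by intro L σ n h; simp only [add_succ, h]) y
  simpa using this

theorem add_comm' {K : E} (x y : K ⟶ NN.N) : NN.add x y = NN.add y x := by
  have := eq_of_induction_elements (NN := NN) (fun {L} σ n => NN.add (σ ≫ x) n)
    (fun σ n => NN.add n (σ ≫ x))
    (by simp [comp_add]) (by simp [comp_add])
    (by simp [add_zero', zero_add'])
    (by intro L σ n h; simp only [add_succ, succ_add, h]) y
  simpa using this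

theorem add_assoc' {K : E} (x y z : K ⟶ NN.N) :
    NN.add (NN.add x y) z = NN.add x (NN.add y z) := by
  have := eq_of_induction_elements (NN := NN)
    (fun {L} σ n => NN.add (NN.add (σ ≫ x) (σ ≫ y)) n)
    (fun σ n => NN.add (σ ≫ x) (NN.add (σ ≫ y) n))
    (by simp [comp_add]) (by simp [comp_add])
    (by simp [add_zero'])
    (by intro L σ n h; simp only [add_succ, h]) z
  simpa using this

theorem zero_mul' {K : E} (x : K ⟶ NN.N) : NN.mul (NN.zeroAt K) x = NN.zeroAt K :=
  eq_of_induction_elements (fun {L} _ n => NN.mul (NN.zeroAt L) n) (fun {L} _ _ => NN.zeroAt L)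
    (by simp [comp_mul]) (by simp) (by simp [mul_zero'])
    (by intro L _ n h; rw [mul_succ, h, add_zero']) x

theorem succ_mul {K : E} (x y : K ⟶ NN.N) :
    NN.mul (x ≫ NN.succ) y = NN.add (NN.mul x y) y := by
  have := eq_of_induction_elements (NN := NN) (fun {L} σ n => NN.mul (σ ≫ x ≫ NN.succ) n)
    (fun σ n => NN.add (NN.mul (σ ≫ x) n) n)
    (by simp [comp_mul]) (by simp [comp_mul, comp_add])
    (by simp [add_zero', mul_zero'])
    (by
      intro L σ n h
      simp only [mul_succ, h]
      rw [← Category.assoc, add_succ, add_succ, add_assoc', add_assoc', add_comm' n]) y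
  simpa using this

theorem mul_comm' {K : E} (x y : K ⟶ NN.N) : NN.mul x y = NN.mul y x := by
  have := eq_of_induction_elements (NN := NN) (fun {L} σ n => NN.mul (σ ≫ x) n)
    (fun σ n => NN.mul n (σ ≫ x))
    (by simp [comp_mul]) (by simp [comp_mul])
    (by simp [mul_zero', zero_mul'])
    (by intro L σ n h; simp only [mul_succ, succ_mul, h]) y
  simpa using this

theorem mul_add' {K : E} (x y z : K ⟶ NN.N) :
    NN.mul x (NN.add y z) = NN.add (NN.mul x y) (NN.mul x z) := by
  have := eq_of_induction_elements (NN := NN)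
    (fun {L} σ n => NN.mul (σ ≫ x) (NN.add (σ ≫ y) n))
    (fun σ n => NN.add (NN.mul (σ ≫ x) (σ ≫ y)) (NN.mul (σ ≫ x) n))
    (by simp [comp_add, comp_mul]) (by simp [comp_add, comp_mul])
    (by simp [add_zero', mul_zero'])
    (by intro L σ n h; simp only [add_succ, mul_succ, h, add_assoc']) z
  simpa using this

theorem mul_assoc' {K : E} (x y z : K ⟶ NN.N) :
    NN.mul (NN.mul x y) z = NN.mul x (NN.mul y z) := by
  have := eq_of_induction_elements (NN := NN)
    (fun {L} σ n => NN.mul (NN.mul (σ ≫ x) (σ ≫ y)) n)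
    (fun σ n => NN.mul (σ ≫ x) (NN.mul (σ ≫ y) n))
    (by simp [comp_mul]) (by simp [comp_mul])
    (by simp [mul_zero'])
    (by intro L σ n h; simp only [mul_succ, mul_add', h]) z
  simpa using this

theorem mul_one' {K : E} (x : K ⟶ NN.N) : NN.mul x (NN.oneAt K) = x := by
  rw [oneAt, mul_succ, mul_zero', zero_add']

/-- The elements of `ℕ` in context `K` form a commutative semiring. -/
instance (K : E) : CommSemiring (K ⟶ NN.N) where
  add := NN.add
  zero := NN.zeroAt K
  mul := NN.mul
  one := NN.oneAt K
  add_assoc := add_assoc'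
  zero_add := zero_add'
  add_zero := add_zero'
  add_comm := add_comm'
  zero_mul := zero_mul'
  mul_zero := mul_zero'
  mul_assoc := mul_assoc'
  mul_comm := mul_comm'
  mul_one := mul_one'
  one_mul x := (mul_comm' _ _).trans (mul_one' _)
  nsmul := @nsmulRec _ ⟨NN.zeroAt K⟩ ⟨NN.add⟩
  left_distrib := mul_add'
  right_distrib x y z := by
    change NN.mul (NN.add x y) z = NN.add (NN.mul x z) (NN.mul y z)
    rw [mul_comm', mul_add', mul_comm' z x, mul_comm' z y]

theorem add_def {K : E} (x y : K ⟶ NN.N) : NN.add x y = x + y := rfl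
theorem mul_def {K : E} (x y : K ⟶ NN.N) : NN.mul x y = x * y := rfl
theorem zero_def (K : E) : NN.zeroAt K = 0 := rfl
theorem one_def (K : E) : NN.oneAt K = 1 := rfl

theorem succ_def {K : E} (x : K ⟶ NN.N) : x ≫ NN.succ = x + 1 := by
  change _ = NN.add x (NN.zeroAt K ≫ NN.succ)
  rw [add_succ, add_zero']

theorem comp_add_def {K L : E} (σ : L ⟶ K) (x y : K ⟶ NN.N) :
    σ ≫ (x + y) = σ ≫ x + σ ≫ y := comp_add NN σ x y
theorem comp_mul_def {K L : E} (σ : L ⟶ K) (x y : K ⟶ NN.N) :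
    σ ≫ (x * y) = (σ ≫ x) * (σ ≫ y) := comp_mul NN σ x y
theorem comp_zero_def {K L : E} (σ : L ⟶ K) : σ ≫ (0 : K ⟶ NN.N) = 0 := comp_zeroAt NN σ
theorem comp_one_def {K L : E} (σ : L ⟶ K) : σ ≫ (1 : K ⟶ NN.N) = 1 := comp_oneAt NN σ

/-- The predecessor map. -/
def pred : NN.N ⟶ NN.N :=
  prod.lift (terminal.from _) (𝟙 _) ≫
    NN.iter (prod.lift NN.zero NN.zero) (prod.lift (prod.snd) (prod.snd ≫ NN.succ)) ≫ prod.fst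

/-- The predecessor is the first component of an iteration on pairs (previous value, current value);
the second component is the counter itself. -/
theorem pred_aux : NN.iter (prod.lift NN.zero NN.zero)
    (prod.lift (prod.snd) (prod.snd ≫ NN.succ)) ≫ prod.snd = prod.snd := by
  refine NN.eq_of_induction_prod _ _ ?_ ?_
  · intro K a
    rw [← Category.assoc, lift_iter_zero]
    simp [zeroAt, Subsingleton.elim a (terminal.from K)]
  · intro K a n ih
    rw [← Category.assoc, lift_iter_succ]
    simp only [Category.assoc, prod.lift_snd] at ih ⊢
    rw [reassoc_of% ih]

theorem zero_pred {K : E} : (0 : K ⟶ NN.N) ≫ pred = 0 := by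
  rw [← zero_def, pred, ← Category.assoc, prod.comp_lift, ← Category.assoc, Category.comp_id,
    lift_iter_zero, Subsingleton.elim (NN.zeroAt K ≫ _) (terminal.from K)]
  simp [zeroAt]

theorem succ_pred {K : E} (n : K ⟶ NN.N) : (n + 1) ≫ pred = n := by
  rw [← succ_def, pred, ← Category.assoc, prod.comp_lift, ← Category.assoc, Category.comp_id,
    lift_iter_succ]
  simp only [Category.assoc, prod.lift_fst, pred_aux, prod.lift_snd]

theorem add_one_cancel {K : E} {x y : K ⟶ NN.N} (h : x + 1 = y + 1) : x = y := by
  rw [← succ_pred x, h, succ_pred]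

/-- Truncated subtraction. -/
def monus {K : E} (x y : K ⟶ NN.N) : K ⟶ NN.N := prod.lift x y ≫ NN.iter (𝟙 _) pred

theorem comp_monus {K L : E} (σ : L ⟶ K) (x y : K ⟶ NN.N) :
    σ ≫ monus x y = monus (σ ≫ x) (σ ≫ y) := by
  simp [monus, ← Category.assoc, prod.comp_lift]

theorem monus_zero {K : E} (x : K ⟶ NN.N) : monus x 0 = x := by
  rw [← zero_def, monus, lift_iter_zero, Category.comp_id]

theorem monus_succ {K : E} (x y : K ⟶ NN.N) : monus x (y + 1) = monus x y ≫ pred := by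
  rw [← succ_def, monus, lift_iter_succ, monus, Category.assoc]

theorem zero_monus {K : E} (x : K ⟶ NN.N) : monus 0 x = 0 :=
  eq_of_induction_elements (fun {L} _ n => monus (0 : L ⟶ NN.N) n) (fun {L} _ _ => 0)
    (by simp [comp_monus, comp_zero_def]) (by simp [comp_zero_def])
    (by simp [zero_def, monus_zero])
    (by intro L _ n h; rw [succ_def, monus_succ, h, zero_pred]) x

theorem succ_monus_succ {K : E} (x y : K ⟶ NN.N) : monus (x + 1) (y + 1) = monus x y := by
  have := eq_of_induction_elements (NN := NN)
    (fun {L} σ n => monus (σ ≫ x + 1) (n + 1)) (fun {L} σ n => monus (σ ≫ x) n)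
    (by simp [comp_monus, comp_add_def, comp_one_def]) (by simp [comp_monus])
    (by
      intro L σ
      rw [zero_def, monus_succ, monus_zero, monus_zero, succ_pred])
    (by intro L σ n h; rw [succ_def, monus_succ, h, monus_succ]) y
  simpa using this

theorem add_monus_cancel {K : E} (x y : K ⟶ NN.N) : monus (x + y) y = x := by
  have := eq_of_induction_elements (NN := NN)
    (fun {L} σ n => monus (σ ≫ x + n) n) (fun {L} σ n => σ ≫ x)
    (by simp [comp_monus, comp_add_def]) (by simp)
    (by intro L σ; simp [zero_def, monus_zero])
    (by intro L σ n h; simp only [succ_def, ← add_assoc, succ_monus_succ, h]) y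
  simpa using this

theorem add_cancel {K : E} {x y z : K ⟶ NN.N} (h : x + z = y + z) : x = y := by
  rw [← add_monus_cancel x z, h, add_monus_cancel]

section Extensive

variable [FinitaryExtensive E]

/-- Whether a natural number is positive. -/
def isPos : NN.N ⟶ two E :=
  prod.lift (terminal.from _) (𝟙 _) ≫ NN.iter coprod.inr (left _)

theorem zero_isPos {K : E} : (0 : K ⟶ NN.N) ≫ isPos = right K := by
  rw [← zero_def, isPos, ← Category.assoc, prod.comp_lift, Category.comp_id,
    lift_iter_zero, comp_inr_eq_right]

theorem succ_isPos {K : E} (n : K ⟶ NN.N) : (n + 1) ≫ isPos = left K := by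
  rw [← succ_def, isPos, ← Category.assoc, prod.comp_lift, Category.comp_id,
    lift_iter_succ, ← Category.assoc, comp_left]

/-- Every number is decidably zero or a successor. The proof is an induction in which the induction
hypothesis plays no role. -/
theorem eq_ite_isPos {K : E} (n : K ⟶ NN.N) :
    n = ite (n ≫ isPos) (n ≫ pred + 1) 0 := by
  have key := NN.eq_of_induction (𝟙 NN.N) (𝟙 NN.N) (ite isPos (pred + 1) 0)
    (by
      intro K x hx
      rw [Category.comp_id] at hx
      rw [ite_right _ _ _ _ (by rw [hx, zero_def, zero_isPos]), hx, Category.comp_id, zero_def,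
        comp_zero_def])
    (by
      intro K n _ x hx
      rw [Category.comp_id, succ_def] at hx
      rw [ite_left _ _ _ _ (by rw [hx, succ_isPos]), hx, Category.comp_id, comp_add_def,
        comp_one_def, succ_pred])
  have := congrArg (n ≫ ·) key
  simp only [Category.comp_id] at this
  refine this.trans (hom_ext_two (n ≫ isPos) ?_ ?_)
  · intro L σ h
    rw [ite_left _ _ _ _ h, ← Category.assoc,
      ite_left _ _ _ _ (by rw [Category.assoc, h])]
    simp [comp_add_def, comp_one_def]
  · intro L σ h
    rw [ite_right _ _ _ _ h, ← Category.assoc,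
      ite_right _ _ _ _ (by rw [Category.assoc, h])]
    simp [comp_zero_def]

theorem eq_zero_of_isPos {K : E} (n : K ⟶ NN.N) (h : n ≫ isPos = right K) : n = 0 := by
  rw [eq_ite_isPos n, ← Category.id_comp (ite _ _ _), ite_right _ _ _ _ (by simpa using h),
    Category.id_comp]

theorem eq_succ_of_isPos {K : E} (n : K ⟶ NN.N) (h : n ≫ isPos = left K) :
    n = n ≫ pred + 1 := by
  conv_lhs => rw [eq_ite_isPos n, ← Category.id_comp (ite _ _ _),
    ite_left _ _ _ _ (by simpa using h), Category.id_comp]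

/-- `isPos` separates successors from zero, and the two elements of `2` coincide only in an empty
context. -/
theorem isInitial_of_succ_eq_zero {K : E} (n : K ⟶ NN.N) (h : n + 1 = 0) :
    Nonempty (IsInitial K) := by
  apply isInitial_of_left_eq_right
  rw [← succ_isPos n, h, zero_isPos]

/-- An equation between elements holds if it holds when `n` is zero and when it is a successor. -/
theorem hom_ext_nat {K X : E} (n : K ⟶ NN.N) {x y : K ⟶ X}
    (h0 : ∀ {L : E} (σ : L ⟶ K), σ ≫ n = 0 → σ ≫ x = σ ≫ y)
    (hs : ∀ {L : E} (σ : L ⟶ K) (m : L ⟶ NN.N), σ ≫ n = m + 1 → σ ≫ x = σ ≫ y) : x = y :=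
  hom_ext_two (n ≫ isPos)
    (fun σ h => hs σ ((σ ≫ n) ≫ pred) (eq_succ_of_isPos _ (by simpa using h)))
    (fun σ h => h0 σ (eq_zero_of_isPos _ (by simpa using h)))

/-- Both sides are the maximum of `x` and `y`. The induction is on `y` for all `x` at once, with a
case split on `x` in the successor step. -/
theorem add_monus_comm {K : E} (x y : K ⟶ NN.N) : x + monus y x = y + monus x y := by
  have key := NN.eq_of_induction (F := NN.N ⨯ NN.N) prod.snd
    (prod.fst + monus prod.snd prod.fst) (prod.snd + monus prod.fst prod.snd)
    (by
      intro K x hx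
      rw [zero_def] at hx
      simp [comp_add_def, comp_monus, hx, zero_monus, monus_zero])
    (by
      intro K n ih x hx
      rw [succ_def] at hx
      simp only [comp_add_def, comp_monus, hx]
      refine hom_ext_nat (x ≫ prod.fst) ?_ ?_
      · intro L σ h
        simp [comp_add_def, comp_monus, h, zero_monus, monus_zero, comp_one_def]
      · intro L σ m h
        have := ih σ (prod.lift m (σ ≫ n)) (by simp)
        simp only [comp_add_def, comp_monus, prod.lift_fst, prod.lift_snd] at this
        simp only [comp_add_def, comp_monus, h, succ_monus_succ, comp_one_def]
        rw [add_right_comm, this, add_right_comm])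
  simpa [comp_add_def, comp_monus] using congrArg (prod.lift x y ≫ ·) key

/-- One of the two truncated differences vanishes. Stating this as an equation makes it accessible
to induction; together with `add_monus_comm` it makes the order decidable. -/
theorem monus_mul_monus {K : E} (x y : K ⟶ NN.N) : monus y x * monus x y = 0 := by
  have key := NN.eq_of_induction (F := NN.N ⨯ NN.N) prod.snd
    (monus prod.snd prod.fst * monus prod.fst prod.snd) 0
    (by
      intro K x hx
      rw [zero_def] at hx
      simp [comp_mul_def, comp_monus, hx, zero_monus, monus_zero, comp_zero_def])
    (by
      intro K n ih x hx
      rw [succ_def] at hx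
      simp only [comp_mul_def, comp_monus, hx, comp_zero_def]
      refine hom_ext_nat (x ≫ prod.fst) ?_ ?_
      · intro L σ h
        simp [comp_mul_def, comp_monus, h, zero_monus, monus_zero, comp_zero_def]
      · intro L σ m h
        have := ih σ (prod.lift m (σ ≫ n)) (by simp)
        simp only [comp_mul_def, comp_monus, prod.lift_fst, prod.lift_snd, comp_zero_def] at this
        simp only [comp_mul_def, comp_monus, comp_add_def, h, succ_monus_succ, comp_one_def,
          comp_zero_def, this])
  simpa [comp_mul_def, comp_monus, comp_zero_def] using congrArg (prod.lift x y ≫ ·) key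

theorem eq_add_of_monus_eq_succ {K : E} {x y d : K ⟶ NN.N} (h : monus y x = d + 1) :
    x + d + 1 = y := by
  refine hom_ext_nat (monus x y) ?_ ?_
  · intro L σ hσ
    have := congrArg (σ ≫ ·) (add_monus_comm x y)
    simp only [comp_add_def, hσ, h, comp_one_def] at this ⊢
    rw [add_zero] at this
    rw [← this, add_assoc]
  · intro L σ m hσ
    have := congrArg (σ ≫ ·) (monus_mul_monus x y)
    simp only [comp_mul_def, hσ, h, comp_one_def, comp_add_def, comp_zero_def] at this
    refine hom_ext_isInitial (isInitial_of_succ_eq_zero (m * σ ≫ d + m + σ ≫ d) ?_) _ _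
    rw [← this]; ring

/-- A positive factor cancels from a strict inequality. By decidability it is enough to refute that
the truncated difference of `y` and `x` is zero; in that case `y ≤ x`, and multiplying by `r + 1`
contradicts `h`. -/
theorem exists_lt_of_mul_lt {K : E} {x y r k : K ⟶ NN.N}
    (h : (r + 1) * x + k + 1 = (r + 1) * y) : ∃ d, x + d + 1 = y := by
  refine ⟨monus y x ≫ pred, eq_add_of_monus_eq_succ (eq_succ_of_isPos _ ?_)⟩
  refine eq_left_of_not_right _ fun {L} σ hσ => ?_
  have h0 := eq_zero_of_isPos (σ ≫ monus y x) (by simpa using hσ)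
  have h₁ := congrArg (σ ≫ ·) (add_monus_comm x y)
  simp only [comp_add_def, h0, add_zero] at h₁
  have h₂ := congrArg (σ ≫ ·) h
  simp only [comp_add_def, comp_mul_def, comp_one_def, h₁] at h₂
  refine isInitial_of_succ_eq_zero ((σ ≫ r + 1) * σ ≫ monus x y + σ ≫ k) ?_
  refine add_cancel (z := (σ ≫ r + 1) * σ ≫ y) ?_
  rw [zero_add]
  conv_rhs => rw [← h₂]
  ring

end Extensive

end

end NNO

end Arithmetic

end
end CubicalReals

/-! ### The order of the rational numbers. -/

namespace CubicalReals
noncomputable section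

section RationalOrder

variable {E : Type u} [Category.{v} E] [HasFiniteLimits E]

attribute [local simp] pullback.lift_fst pullback.lift_snd pullback.lift_fst_assoc
  pullback.lift_snd_assoc prod.lift_fst prod.lift_snd prod.lift_fst_assoc prod.lift_snd_assoc

namespace NNO

variable {NN : NNO E}

theorem comp_cross {K L : E} (σ : L ⟶ K) (x y : K ⟶ NN.Frac) :
    σ ≫ NN.cross x y = NN.cross (σ ≫ x) (σ ≫ y) := by
  simp [cross, comp_add, comp_mul]

theorem FracLt.comp {K L : E} {x y : K ⟶ NN.Frac} (h : NN.FracLt x y) (σ : L ⟶ K) :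
    NN.FracLt (σ ≫ x) (σ ≫ y) := by
  obtain ⟨d, hd⟩ := h
  refine ⟨σ ≫ d, ?_⟩
  rw [← comp_cross, ← comp_add, Category.assoc, hd, comp_cross]

variable [LocallyCartesianClosed E]

theorem cross_def {K : E} (x y : K ⟶ NN.Frac) : NN.cross x y =
    (x ≫ prod.fst ≫ prod.fst) * (y ≫ prod.snd + 1) +
      (y ≫ prod.fst ≫ prod.snd) * (x ≫ prod.snd + 1) := by
  rw [← succ_def, ← succ_def, Category.assoc, Category.assoc]; rfl

theorem fracLt_iff {K : E} {x y : K ⟶ NN.Frac} :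
    NN.FracLt x y ↔ ∃ d : K ⟶ NN.N, NN.cross x y + d + 1 = NN.cross y x := by
  simp only [FracLt, succ_def]; rfl

variable [FinitaryExtensive E]

/-- The order respects equality of fractions: inequalities are scaled to a common denominator and
the positive factor is cancelled by `exists_lt_of_mul_lt`. One side is replaced at a time. -/
theorem FracLt.congr {K : E} {x y x' y' : K ⟶ NN.Frac} (h : NN.FracLt x y)
    (hx : NN.cross x x' = NN.cross x' x) (hy : NN.cross y y' = NN.cross y' y) :
    NN.FracLt x' y' := by
  rw [fracLt_iff] at h ⊢
  obtain ⟨d, h⟩ := h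
  have aux : ∃ d, NN.cross x' y + d + 1 = NN.cross y x' := by
    rw [cross_def] at h hx ⊢
    rw [cross_def] at h hx ⊢
    revert h hx
    generalize x ≫ prod.fst ≫ prod.fst = p
    generalize x ≫ prod.fst ≫ prod.snd = q
    generalize x ≫ prod.snd = r
    generalize x' ≫ prod.fst ≫ prod.fst = p'
    generalize x' ≫ prod.fst ≫ prod.snd = q'
    generalize x' ≫ prod.snd = r'
    generalize y ≫ prod.fst ≫ prod.fst = m
    generalize y ≫ prod.fst ≫ prod.snd = w
    generalize y ≫ prod.snd = s
    intro hx h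
    -- The value of `k` is chosen so that `k + 1 = (r' + 1) * (d + 1)`.
    refine exists_lt_of_mul_lt (r := r) (k := r' * d + d + r') ?_
    -- In the absence of subtraction, the negative part of `x` is added to both sides so that `hx`
    -- can be applied.
    refine add_cancel (z := q * (r' + 1) * (s + 1)) ?_
    calc _ = (p' * (r + 1) + q * (r' + 1)) * (s + 1) + w * (r' + 1) * (r + 1)
          + (r' + 1) * (d + 1) := by ring
      _ = (r' + 1) * (p * (s + 1) + w * (r + 1) + d + 1) + q' * (r + 1) * (s + 1) := by
          rw [← hx]; ring
      _ = _ := by rw [h]; ring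
  obtain ⟨d', h'⟩ := aux
  clear h hx
  rw [cross_def] at h' hy ⊢
  rw [cross_def] at h' hy ⊢
  revert h' hy
  generalize y ≫ prod.fst ≫ prod.fst = p
  generalize y ≫ prod.fst ≫ prod.snd = q
  generalize y ≫ prod.snd = r
  generalize y' ≫ prod.fst ≫ prod.fst = p'
  generalize y' ≫ prod.fst ≫ prod.snd = q'
  generalize y' ≫ prod.snd = r'
  generalize x' ≫ prod.fst ≫ prod.fst = m
  generalize x' ≫ prod.fst ≫ prod.snd = w
  generalize x' ≫ prod.snd = s
  intro hy h
  refine exists_lt_of_mul_lt (r := r) (k := r' * d' + d' + r') ?_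
  refine add_cancel (z := q * (r' + 1) * (s + 1)) ?_
  calc _ = (r' + 1) * (m * (r + 1) + q * (s + 1) + d' + 1) + q' * (s + 1) * (r + 1) := by ring
    _ = (p * (r' + 1) + q' * (r + 1)) * (s + 1) + w * (r + 1) * (r' + 1) := by rw [h]; ring
    _ = _ := by rw [hy]; ring

/-- The fraction `x + 1 / (n + 1)`. -/
def approx {K : E} (x : K ⟶ NN.Frac) (n : K ⟶ NN.N) : K ⟶ NN.Frac :=
  prod.lift (prod.lift ((x ≫ prod.fst ≫ prod.fst) * (n + 1) + (x ≫ prod.snd + 1))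
    ((x ≫ prod.fst ≫ prod.snd) * (n + 1))) ((x ≫ prod.snd) * n + x ≫ prod.snd + n)

theorem comp_approx {K L : E} (σ : L ⟶ K) (x : K ⟶ NN.Frac) (n : K ⟶ NN.N) :
    σ ≫ approx x n = approx (σ ≫ x) (σ ≫ n) := by
  simp [approx, comp_add_def, comp_mul_def, comp_one_def, prod.comp_lift]

theorem fracLt_approx {K : E} (x : K ⟶ NN.Frac) (n : K ⟶ NN.N) : NN.FracLt x (approx x n) := by
  rw [fracLt_iff]
  -- With `r + 1` the denominator of `x`, the cross products differ by `(r + 1) ^ 2`, of which this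
  -- is the predecessor.
  refine ⟨(x ≫ prod.snd) * (x ≫ prod.snd) + (x ≫ prod.snd) + (x ≫ prod.snd), ?_⟩
  rw [cross_def, cross_def]
  simp only [approx, prod.lift_fst, prod.lift_snd, prod.lift_fst_assoc]
  ring

/-- If `x < y` have denominators `r + 1` and `r' + 1`, they differ by at least `1 / ((r + 1) (r' +
1))`, which exceeds `1 / (n + 1)` for `n = (r + 1) (r' + 1)`. The bound `n` is thus an explicit
function of `x` and `y`. -/
theorem approx_fracLt {K : E} {x y : K ⟶ NN.Frac} (h : NN.FracLt x y) :
    NN.FracLt (approx x ((x ≫ prod.snd + 1) * (y ≫ prod.snd + 1))) y := by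
  rw [fracLt_iff] at h ⊢
  obtain ⟨d, h⟩ := h
  refine ⟨(x ≫ prod.snd + 1) * (y ≫ prod.snd + 1) * d + d, ?_⟩
  rw [cross_def, cross_def] at h ⊢
  simp only [approx, prod.lift_fst, prod.lift_snd, prod.lift_fst_assoc]
  revert h
  generalize x ≫ prod.fst ≫ prod.fst = p
  generalize x ≫ prod.fst ≫ prod.snd = q
  generalize x ≫ prod.snd = r
  generalize y ≫ prod.fst ≫ prod.fst = p'
  generalize y ≫ prod.fst ≫ prod.snd = q'
  generalize y ≫ prod.snd = r'
  intro h
  calc _ = ((r + 1) * (r' + 1) + 1) * (p * (r' + 1) + q' * (r + 1) + d + 1) := by ring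
    _ = _ := by rw [h]; ring

end NNO

namespace Rationals

variable {NN : NNO E} (QQ : Rationals NN)

theorem Lt.comp {QQ : Rationals NN} {K L : E} {x y : K ⟶ QQ.Q} (h : QQ.Lt x y) (σ : L ⟶ K) :
    QQ.Lt (σ ≫ x) (σ ≫ y) := by
  obtain ⟨f, g, rfl, rfl, h⟩ := h
  exact ⟨σ ≫ f, σ ≫ g, by simp, by simp, h.comp σ⟩

variable [LocallyCartesianClosed E] [FinitaryExtensive E]

/-- By `FracLt.congr` the order may be tested on the chosen representatives. It then amounts to
solving one equation for the difference, so pairs `a < b` are cut out by an equalizer. -/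
theorem lt_iff_rep {K : E} (x y : K ⟶ QQ.Q) :
    QQ.Lt x y ↔ NN.FracLt (x ≫ QQ.rep) (y ≫ QQ.rep) := by
  constructor
  · rintro ⟨f, g, rfl, rfl, h⟩
    exact h.congr ((QQ.frac_eq_iff _ _).mp (by simp [QQ.rep_frac]))
      ((QQ.frac_eq_iff _ _).mp (by simp [QQ.rep_frac]))
  · intro h
    exact ⟨_, _, by simp [QQ.rep_frac], by simp [QQ.rep_frac], h⟩

/-- For `((a, b), d)`, the natural number `cross a b + d + 1`. -/
def ltLeft : (QQ.Q ⨯ QQ.Q) ⨯ NN.N ⟶ NN.N :=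
  NN.cross ((prod.fst ≫ prod.fst) ≫ QQ.rep) ((prod.fst ≫ prod.snd) ≫ QQ.rep) + prod.snd + 1

/-- For `((a, b), d)`, the natural number `cross b a`. -/
def ltRight : (QQ.Q ⨯ QQ.Q) ⨯ NN.N ⟶ NN.N :=
  NN.cross ((prod.fst ≫ prod.snd) ≫ QQ.rep) ((prod.fst ≫ prod.fst) ≫ QQ.rep)

theorem comp_ltLeft {K : E} (x : K ⟶ (QQ.Q ⨯ QQ.Q) ⨯ NN.N) : x ≫ QQ.ltLeft =
    NN.cross (((x ≫ prod.fst) ≫ prod.fst) ≫ QQ.rep) (((x ≫ prod.fst) ≫ prod.snd) ≫ QQ.rep) +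
      x ≫ prod.snd + 1 := by
  simp [ltLeft, NNO.comp_add_def, NNO.comp_one_def, NNO.comp_cross]

theorem comp_ltRight {K : E} (x : K ⟶ (QQ.Q ⨯ QQ.Q) ⨯ NN.N) : x ≫ QQ.ltRight =
    NN.cross (((x ≫ prod.fst) ≫ prod.snd) ≫ QQ.rep) (((x ≫ prod.fst) ≫ prod.fst) ≫ QQ.rep) := by
  simp [ltRight, NNO.comp_cross]

/-- The object of pairs `a < b` of rationals, with the difference as an extra datum. -/
def ltObj : E := equalizer QQ.ltLeft QQ.ltRight

/-- The inclusion of the object of pairs `a < b`. -/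
def ltι : QQ.ltObj ⟶ (QQ.Q ⨯ QQ.Q) ⨯ NN.N := equalizer.ι QQ.ltLeft QQ.ltRight

/-- The smaller rational. -/
def ltFst : QQ.ltObj ⟶ QQ.Q := (QQ.ltι ≫ prod.fst) ≫ prod.fst

/-- The larger rational. -/
def ltSnd : QQ.ltObj ⟶ QQ.Q := (QQ.ltι ≫ prod.fst) ≫ prod.snd

theorem ltι_condition : NN.cross (QQ.ltFst ≫ QQ.rep) (QQ.ltSnd ≫ QQ.rep) + QQ.ltι ≫ prod.snd + 1 =
    NN.cross (QQ.ltSnd ≫ QQ.rep) (QQ.ltFst ≫ QQ.rep) := by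
  have := equalizer.condition QQ.ltLeft QQ.ltRight
  rwa [comp_ltLeft, comp_ltRight] at this

theorem lt_ltFst_ltSnd : QQ.Lt QQ.ltFst QQ.ltSnd := by
  rw [lt_iff_rep, NNO.fracLt_iff]
  exact ⟨_, QQ.ltι_condition⟩

theorem exists_ltObj {K : E} {x y : K ⟶ QQ.Q} (h : QQ.Lt x y) :
    ∃ l : K ⟶ QQ.ltObj, l ≫ QQ.ltFst = x ∧ l ≫ QQ.ltSnd = y := by
  rw [lt_iff_rep, NNO.fracLt_iff] at h
  obtain ⟨d, h⟩ := h
  obtain ⟨l, hl⟩ : Mem QQ.ltι (prod.lift (prod.lift x y) d) := by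
    refine (mem_equalizer_iff _ _ _).mpr ?_
    rw [comp_ltLeft, comp_ltRight]
    simpa using h
  refine ⟨l, ?_, ?_⟩
  · rw [ltFst, Category.assoc, reassoc_of% hl]; simp
  · rw [ltSnd, Category.assoc, reassoc_of% hl]; simp

/-- By cancellation the recorded difference is determined by the two rationals, so `ltObj` is a
subobject of pairs and maps into it need no choices. -/
theorem ltObj_hom_ext {K : E} {l l' : K ⟶ QQ.ltObj} (h₁ : l ≫ QQ.ltFst = l' ≫ QQ.ltFst)
    (h₂ : l ≫ QQ.ltSnd = l' ≫ QQ.ltSnd) : l = l' := by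
  refine equalizer.hom_ext ?_
  change l ≫ QQ.ltι = l' ≫ QQ.ltι
  refine Limits.prod.hom_ext (Limits.prod.hom_ext (by simpa [ltFst] using h₁)
    (by simpa [ltSnd] using h₂)) ?_
  have h := congrArg (l ≫ ·) QQ.ltι_condition
  have h' := congrArg (l' ≫ ·) QQ.ltι_condition
  simp only [NNO.comp_add_def, NNO.comp_one_def, NNO.comp_cross, ← Category.assoc] at h h'
  rw [h₁, h₂, ← h', add_assoc, add_assoc, add_comm, add_comm _ (_ + 1)] at h
  exact NNO.add_one_cancel (NNO.add_cancel h)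

/-- The rational `a + 1 / (n + 1)`. -/
def approx {K : E} (a : K ⟶ QQ.Q) (n : K ⟶ NN.N) : K ⟶ QQ.Q :=
  NNO.approx (a ≫ QQ.rep) n ≫ QQ.frac

theorem comp_approx {K L : E} (σ : L ⟶ K) (a : K ⟶ QQ.Q) (n : K ⟶ NN.N) :
    σ ≫ QQ.approx a n = QQ.approx (σ ≫ a) (σ ≫ n) := by
  simp [approx, ← Category.assoc, NNO.comp_approx]

theorem lt_approx {K : E} (a : K ⟶ QQ.Q) (n : K ⟶ NN.N) : QQ.Lt a (QQ.approx a n) :=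
  ⟨_, _, by simp [QQ.rep_frac], rfl, NNO.fracLt_approx (a ≫ QQ.rep) n⟩

/-- A function of rationals `a` and `b` producing `n` with `a + 1 / (n + 1) < b` if `a < b`. -/
def index {K : E} (a b : K ⟶ QQ.Q) : K ⟶ NN.N :=
  ((a ≫ QQ.rep) ≫ prod.snd + 1) * ((b ≫ QQ.rep) ≫ prod.snd + 1)

theorem comp_index {K L : E} (σ : L ⟶ K) (a b : K ⟶ QQ.Q) :
    σ ≫ QQ.index a b = QQ.index (σ ≫ a) (σ ≫ b) := by
  simp [index, NNO.comp_add_def, NNO.comp_mul_def, NNO.comp_one_def]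

theorem approx_index_lt {K : E} {a b : K ⟶ QQ.Q} (h : QQ.Lt a b) :
    QQ.Lt (QQ.approx a (QQ.index a b)) b :=
  ⟨_, _, rfl, by simp [QQ.rep_frac], NNO.approx_fracLt ((QQ.lt_iff_rep a b).mp h)⟩

end Rationals

end RationalOrder

end
end CubicalReals

/-! ### Elements of cubical sets, and the adjunction between `Δ` and `Γ`. -/

namespace CubicalReals
noncomputable section

section CubicalBasics

variable {E : Type u} [Category.{v} E] [HasFiniteLimits E] {NN : NNO E}

attribute [local simp] pullback.lift_fst pullback.lift_snd pullback.lift_fst_assoc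
  pullback.lift_snd_assoc prod.lift_fst prod.lift_snd prod.lift_fst_assoc prod.lift_snd_assoc

namespace CubeCategory

variable (C : CubeCategory NN)

theorem comp_congr {K : E} {f f' g g' : K ⟶ C.Mor} (hf : f = f') (hg : g = g')
    (h : f ≫ C.cod = g ≫ C.dom) (h' : f' ≫ C.cod = g' ≫ C.dom) :
    C.comp f g h = C.comp f' g' h' := by
  subst hf hg; rfl

/-- The maps `[n] ⟶ [0]`. -/
def bang : NN.N ⟶ C.Mor := (C.existsUnique_toZero (𝟙 NN.N)).choose

@[simp]
theorem bang_dom : C.bang ≫ C.dom = 𝟙 NN.N := (C.existsUnique_toZero (𝟙 NN.N)).choose_spec.1.1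

@[simp]
theorem bang_cod : C.bang ≫ C.cod = NN.zeroAt NN.N :=
  (C.existsUnique_toZero (𝟙 NN.N)).choose_spec.1.2

theorem toZero_ext {K : E} {f g : K ⟶ C.Mor} (h : f ≫ C.dom = g ≫ C.dom)
    (hf : f ≫ C.cod = NN.zeroAt K) (hg : g ≫ C.cod = NN.zeroAt K) : f = g :=
  (C.existsUnique_toZero (f ≫ C.dom)).unique ⟨rfl, hf⟩ ⟨h.symm, hg⟩

end CubeCategory

namespace CubicalSet

variable {C : CubeCategory NN}

theorem Hom.dim_eq {X Y : CubicalSet C} (f : X ⟶ Y) : f.hom ≫ Y.dim = X.dim := f.hom_dim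

theorem Hom.act_eq {X Y : CubicalSet C} (f : X ⟶ Y) {K : E} (x : K ⟶ X.carrier) (s : K ⟶ C.Mor)
    (h : s ≫ C.cod = x ≫ X.dim) : X.act x s h ≫ f.hom = Y.act (x ≫ f.hom) s (by
      rw [h, Category.assoc, f.dim_eq]) :=
  f.act_hom x s h _

variable (C) in
/-- The carrier functor. -/
def car : CubicalSet C ⥤ E where
  obj X := X.carrier
  map f := f.hom

/-- An inverse on carriers automatically commutes with the action. Together with preservation of
pullbacks, this transfers exactness properties from `E` to cubical sets. -/
instance : (car C).ReflectsIsomorphisms where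
  reflects {X Y} f hf := by
    change IsIso f.hom at hf
    refine ⟨{ hom := inv f.hom, hom_dim := ?_, act_hom := ?_ }, hom_ext ?_, hom_ext ?_⟩
    · rw [IsIso.inv_comp_eq, f.dim_eq]
    · intro K x s h h'
      rw [← cancel_mono f.hom, Category.assoc, IsIso.inv_hom_id, Category.comp_id, f.act_eq]
      exact act_congr _ (by simp) rfl _ _
    · exact IsIso.hom_inv_id _
    · exact IsIso.inv_hom_id _

instance : PreservesLimitsOfShape WalkingCospan (car C) :=
  have : ∀ {X Y Z : CubicalSet C} (f : X ⟶ Z) (g : Y ⟶ Z), PreservesLimit (cospan f g) (car C) :=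
    fun f g => preservesLimit_of_preserves_limit_cone (isPullback_pb f g).isLimit
      ((isLimitMapConePullbackConeEquiv (car C) (isPullback_pb f g).w).symm
        (pullbackIsPullback f.hom g.hom))
  ⟨fun {K} => by
    have := this (K.map WalkingCospan.Hom.inl) (K.map WalkingCospan.Hom.inr)
    exact preservesLimit_of_iso_diagram (car C) (diagramIsoCospan K).symm⟩

theorem isPullback_hom {W X Y Z : CubicalSet C} {a : W ⟶ X} {b : W ⟶ Y} {f : X ⟶ Z} {g : Y ⟶ Z}
    (sq : IsPullback a b f g) : IsPullback a.hom b.hom f.hom g.hom :=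
  sq.map (car C)

/-! ### Elements of limits -/

/-- The element of a pullback determined by elements of the factors. -/
theorem exists_pullback_el {W X Y Z : CubicalSet C} {a : W ⟶ X} {b : W ⟶ Y} {f : X ⟶ Z}
    {g : Y ⟶ Z} (sq : IsPullback a b f g) {K : E} (x : K ⟶ X.carrier) (y : K ⟶ Y.carrier)
    (h : x ≫ f.hom = y ≫ g.hom) : ∃ w : K ⟶ W.carrier, w ≫ a.hom = x ∧ w ≫ b.hom = y :=
  ⟨(isPullback_hom sq).lift x y h, (isPullback_hom sq).lift_fst _ _ _,
    (isPullback_hom sq).lift_snd _ _ _⟩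

theorem pullback_el_ext {W X Y Z : CubicalSet C} {a : W ⟶ X} {b : W ⟶ Y} {f : X ⟶ Z}
    {g : Y ⟶ Z} (sq : IsPullback a b f g) {K : E} {w w' : K ⟶ W.carrier}
    (h₁ : w ≫ a.hom = w' ≫ a.hom) (h₂ : w ≫ b.hom = w' ≫ b.hom) : w = w' :=
  (isPullback_hom sq).hom_ext h₁ h₂

/-- The terminal cubical set is isomorphic to `point`, whose carrier is `ℕ`; its elements are
therefore determined by their dimension. -/
theorem terminal_el_ext {K : E} {x y : K ⟶ (⊤_ (CubicalSet C)).carrier}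
    (h : x ≫ (⊤_ (CubicalSet C)).dim = y ≫ (⊤_ (CubicalSet C)).dim) : x = y := by
  let p : ⊤_ (CubicalSet C) ⟶ point C :=
    { hom := (⊤_ (CubicalSet C)).dim
      hom_dim := Category.comp_id _
      act_hom := fun x s h _ => (⊤_ (CubicalSet C)).act_dim x s h }
  have hp : p ≫ terminal.from (point C) = 𝟙 _ := Subsingleton.elim _ _
  have hp' : (⊤_ (CubicalSet C)).dim ≫ (terminal.from (point C)).hom = 𝟙 _ := congrArg Hom.hom hp
  rw [← Category.comp_id x, ← Category.comp_id y, ← hp']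
  exact (Category.assoc _ _ _).symm.trans ((congrArg (· ≫ _) h).trans (Category.assoc _ _ _))

theorem isPullback_prod (X Y : CubicalSet C) :
    IsPullback (prod.fst : X ⨯ Y ⟶ X) prod.snd (terminal.from X) (terminal.from Y) :=
  IsPullback.of_isLimit_binaryFan_of_isTerminal (prodIsProd X Y) terminalIsTerminal

/-- The element of a product determined by elements of the factors. -/
def pairEl {X Y : CubicalSet C} {K : E} (x : K ⟶ X.carrier) (y : K ⟶ Y.carrier)
    (h : x ≫ X.dim = y ≫ Y.dim) : K ⟶ (X ⨯ Y).carrier :=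
  (isPullback_hom (isPullback_prod X Y)).lift x y (terminal_el_ext (by
    rw [Category.assoc, Category.assoc, Hom.dim_eq, Hom.dim_eq, h]))

@[simp]
theorem pairEl_fst {X Y : CubicalSet C} {K : E} (x : K ⟶ X.carrier) (y : K ⟶ Y.carrier)
    (h : x ≫ X.dim = y ≫ Y.dim) : pairEl x y h ≫ (prod.fst : X ⨯ Y ⟶ X).hom = x :=
  (isPullback_hom (isPullback_prod X Y)).lift_fst _ _ _

@[simp]
theorem pairEl_snd {X Y : CubicalSet C} {K : E} (x : K ⟶ X.carrier) (y : K ⟶ Y.carrier)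
    (h : x ≫ X.dim = y ≫ Y.dim) : pairEl x y h ≫ (prod.snd : X ⨯ Y ⟶ Y).hom = y :=
  (isPullback_hom (isPullback_prod X Y)).lift_snd _ _ _

theorem prod_el_ext {X Y : CubicalSet C} {K : E} {w w' : K ⟶ (X ⨯ Y).carrier}
    (h₁ : w ≫ (prod.fst : X ⨯ Y ⟶ X).hom = w' ≫ (prod.fst : X ⨯ Y ⟶ X).hom)
    (h₂ : w ≫ (prod.snd : X ⨯ Y ⟶ Y).hom = w' ≫ (prod.snd : X ⨯ Y ⟶ Y).hom) : w = w' :=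
  pullback_el_ext (isPullback_prod X Y) h₁ h₂

@[simp]
theorem lift_hom_fst {X Y Z : CubicalSet C} (f : Z ⟶ X) (g : Z ⟶ Y) :
    (prod.lift f g).hom ≫ (prod.fst : X ⨯ Y ⟶ X).hom = f.hom := by
  rw [← comp_hom, prod.lift_fst]

@[simp]
theorem lift_hom_fst_assoc {X Y Z : CubicalSet C} (f : Z ⟶ X) (g : Z ⟶ Y) {W : E} (h : X.carrier ⟶ W) :
    (prod.lift f g).hom ≫ (prod.fst : X ⨯ Y ⟶ X).hom ≫ h = f.hom ≫ h := by
  rw [← Category.assoc, lift_hom_fst]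

@[simp]
theorem lift_hom_snd {X Y Z : CubicalSet C} (f : Z ⟶ X) (g : Z ⟶ Y) :
    (prod.lift f g).hom ≫ (prod.snd : X ⨯ Y ⟶ Y).hom = g.hom := by
  rw [← comp_hom, prod.lift_snd]

@[simp]
theorem lift_hom_snd_assoc {X Y Z : CubicalSet C} (f : Z ⟶ X) (g : Z ⟶ Y) {W : E} (h : Y.carrier ⟶ W) :
    (prod.lift f g).hom ≫ (prod.snd : X ⨯ Y ⟶ Y).hom ≫ h = g.hom ≫ h := by
  rw [← Category.assoc, lift_hom_snd]

/-! ### Maps into constant cubical sets -/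

/-- The element of `A` underlying an element of `Δ A`. -/
def Δval (A : E) : ((Δ C).obj A).carrier ⟶ A := (prod.fst : A ⨯ NN.N ⟶ A)

/-- The element of `Δ A` of dimension `n` given by an element of `A`. -/
def Δel {A K : E} (a : K ⟶ A) (n : K ⟶ NN.N) : K ⟶ ((Δ C).obj A).carrier :=
  (prod.lift a n : K ⟶ A ⨯ NN.N)

@[simp]
theorem Δel_val {A K : E} (a : K ⟶ A) (n : K ⟶ NN.N) : Δel (C := C) a n ≫ Δval A = a :=
  prod.lift_fst _ _

@[simp]
theorem Δel_val_assoc {A K : E} (a : K ⟶ A) (n : K ⟶ NN.N) {Z : E} (h : A ⟶ Z) :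
    Δel (C := C) a n ≫ Δval A ≫ h = a ≫ h := by
  rw [← Category.assoc, Δel_val]

@[simp]
theorem Δel_dim {A K : E} (a : K ⟶ A) (n : K ⟶ NN.N) : Δel a n ≫ ((Δ C).obj A).dim = n :=
  prod.lift_snd _ _

@[simp]
theorem Δel_dim_assoc {A K : E} (a : K ⟶ A) (n : K ⟶ NN.N) {Z : E} (h : NN.N ⟶ Z) :
    Δel a n ≫ ((Δ C).obj A).dim ≫ h = n ≫ h := by
  rw [← Category.assoc, Δel_dim]

theorem Δel_ext {A K : E} {x y : K ⟶ ((Δ C).obj A).carrier} (h₁ : x ≫ Δval A = y ≫ Δval A)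
    (h₂ : x ≫ ((Δ C).obj A).dim = y ≫ ((Δ C).obj A).dim) : x = y :=
  Limits.prod.hom_ext h₁ h₂

theorem comp_Δel {A K L : E} (σ : L ⟶ K) (a : K ⟶ A) (n : K ⟶ NN.N) :
    σ ≫ Δel (C := C) a n = Δel (σ ≫ a) (σ ≫ n) :=
  Δel_ext (by simp) (by simp)

theorem act_Δval {A K : E} (x : K ⟶ ((Δ C).obj A).carrier) (s : K ⟶ C.Mor)
    (h : s ≫ C.cod = x ≫ ((Δ C).obj A).dim) : ((Δ C).obj A).act x s h ≫ Δval A = x ≫ Δval A :=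
  prod.lift_fst _ _

theorem act_Δval_assoc {A K : E} (x : K ⟶ ((Δ C).obj A).carrier) (s : K ⟶ C.Mor)
    (h : s ≫ C.cod = x ≫ ((Δ C).obj A).dim) {Z : E} (g : A ⟶ Z) :
    ((Δ C).obj A).act x s h ≫ Δval A ≫ g = x ≫ Δval A ≫ g := by
  rw [← Category.assoc, act_Δval, Category.assoc]

theorem Δmap_val {A B : E} (f : A ⟶ B) : ((Δ C).map f).hom ≫ Δval B = Δval A ≫ f :=
  prod.map_fst _ _

theorem val_eq {X : CubicalSet C} {A : E} (a : X ⟶ (Δ C).obj A) : val a = a.hom ≫ Δval A := rfl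

theorem act_val {X : CubicalSet C} {A : E} (a : X ⟶ (Δ C).obj A) {K : E} (x : K ⟶ X.carrier)
    (s : K ⟶ C.Mor) (h : s ≫ C.cod = x ≫ X.dim) : X.act x s h ≫ val a = x ≫ val a := by
  rw [val_eq, ← Category.assoc, a.act_eq, act_Δval, Category.assoc]

theorem val_comp {X Y : CubicalSet C} {A : E} (f : X ⟶ Y) (a : Y ⟶ (Δ C).obj A) :
    val (f ≫ a) = f.hom ≫ val a := by
  simp [val_eq]

theorem val_comp_map {X : CubicalSet C} {A B : E} (a : X ⟶ (Δ C).obj A) (f : A ⟶ B) :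
    val (a ≫ (Δ C).map f) = val a ≫ f := by
  simp [val_eq, Δmap_val]

theorem val_map {A B : E} (f : A ⟶ B) : val ((Δ C).map f) = Δval A ≫ f := Δmap_val f

theorem val_injective {X : CubicalSet C} {A : E} {a b : X ⟶ (Δ C).obj A} (h : val a = val b) :
    a = b :=
  hom_ext (Δel_ext h (by rw [a.dim_eq, b.dim_eq]))

/-- The map into a constant cubical set determined by an invariant function on elements. -/
def mkΔ {X : CubicalSet C} {A : E} (w : X.carrier ⟶ A)
    (hw : ∀ {K : E} (x : K ⟶ X.carrier) (s : K ⟶ C.Mor) (h : s ≫ C.cod = x ≫ X.dim),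
      X.act x s h ≫ w = x ≫ w) : X ⟶ (Δ C).obj A where
  hom := Δel w X.dim
  hom_dim := Δel_dim _ _
  act_hom x s h h' := Δel_ext (by rw [Category.assoc, Δel_val, hw, act_Δval, Category.assoc,
      Δel_val]) (by rw [Category.assoc, Δel_dim, X.act_dim, act_dim])

@[simp]
theorem val_mkΔ {X : CubicalSet C} {A : E} (w : X.carrier ⟶ A)
    (hw : ∀ {K : E} (x : K ⟶ X.carrier) (s : K ⟶ C.Mor) (h : s ≫ C.cod = x ≫ X.dim),
      X.act x s h ≫ w = x ≫ w) : val (mkΔ w hw) = w :=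
  Δel_val (C := C) _ _

/-- Factoring a map into a constant cubical set through a subobject. -/
theorem exists_Δ_factor {X : CubicalSet C} {A B : E} (m : A ⟶ B) [Mono m]
    (b : X ⟶ (Δ C).obj B) (h : Mem m (val b)) : ∃ a : X ⟶ (Δ C).obj A, a ≫ (Δ C).map m = b := by
  obtain ⟨l, hl⟩ := h
  refine ⟨mkΔ l ?_, val_injective ?_⟩
  · intro K x s h
    rw [← cancel_mono m, Category.assoc, Category.assoc, hl, act_val]
  · rw [val_comp_map, val_mkΔ, hl]

instance {A B : E} (m : A ⟶ B) [Mono m] : Mono ((Δ C).map m) where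
  right_cancellation a b h := by
    refine val_injective ?_
    rw [← cancel_mono m, ← val_comp_map, ← val_comp_map, h]

/-! ### Global points -/

/-- The element underlying a global point. -/
def Γι (X : CubicalSet C) : (Γ C).obj X ⟶ X.carrier := pullback.fst X.dim NN.zero

@[simp]
theorem Γι_dim (X : CubicalSet C) : Γι X ≫ X.dim = NN.zeroAt _ := by
  exact pullback.condition.trans (congrArg (· ≫ NN.zero) (Subsingleton.elim _ _))

/-- The global point given by an element of dimension `0`. -/
def Γel {X : CubicalSet C} {K : E} (x : K ⟶ X.carrier) (h : x ≫ X.dim = NN.zeroAt K) :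
    K ⟶ (Γ C).obj X :=
  pullback.lift x (terminal.from K) h

@[simp]
theorem Γel_ι {X : CubicalSet C} {K : E} (x : K ⟶ X.carrier) (h : x ≫ X.dim = NN.zeroAt K) :
    Γel x h ≫ Γι X = x :=
  pullback.lift_fst _ _ _

@[simp]
theorem Γel_ι_assoc {X : CubicalSet C} {K : E} (x : K ⟶ X.carrier) (h : x ≫ X.dim = NN.zeroAt K) {Z : E}
    (g : X.carrier ⟶ Z) :
    Γel x h ≫ Γι X ≫ g = x ≫ g := by
  rw [← Category.assoc, Γel_ι]

theorem Γel_ext {X : CubicalSet C} {K : E} {x y : K ⟶ (Γ C).obj X} (h : x ≫ Γι X = y ≫ Γι X) :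
    x = y :=
  pullback.hom_ext h (Subsingleton.elim _ _)

@[simp]
theorem Γmap_ι {X Y : CubicalSet C} (f : X ⟶ Y) : (Γ C).map f ≫ Γι Y = Γι X ≫ f.hom :=
  pullback.lift_fst _ _ _

@[simp]
theorem Γmap_ι_assoc {X Y : CubicalSet C} (f : X ⟶ Y) {Z : E} (h : Y.carrier ⟶ Z) :
    (Γ C).map f ≫ Γι Y ≫ h = Γι X ≫ f.hom ≫ h := by
  rw [← Category.assoc, Γmap_ι, Category.assoc]

/-- The map out of a constant cubical set determined by a family of global points. -/
def ofΓ {X : CubicalSet C} {K : E} (x : K ⟶ (Γ C).obj X) : (Δ C).obj K ⟶ X where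
  -- In dimension `n` the value is the degeneration of the global point along `[n] ⟶ [0]`.
  hom := X.act (Δval K ≫ x ≫ Γι X) (((Δ C).obj K).dim ≫ C.bang) (by simp)
  hom_dim := by rw [X.act_dim]; simp
  act_hom {L} y s h h' := by
    have e : (y ≫ ((Δ C).obj K).dim ≫ C.bang) ≫ C.cod = (y ≫ Δval K ≫ x ≫ Γι X) ≫ X.dim := by
      simp
    have e' : (((Δ C).obj K).act y s h ≫ ((Δ C).obj K).dim ≫ C.bang) ≫ C.cod =
      (((Δ C).obj K).act y s h ≫ Δval K ≫ x ≫ Γι X) ≫ X.dim := by simp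
    have e'' : s ≫ C.cod = X.act (y ≫ Δval K ≫ x ≫ Γι X) (y ≫ ((Δ C).obj K).dim ≫ C.bang) e ≫
        X.dim := by rw [X.act_dim, h]; simp
    have e₃ : s ≫ C.cod = (y ≫ ((Δ C).obj K).dim ≫ C.bang) ≫ C.dom := by rw [h]; simp
    have e₄ : C.comp s (y ≫ ((Δ C).obj K).dim ≫ C.bang) e₃ ≫ C.cod =
        (y ≫ Δval K ≫ x ≫ Γι X) ≫ X.dim := by rw [C.comp_cod]; simp
    rw [X.act_nat _ _ _ _ e', X.act_congr (X.act_nat _ _ _ _ e) rfl h' e'', X.act_comp _ _ _ e e'' e₃ e₄]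
    refine X.act_congr (act_Δval_assoc _ _ _ _) (C.toZero_ext ?_ ?_ ?_) _ _
    · rw [C.comp_dom, Category.assoc, Category.assoc, C.bang_dom, Category.comp_id, act_dim]
    · simp
    · rw [C.comp_cod]; simp

/-- The family of global points underlying a map out of a constant cubical set. -/
def toΓ {X : CubicalSet C} {K : E} (f : (Δ C).obj K ⟶ X) : K ⟶ (Γ C).obj X :=
  Γel (Δel (𝟙 K) (NN.zeroAt K) ≫ f.hom) (by rw [Category.assoc, f.dim_eq, Δel_dim])

theorem toΓ_ofΓ {X : CubicalSet C} {K : E} (x : K ⟶ (Γ C).obj X) : toΓ (ofΓ x) = x := by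
  refine Γel_ext ?_
  rw [toΓ, Γel_ι, ofΓ, X.act_nat _ _ _ _ (by simp)]
  have h : x ≫ Γι X ≫ X.dim = NN.zeroAt K := by simp
  have e : (((x ≫ Γι X) ≫ X.dim) ≫ C.ident) ≫ C.cod = (x ≫ Γι X) ≫ X.dim := by
    simp [C.ident_cod]
  refine (X.act_congr ?_ ?_ _ e).trans (X.act_ident _ e)
  · simp
  · refine C.toZero_ext ?_ ?_ ?_
    · simp [C.ident_dom]
    · simp
    · simp [C.ident_cod]

/-- Every element of `Δ K` is the degeneration of an element of dimension `0`, so a map out of `Δ K`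
is determined by its values there. -/
theorem ofΓ_toΓ {X : CubicalSet C} {K : E} (f : (Δ C).obj K ⟶ X) : ofΓ (toΓ f) = f := by
  refine hom_ext ?_
  change X.act (Δval K ≫ toΓ f ≫ Γι X) _ _ = _
  have e : (((Δ C).obj K).dim ≫ C.bang) ≫ C.cod =
    (Δval K ≫ Δel (𝟙 K) (NN.zeroAt K)) ≫ ((Δ C).obj K).dim := by simp
  have e' : (((Δ C).obj K).dim ≫ C.bang) ≫ C.cod =
    ((Δval K ≫ Δel (𝟙 K) (NN.zeroAt K)) ≫ f.hom) ≫ X.dim := by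
    rw [e]; simp only [Category.assoc, f.dim_eq]
  refine (X.act_congr ?_ rfl _ e').trans ?_
  · rw [toΓ, Γel_ι, Category.assoc]
  · rw [← f.act_eq _ _ e]
    refine (congrArg (· ≫ f.hom) (Δel_ext (y := 𝟙 _) ?_ ?_)).trans (Category.id_comp _)
    · rw [act_Δval]; simp
    · rw [act_dim]; simp

theorem toΓ_comp {X Y : CubicalSet C} {K : E} (f : (Δ C).obj K ⟶ X) (g : X ⟶ Y) :
    toΓ (f ≫ g) = toΓ f ≫ (Γ C).map g := by
  refine Γel_ext ?_
  simp [toΓ]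

theorem toΓ_map_comp {X : CubicalSet C} {K L : E} (σ : L ⟶ K) (f : (Δ C).obj K ⟶ X) :
    toΓ ((Δ C).map σ ≫ f) = σ ≫ toΓ f := by
  refine Γel_ext ?_
  simp only [toΓ, Γel_ι, Category.assoc, comp_hom]
  rw [← Category.assoc, ← Category.assoc]
  congr 1
  refine Δel_ext ?_ ?_
  · rw [Category.assoc, Δmap_val]; simp
  · rw [Category.assoc, Hom.dim_eq]; simp

variable (C) in
/-- The constant functor is left adjoint to the global points functor. -/
def ΔΓ : Δ C ⊣ Γ C := Adjunction.mkOfHomEquiv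
  { homEquiv := fun _ _ => ⟨toΓ, ofΓ, ofΓ_toΓ, toΓ_ofΓ⟩
    homEquiv_naturality_left_symm := by
      intro K' K X σ x
      change ofΓ (σ ≫ x) = (Δ C).map σ ≫ ofΓ x
      rw [← ofΓ_toΓ ((Δ C).map σ ≫ ofΓ x), toΓ_map_comp, toΓ_ofΓ]
    homEquiv_naturality_right := fun f g => toΓ_comp f g }

theorem toΓ_injective {X : CubicalSet C} {K : E} {f g : (Δ C).obj K ⟶ X} (h : toΓ f = toΓ g) :
    f = g := by
  rw [← ofΓ_toΓ f, h, ofΓ_toΓ]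

theorem ofΓ_comp {X Y : CubicalSet C} {K : E} (x : K ⟶ (Γ C).obj X) (g : X ⟶ Y) :
    ofΓ x ≫ g = ofΓ (x ≫ (Γ C).map g) :=
  toΓ_injective (by rw [toΓ_comp, toΓ_ofΓ, toΓ_ofΓ])

theorem map_comp_ofΓ {X : CubicalSet C} {K L : E} (σ : L ⟶ K) (x : K ⟶ (Γ C).obj X) :
    (Δ C).map σ ≫ ofΓ x = ofΓ (σ ≫ x) :=
  toΓ_injective (by rw [toΓ_map_comp, toΓ_ofΓ, toΓ_ofΓ])

theorem toΓ_Δval {A K : E} (f : (Δ C).obj K ⟶ (Δ C).obj A) :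
    toΓ f ≫ Γι _ ≫ Δval A = Δel (𝟙 K) (NN.zeroAt K) ≫ val f := by
  simp [toΓ, val_eq]

instance : PreservesColimits (Δ C) := (ΔΓ C).leftAdjoint_preservesColimits

end CubicalSet
end CubicalBasics
end
end CubicalReals

/-! ### Coproducts and extensivity of cubical sets. -/

namespace CubicalReals
noncomputable section

section CubicalColimits

variable {E : Type u} [Category.{v} E] [HasFiniteLimits E] {NN : NNO E}
  {C : CubeCategory NN}

attribute [local simp] pullback.lift_fst pullback.lift_snd pullback.lift_fst_assoc
  pullback.lift_snd_assoc prod.lift_fst prod.lift_snd prod.lift_fst_assoc prod.lift_snd_assoc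
  coprod.inl_desc coprod.inr_desc coprod.inl_desc_assoc coprod.inr_desc_assoc

namespace CubicalSet

variable [FinitaryExtensive E]

theorem hom_ext_empty {K Z : E} (f : K ⟶ ⊥_ E) (x y : K ⟶ Z) : x = y :=
  (initialIsInitial.ofStrict f).hom_ext x y

variable (C) in
/-- The empty cubical set. -/
def empty : CubicalSet C where
  carrier := ⊥_ E
  dim := initial.to _
  act x _ _ := x
  act_dim x _ _ := hom_ext_empty x _ _
  act_nat σ x _ _ _ := hom_ext_empty (σ ≫ x) _ _
  act_ident x _ := hom_ext_empty x _ _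
  act_comp x _ _ _ _ _ _ := hom_ext_empty x _ _

/-- A cubical set is initial if its carrier is. -/
def isInitialOfCarrier {X : CubicalSet C} (h : IsInitial X.carrier) : IsInitial X :=
  IsInitial.ofUniqueHom
    (fun _ => { hom := h.to _
                hom_dim := h.hom_ext _ _
                act_hom := fun x _ _ _ => (h.ofStrict x).hom_ext _ _ })
    (fun _ _ => hom_ext (h.hom_ext _ _))

/-- An initial cubical set maps to `empty`, and a map to the strict initial object of `E` makes the
carrier initial. -/
theorem isInitial_iff (X : CubicalSet C) :
    Nonempty (IsInitial X) ↔ Nonempty (IsInitial X.carrier) :=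
  ⟨fun h => ⟨initialIsInitial.ofStrict (h.some.to (empty C)).hom⟩,
    fun h => ⟨isInitialOfCarrier h.some⟩⟩

theorem isInitial_of_hom {X Y : CubicalSet C} (f : X ⟶ Y) (h : Nonempty (IsInitial Y)) :
    Nonempty (IsInitial X) :=
  (isInitial_iff X).mpr ⟨((isInitial_iff Y).mp h).some.ofStrict f.hom⟩

instance : HasInitial (CubicalSet C) :=
  (isInitialOfCarrier (X := empty C) initialIsInitial).hasInitial

section Coproducts

variable (X Y : CubicalSet C)

/-- The action on a disjoint union. -/
def sumAct {K : E} (x : K ⟶ X.carrier ⨿ Y.carrier) (s : K ⟶ C.Mor)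
    (h : s ≫ C.cod = x ≫ coprod.desc X.dim Y.dim) : K ⟶ X.carrier ⨿ Y.carrier :=
  BinaryCofan.IsColimit.desc (isColimit_cases x).some
    (X.act (pullback.snd x coprod.inl) (pullback.fst x coprod.inl ≫ s)
      (by rw [Category.assoc, h, pullback.condition_assoc, coprod.inl_desc]) ≫ coprod.inl)
    (Y.act (pullback.snd x coprod.inr) (pullback.fst x coprod.inr ≫ s)
      (by rw [Category.assoc, h, pullback.condition_assoc, coprod.inr_desc]) ≫ coprod.inr)

variable {X Y}

/-- Computes the action in any context where `x` is known to lie in the left summand; with its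
mirror image it reduces the laws of the sum to those of the summands. -/
theorem sumAct_inl {K L : E} (x : K ⟶ X.carrier ⨿ Y.carrier) (s : K ⟶ C.Mor)
    (h : s ≫ C.cod = x ≫ coprod.desc X.dim Y.dim) (σ : L ⟶ K) (a : L ⟶ X.carrier)
    (e : σ ≫ x = a ≫ coprod.inl) (h' : (σ ≫ s) ≫ C.cod = a ≫ X.dim) :
    σ ≫ sumAct X Y x s h = X.act a (σ ≫ s) h' ≫ coprod.inl := by
  have : pullback.fst x coprod.inl ≫ sumAct X Y x s h = _ :=
    BinaryCofan.IsColimit.inl_desc (isColimit_cases x).some _ _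
  conv_lhs => rw [← pullback.lift_fst (f := x) (g := coprod.inl) σ a e, Category.assoc, this,
    ← Category.assoc]
  congr 1
  rw [X.act_nat _ _ _ _ (by simp [h'])]
  exact X.act_congr (by simp) (by simp) _ _

theorem sumAct_inr {K L : E} (x : K ⟶ X.carrier ⨿ Y.carrier) (s : K ⟶ C.Mor)
    (h : s ≫ C.cod = x ≫ coprod.desc X.dim Y.dim) (σ : L ⟶ K) (a : L ⟶ Y.carrier)
    (e : σ ≫ x = a ≫ coprod.inr) (h' : (σ ≫ s) ≫ C.cod = a ≫ Y.dim) :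
    σ ≫ sumAct X Y x s h = Y.act a (σ ≫ s) h' ≫ coprod.inr := by
  have : pullback.fst x coprod.inr ≫ sumAct X Y x s h = _ :=
    BinaryCofan.IsColimit.inr_desc (isColimit_cases x).some _ _
  conv_lhs => rw [← pullback.lift_fst (f := x) (g := coprod.inr) σ a e, Category.assoc, this,
    ← Category.assoc]
  congr 1
  rw [Y.act_nat _ _ _ _ (by simp [h'])]
  exact Y.act_congr (by simp) (by simp) _ _

theorem sumAct_inl' {K : E} (s : K ⟶ C.Mor) (a : K ⟶ X.carrier)
    (h' : s ≫ C.cod = a ≫ X.dim) (h : s ≫ C.cod = (a ≫ coprod.inl) ≫ coprod.desc X.dim Y.dim) :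
    sumAct X Y (a ≫ coprod.inl) s h = X.act a s h' ≫ coprod.inl := by
  have := sumAct_inl (a ≫ coprod.inl) s h (𝟙 K) a (by simp) (by simpa using h')
  rw [Category.id_comp] at this
  rw [this]; congr 1
  exact X.act_congr rfl (by simp) _ _

theorem sumAct_inr' {K : E} (s : K ⟶ C.Mor) (a : K ⟶ Y.carrier)
    (h' : s ≫ C.cod = a ≫ Y.dim) (h : s ≫ C.cod = (a ≫ coprod.inr) ≫ coprod.desc X.dim Y.dim) :
    sumAct X Y (a ≫ coprod.inr) s h = Y.act a s h' ≫ coprod.inr := by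
  have := sumAct_inr (a ≫ coprod.inr) s h (𝟙 K) a (by simp) (by simpa using h')
  rw [Category.id_comp] at this
  rw [this]; congr 1
  exact Y.act_congr rfl (by simp) _ _

theorem sumAct_nat {K L : E} (σ : L ⟶ K) (x : K ⟶ X.carrier ⨿ Y.carrier) (s : K ⟶ C.Mor)
    (h : s ≫ C.cod = x ≫ coprod.desc X.dim Y.dim)
    (h' : (σ ≫ s) ≫ C.cod = (σ ≫ x) ≫ coprod.desc X.dim Y.dim) :
    σ ≫ sumAct X Y x s h = sumAct X Y (σ ≫ x) (σ ≫ s) h' := by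
  refine hom_ext_cases (σ ≫ x) (fun τ a e => ?_) (fun τ a e => ?_)
  · have e' : (τ ≫ σ ≫ s) ≫ C.cod = a ≫ X.dim := by
      simp only [Category.assoc] at e ⊢; rw [h, reassoc_of% e]; simp
    rw [sumAct_inl _ _ _ τ a e e', ← Category.assoc τ σ, sumAct_inl _ _ _ (τ ≫ σ) a (by simpa using e)
      (by simpa using e')]
    congr 1
    exact X.act_congr rfl (by simp) _ _
  · have e' : (τ ≫ σ ≫ s) ≫ C.cod = a ≫ Y.dim := by
      simp only [Category.assoc] at e ⊢; rw [h, reassoc_of% e]; simp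
    rw [sumAct_inr _ _ _ τ a e e', ← Category.assoc τ σ, sumAct_inr _ _ _ (τ ≫ σ) a (by simpa using e)
      (by simpa using e')]
    congr 1
    exact Y.act_congr rfl (by simp) _ _

theorem desc_hom_dim {Z : CubicalSet C} (f : X ⟶ Z) (g : Y ⟶ Z) :
    coprod.desc f.hom g.hom ≫ Z.dim = coprod.desc X.dim Y.dim := by
  rw [coprod.desc_comp, f.dim_eq, g.dim_eq]

theorem sumAct_desc {Z : CubicalSet C} (f : X ⟶ Z) (g : Y ⟶ Z) {K : E}
    (x : K ⟶ X.carrier ⨿ Y.carrier) (s : K ⟶ C.Mor)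
    (h : s ≫ C.cod = x ≫ coprod.desc X.dim Y.dim)
    (h' : s ≫ C.cod = (x ≫ coprod.desc f.hom g.hom) ≫ Z.dim) :
    sumAct X Y x s h ≫ coprod.desc f.hom g.hom = Z.act (x ≫ coprod.desc f.hom g.hom) s h' := by
  refine hom_ext_cases x (fun τ a e => ?_) (fun τ a e => ?_)
  · have e₁ : (τ ≫ s) ≫ C.cod = a ≫ X.dim := by
      rw [Category.assoc, h, reassoc_of% e]; simp
    have e₂ : τ ≫ x ≫ coprod.desc f.hom g.hom = a ≫ f.hom := by rw [reassoc_of% e]; simp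
    rw [← Category.assoc, sumAct_inl x s h τ a e e₁, Category.assoc, coprod.inl_desc,
      f.act_eq, Z.act_nat _ _ _ _ (by rw [e₂, e₁, Category.assoc, f.dim_eq])]
    exact Z.act_congr e₂.symm rfl _ _
  · have e₁ : (τ ≫ s) ≫ C.cod = a ≫ Y.dim := by
      rw [Category.assoc, h, reassoc_of% e]; simp
    have e₂ : τ ≫ x ≫ coprod.desc f.hom g.hom = a ≫ g.hom := by rw [reassoc_of% e]; simp
    rw [← Category.assoc, sumAct_inr x s h τ a e e₁, Category.assoc, coprod.inr_desc,
      g.act_eq, Z.act_nat _ _ _ _ (by rw [e₂, e₁, Category.assoc, g.dim_eq])]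
    exact Z.act_congr e₂.symm rfl _ _

variable (X Y)

/-- The disjoint union of two cubical sets. -/
def sum : CubicalSet C where
  carrier := X.carrier ⨿ Y.carrier
  dim := coprod.desc X.dim Y.dim
  act := sumAct X Y
  act_dim {K} x s h := by
    refine hom_ext_cases x (fun τ a e => ?_) (fun τ a e => ?_)
    · rw [← Category.assoc, sumAct_inl x s h τ a e (by rw [Category.assoc, h, reassoc_of% e]; simp)]
      simp [X.act_dim]
    · rw [← Category.assoc, sumAct_inr x s h τ a e (by rw [Category.assoc, h, reassoc_of% e]; simp)]
      simp [Y.act_dim]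
  act_nat := sumAct_nat
  act_ident {K} x h := by
    refine hom_ext_cases x (fun τ a e => ?_) (fun τ a e => ?_)
    · have e' : ((a ≫ X.dim) ≫ C.ident) ≫ C.cod = a ≫ X.dim := by simp [C.ident_cod]
      rw [sumAct_inl _ _ _ τ a e (by
        simp only [Category.assoc]; rw [C.ident_cod, reassoc_of% e]; simp)]
      refine Eq.trans (congrArg (· ≫ coprod.inl) ?_) e.symm
      refine (X.act_congr rfl ?_ _ e').trans (X.act_ident _ e')
      simp only [Category.assoc]; rw [reassoc_of% e]; simp
    · have e' : ((a ≫ Y.dim) ≫ C.ident) ≫ C.cod = a ≫ Y.dim := by simp [C.ident_cod]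
      rw [sumAct_inr _ _ _ τ a e (by
        simp only [Category.assoc]; rw [C.ident_cod, reassoc_of% e]; simp)]
      refine Eq.trans (congrArg (· ≫ coprod.inr) ?_) e.symm
      refine (Y.act_congr rfl ?_ _ e').trans (Y.act_ident _ e')
      simp only [Category.assoc]; rw [reassoc_of% e]; simp
  act_comp {K} x s r h h₁ h₂ h₃ := by
    refine hom_ext_cases x (fun τ a e => ?_) (fun τ a e => ?_)
    · have e₁ : (τ ≫ s) ≫ C.cod = a ≫ X.dim := by
        rw [Category.assoc, h, reassoc_of% e]; simp
      have e₂ : (τ ≫ r) ≫ C.cod = (τ ≫ s) ≫ C.dom := by simp [h₂]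
      rw [sumAct_inl _ r h₁ τ (X.act a (τ ≫ s) e₁) (sumAct_inl x s h τ a e e₁) (by
        rw [X.act_dim, e₂]), sumAct_inl _ _ _ τ a e (by
        rw [Category.assoc, C.comp_cod, ← Category.assoc, e₁])]
      congr 1
      rw [X.act_comp _ _ _ _ _ e₂ (by rw [C.comp_cod, e₁])]
      exact X.act_congr rfl (C.comp_nat _ _ _ _ _).symm _ _
    · have e₁ : (τ ≫ s) ≫ C.cod = a ≫ Y.dim := by
        rw [Category.assoc, h, reassoc_of% e]; simp
      have e₂ : (τ ≫ r) ≫ C.cod = (τ ≫ s) ≫ C.dom := by simp [h₂]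
      rw [sumAct_inr _ r h₁ τ (Y.act a (τ ≫ s) e₁) (sumAct_inr x s h τ a e e₁) (by
        rw [Y.act_dim, e₂]), sumAct_inr _ _ _ τ a e (by
        rw [Category.assoc, C.comp_cod, ← Category.assoc, e₁])]
      congr 1
      rw [Y.act_comp _ _ _ _ _ e₂ (by rw [C.comp_cod, e₁])]
      exact Y.act_congr rfl (C.comp_nat _ _ _ _ _).symm _ _

/-- The left inclusion. -/
def sumInl : X ⟶ sum X Y where
  hom := coprod.inl
  hom_dim := coprod.inl_desc _ _
  act_hom x s h h' := (sumAct_inl' s x h h').symm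

/-- The right inclusion. -/
def sumInr : Y ⟶ sum X Y where
  hom := coprod.inr
  hom_dim := coprod.inr_desc _ _
  act_hom x s h h' := (sumAct_inr' s x h h').symm

variable {X Y} in
/-- The map out of a disjoint union. -/
def sumDesc {Z : CubicalSet C} (f : X ⟶ Z) (g : Y ⟶ Z) : sum X Y ⟶ Z where
  hom := coprod.desc f.hom g.hom
  hom_dim := desc_hom_dim f g
  act_hom x s h h' := sumAct_desc f g x s h h'

/-- The disjoint union is a coproduct. -/
def isColimitSum : IsColimit (BinaryCofan.mk (sumInl X Y) (sumInr X Y)) :=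
  BinaryCofan.isColimitMk (fun s => sumDesc s.inl s.inr)
    (fun _ => hom_ext (coprod.inl_desc _ _)) (fun _ => hom_ext (coprod.inr_desc _ _))
    (fun _ _ h₁ h₂ => hom_ext (coprod.hom_ext
      ((congrArg Hom.hom h₁).trans (coprod.inl_desc _ _).symm)
      ((congrArg Hom.hom h₂).trans (coprod.inr_desc _ _).symm)))

end Coproducts

instance : HasBinaryCoproducts (CubicalSet C) :=
  have : ∀ {X Y : CubicalSet C}, HasColimit (pair X Y) :=
    fun {X Y} => ⟨⟨⟨_, isColimitSum X Y⟩⟩⟩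
  hasBinaryCoproducts_of_hasColimit_pair _

instance : HasFiniteCoproducts (CubicalSet C) := hasFiniteCoproducts_of_has_binary_and_initial

instance : PreservesColimitsOfShape (Discrete WalkingPair) (car C) :=
  have : ∀ (X Y : CubicalSet C), PreservesColimit (pair X Y) (car C) := fun X Y =>
    preservesColimit_of_preserves_colimit_cocone (isColimitSum X Y)
      ((isColimitMapCoconeBinaryCofanEquiv (car C) (sumInl X Y) (sumInr X Y)).symm
        (coprodIsCoprod X.carrier Y.carrier))
  ⟨fun {K} => by
    have := this (K.obj ⟨WalkingPair.left⟩) (K.obj ⟨WalkingPair.right⟩)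
    exact preservesColimit_of_iso_diagram (car C) (diagramIsoPair K).symm⟩

/-- The carrier functor reflects isomorphisms and preserves pullbacks and finite coproducts, so
extensivity is inherited from `E`. -/
instance : FinitaryExtensive (CubicalSet C) :=
  finitaryExtensive_of_preserves_and_reflects_isomorphism (car C)

end CubicalSet
end CubicalColimits
end
end CubicalReals

/-! ### The right adjoint of the global points functor. -/

namespace CubicalReals
noncomputable section

section RightAdjoint

variable {E : Type u} [Category.{v} E] [HasFiniteLimits E] {NN : NNO E}
  {C : CubeCategory NN}

attribute [local simp] pullback.lift_fst pullback.lift_snd pullback.lift_fst_assoc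
  pullback.lift_snd_assoc prod.lift_fst prod.lift_snd prod.lift_fst_assoc prod.lift_snd_assoc
  coprod.inl_desc coprod.inr_desc coprod.inl_desc_assoc coprod.inr_desc_assoc

namespace CubeCategory

variable (C)

/-- The object of vertices `[0] ⟶ [n]` of cubes. -/
def Vert : E := pullback C.dom NN.zero

/-- The morphism underlying a vertex. -/
def vertι : C.Vert ⟶ C.Mor := pullback.fst C.dom NN.zero

@[simp]
theorem vertι_dom : C.vertι ≫ C.dom = NN.zeroAt _ :=
  pullback.condition.trans (congrArg (· ≫ NN.zero) (Subsingleton.elim _ _))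

/-- The dimension of the cube of which an element is a vertex. -/
def vcod : C.Vert ⟶ NN.N := C.vertι ≫ C.cod

variable {C}

/-- The vertex given by a morphism with domain `[0]`. -/
def vertEl {K : E} (f : K ⟶ C.Mor) (h : f ≫ C.dom = NN.zeroAt K) : K ⟶ C.Vert :=
  pullback.lift f (terminal.from K) h

@[simp]
theorem vertEl_ι {K : E} (f : K ⟶ C.Mor) (h : f ≫ C.dom = NN.zeroAt K) :
    vertEl f h ≫ C.vertι = f :=
  pullback.lift_fst _ _ _

@[simp]
theorem vertEl_vcod {K : E} (f : K ⟶ C.Mor) (h : f ≫ C.dom = NN.zeroAt K) :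
    vertEl f h ≫ C.vcod = f ≫ C.cod := by
  rw [vcod, ← Category.assoc, vertEl_ι]

theorem vert_ext {K : E} {x y : K ⟶ C.Vert} (h : x ≫ C.vertι = y ≫ C.vertι) : x = y :=
  pullback.hom_ext h (Subsingleton.elim _ _)

theorem comp_vertι_dom {K : E} (w : K ⟶ C.Vert) : (w ≫ C.vertι) ≫ C.dom = NN.zeroAt K := by
  simp

/-- The image of a vertex under a morphism of cubes. -/
def vcomp {K : E} (w : K ⟶ C.Vert) (s : K ⟶ C.Mor) (h : w ≫ C.vcod = s ≫ C.dom) : K ⟶ C.Vert :=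
  vertEl (C.comp (w ≫ C.vertι) s (by rw [← h, vcod, Category.assoc]))
    (by rw [C.comp_dom, comp_vertι_dom])

@[simp]
theorem vcomp_vcod {K : E} (w : K ⟶ C.Vert) (s : K ⟶ C.Mor) (h : w ≫ C.vcod = s ≫ C.dom) :
    vcomp w s h ≫ C.vcod = s ≫ C.cod := by
  rw [vcomp, vertEl_vcod, C.comp_cod]

theorem vcomp_ι {K : E} (w : K ⟶ C.Vert) (s : K ⟶ C.Mor) (h : w ≫ C.vcod = s ≫ C.dom) :
    vcomp w s h ≫ C.vertι = C.comp (w ≫ C.vertι) s (by rw [← h, vcod, Category.assoc]) :=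
  vertEl_ι _ _

theorem comp_vcomp {K L : E} (σ : L ⟶ K) (w : K ⟶ C.Vert) (s : K ⟶ C.Mor)
    (h : w ≫ C.vcod = s ≫ C.dom) (h' : (σ ≫ w) ≫ C.vcod = (σ ≫ s) ≫ C.dom) :
    σ ≫ vcomp w s h = vcomp (σ ≫ w) (σ ≫ s) h' := by
  refine vert_ext ?_
  have e : (σ ≫ w ≫ C.vertι) ≫ C.cod = (σ ≫ s) ≫ C.dom := by
    rw [← h', vcod]; simp
  rw [vcomp, vcomp, Category.assoc, vertEl_ι, vertEl_ι, C.comp_nat _ _ _ _ e]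
  exact C.comp_congr (Category.assoc _ _ _).symm rfl _ _

theorem vcomp_congr {K : E} {w w' : K ⟶ C.Vert} {s s' : K ⟶ C.Mor} (hw : w = w') (hs : s = s')
    (h : w ≫ C.vcod = s ≫ C.dom) (h' : w' ≫ C.vcod = s' ≫ C.dom) :
    vcomp w s h = vcomp w' s' h' := by
  subst hw hs; rfl

theorem vcomp_ident {K : E} (w : K ⟶ C.Vert) (h : w ≫ C.vcod = ((w ≫ C.vcod) ≫ C.ident) ≫ C.dom) :
    vcomp w ((w ≫ C.vcod) ≫ C.ident) h = w := by
  refine vert_ext ?_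
  have e : (w ≫ C.vertι) ≫ C.cod = (((w ≫ C.vertι) ≫ C.cod) ≫ C.ident) ≫ C.dom := by
    simp [C.ident_dom]
  rw [vcomp, vertEl_ι]
  refine (C.comp_congr rfl ?_ _ e).trans (C.comp_ident _ e)
  rw [vcod, Category.assoc, Category.assoc]; simp

theorem vcomp_comp {K : E} (w : K ⟶ C.Vert) (s r : K ⟶ C.Mor) (h : w ≫ C.vcod = s ≫ C.dom)
    (h₁ : s ≫ C.cod = r ≫ C.dom) (h₂ : vcomp w s h ≫ C.vcod = r ≫ C.dom)
    (h₃ : w ≫ C.vcod = C.comp s r h₁ ≫ C.dom) :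
    vcomp (vcomp w s h) r h₂ = vcomp w (C.comp s r h₁) h₃ := by
  refine vert_ext ?_
  have e : (w ≫ C.vertι) ≫ C.cod = s ≫ C.dom := by rw [← h, vcod, Category.assoc]
  have e' : C.comp (w ≫ C.vertι) s e ≫ C.cod = r ≫ C.dom := by rw [C.comp_cod, h₁]
  refine (vcomp_ι _ _ _).trans (Eq.trans ?_ (vcomp_ι _ _ _).symm)
  exact (C.comp_congr (vcomp_ι _ _ _) rfl _ e').trans (C.assoc _ _ _ _ _ _ _)

/-- The identity vertex of `[0]`. -/
def idVert (K : E) : K ⟶ C.Vert := vertEl (NN.zeroAt K ≫ C.ident) (by simp [C.ident_dom])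

@[simp]
theorem idVert_vcod (K : E) : idVert K ≫ C.vcod = NN.zeroAt K := by
  rw [idVert, vertEl_vcod, Category.assoc, C.ident_cod, Category.comp_id]

@[simp]
theorem comp_idVert {K L : E} (σ : L ⟶ K) : σ ≫ idVert (C := C) K = idVert L :=
  vert_ext (by rw [Category.assoc, idVert, vertEl_ι, idVert, vertEl_ι, ← Category.assoc,
    NN.comp_zeroAt])

theorem idVert_vcomp {K : E} (w : K ⟶ C.Vert)
    (h : idVert K ≫ C.vcod = (w ≫ C.vertι) ≫ C.dom) : vcomp (idVert K) (w ≫ C.vertι) h = w := by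
  refine vert_ext ?_
  rw [vcomp, vertEl_ι]
  have e : (((w ≫ C.vertι) ≫ C.dom) ≫ C.ident) ≫ C.cod = (w ≫ C.vertι) ≫ C.dom := by
    simp [C.ident_cod]
  refine (C.comp_congr ?_ rfl _ e).trans (C.ident_comp _ e)
  rw [idVert, vertEl_ι, comp_vertι_dom]

end CubeCategory

open CubeCategory

namespace CubicalSet

/-- The restriction of an element to a vertex. -/
def restrict {X : CubicalSet C} {K : E} (x : K ⟶ X.carrier) (w : K ⟶ C.Vert)
    (h : w ≫ C.vcod = x ≫ X.dim) : K ⟶ (Γ C).obj X :=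
  Γel (X.act x (w ≫ C.vertι) (by rw [← h, vcod, Category.assoc]))
    (by rw [X.act_dim, comp_vertι_dom])

theorem restrict_ι {X : CubicalSet C} {K : E} (x : K ⟶ X.carrier) (w : K ⟶ C.Vert)
    (h : w ≫ C.vcod = x ≫ X.dim) : restrict x w h ≫ Γι X =
      X.act x (w ≫ C.vertι) (by rw [← h, vcod, Category.assoc]) :=
  Γel_ι _ _

theorem restrict_congr {X : CubicalSet C} {K : E} {x x' : K ⟶ X.carrier} {w w' : K ⟶ C.Vert}
    (hx : x = x') (hw : w = w') (h : w ≫ C.vcod = x ≫ X.dim) (h' : w' ≫ C.vcod = x' ≫ X.dim) :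
    restrict x w h = restrict x' w' h' := by
  subst hx hw; rfl

theorem comp_restrict {X : CubicalSet C} {K L : E} (σ : L ⟶ K) (x : K ⟶ X.carrier)
    (w : K ⟶ C.Vert) (h : w ≫ C.vcod = x ≫ X.dim) (h' : (σ ≫ w) ≫ C.vcod = (σ ≫ x) ≫ X.dim) :
    σ ≫ restrict x w h = restrict (σ ≫ x) (σ ≫ w) h' := by
  refine Γel_ext ?_
  have e : (σ ≫ w ≫ C.vertι) ≫ C.cod = (σ ≫ x) ≫ X.dim := by rw [← h', vcod]; simp
  rw [restrict, restrict, Category.assoc, Γel_ι, Γel_ι, X.act_nat _ _ _ _ e]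
  exact X.act_congr rfl (Category.assoc _ _ _).symm _ _

theorem restrict_map {X Y : CubicalSet C} (f : X ⟶ Y) {K : E} (x : K ⟶ X.carrier)
    (w : K ⟶ C.Vert) (h : w ≫ C.vcod = x ≫ X.dim) (h' : w ≫ C.vcod = (x ≫ f.hom) ≫ Y.dim) :
    restrict x w h ≫ (Γ C).map f = restrict (x ≫ f.hom) w h' := by
  refine Γel_ext ?_
  rw [Category.assoc, Γmap_ι, restrict, Γel_ι_assoc, f.act_eq, restrict, Γel_ι]

theorem restrict_act {X : CubicalSet C} {K : E} (x : K ⟶ X.carrier) (s : K ⟶ C.Mor)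
    (w : K ⟶ C.Vert) (h : s ≫ C.cod = x ≫ X.dim) (h₁ : w ≫ C.vcod = s ≫ C.dom)
    (h₂ : w ≫ C.vcod = X.act x s h ≫ X.dim) (h₃ : vcomp w s h₁ ≫ C.vcod = x ≫ X.dim) :
    restrict (X.act x s h) w h₂ = restrict x (vcomp w s h₁) h₃ := by
  refine Γel_ext ?_
  have e : (w ≫ C.vertι) ≫ C.cod = s ≫ C.dom := by rw [← h₁, vcod, Category.assoc]
  rw [restrict, restrict, Γel_ι, Γel_ι, X.act_comp _ _ _ _ _ e (by rw [C.comp_cod, h])]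
  exact X.act_congr rfl (vertEl_ι _ _).symm _ _

theorem restrict_idVert {X : CubicalSet C} {K : E} (x : K ⟶ (Γ C).obj X)
    (h : idVert K ≫ C.vcod = (x ≫ Γι X) ≫ X.dim) : restrict (x ≫ Γι X) (idVert K) h = x := by
  refine Γel_ext ?_
  have e : (((x ≫ Γι X) ≫ X.dim) ≫ C.ident) ≫ C.cod = (x ≫ Γι X) ≫ X.dim := by
    simp [C.ident_cod]
  rw [restrict, Γel_ι]
  refine (X.act_congr rfl ?_ _ e).trans (X.act_ident _ e)
  rw [idVert, vertEl_ι]; simp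

theorem restrict_val {X : CubicalSet C} {A : E} (a : X ⟶ (Δ C).obj A) {K : E} (x : K ⟶ X.carrier)
    (w : K ⟶ C.Vert) (h : w ≫ C.vcod = x ≫ X.dim) :
    restrict x w h ≫ Γι X ≫ val a = x ≫ val a := by
  rw [restrict, Γel_ι_assoc, act_val]

variable [LocallyCartesianClosed E]

variable (C) in
/-- The functions from the vertices of cubes to `A`. -/
def vertFun (A : E) : DepProd C.vcod (prod.snd : A ⨯ C.Vert ⟶ C.Vert) := depProd _ _

/-- Evaluation of a function at a vertex. -/
def vapp {A K : E} (d : K ⟶ (vertFun C A).obj) (w : K ⟶ C.Vert)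
    (h : d ≫ (vertFun C A).p = w ≫ C.vcod) : K ⟶ A :=
  (vertFun C A).app d w h ≫ prod.fst

theorem comp_vapp {A K L : E} (σ : L ⟶ K) (d : K ⟶ (vertFun C A).obj) (w : K ⟶ C.Vert)
    (h : d ≫ (vertFun C A).p = w ≫ C.vcod) (h' : (σ ≫ d) ≫ (vertFun C A).p = (σ ≫ w) ≫ C.vcod) :
    σ ≫ vapp d w h = vapp (σ ≫ d) (σ ≫ w) h' := by
  rw [vapp, vapp, ← Category.assoc, (vertFun C A).app_nat _ _ _ _ h']

theorem vapp_congr {A K : E} {d d' : K ⟶ (vertFun C A).obj} {w w' : K ⟶ C.Vert}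
    (hd : d = d') (hw : w = w') (h : d ≫ (vertFun C A).p = w ≫ C.vcod)
    (h' : d' ≫ (vertFun C A).p = w' ≫ C.vcod) : vapp d w h = vapp d' w' h' := by
  subst hd hw; rfl

theorem vapp_ext {A K : E} {d d' : K ⟶ (vertFun C A).obj}
    (h : d ≫ (vertFun C A).p = d' ≫ (vertFun C A).p)
    (w : ∀ {L : E} (σ : L ⟶ K) (a : L ⟶ C.Vert) (h₁ : (σ ≫ d) ≫ (vertFun C A).p = a ≫ C.vcod)
      (h₂ : (σ ≫ d') ≫ (vertFun C A).p = a ≫ C.vcod), vapp (σ ≫ d) a h₁ = vapp (σ ≫ d') a h₂) :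
    d = d' :=
  (vertFun C A).ext d d' h fun σ a h₁ h₂ => Limits.prod.hom_ext (w σ a h₁ h₂)
    (by rw [DepProd.app_over, DepProd.app_over])

/-- The function on vertices with given values. -/
def vlam {A K : E} (n : K ⟶ NN.N) (k : pullback n C.vcod ⟶ A) : K ⟶ (vertFun C A).obj :=
  (vertFun C A).lam n (prod.lift k (pullback.snd _ _)) (prod.lift_snd _ _)

@[simp]
theorem vlam_p {A K : E} (n : K ⟶ NN.N) (k : pullback n C.vcod ⟶ A) :
    vlam n k ≫ (vertFun C A).p = n :=
  (vertFun C A).lam_p _ _ _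

theorem vapp_vlam {A K L : E} (σ : L ⟶ K) (n : K ⟶ NN.N) (k : pullback n C.vcod ⟶ A)
    (a : L ⟶ C.Vert) (h : (σ ≫ vlam n k) ≫ (vertFun C A).p = a ≫ C.vcod)
    (h' : σ ≫ n = a ≫ C.vcod) : vapp (σ ≫ vlam n k) a h = pullback.lift σ a h' ≫ k := by
  rw [vapp]
  rw [show (vertFun C A).app (σ ≫ vlam n k) a h = _ from
    (vertFun C A).app_lam σ n _ (prod.lift_snd _ _) a h h']
  rw [Category.assoc, prod.lift_fst]

/-- The action on functions on vertices. -/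
def vact {A K : E} (d : K ⟶ (vertFun C A).obj) (s : K ⟶ C.Mor)
    (h : s ≫ C.cod = d ≫ (vertFun C A).p) : K ⟶ (vertFun C A).obj :=
  vlam (s ≫ C.dom) (vapp (pullback.fst _ _ ≫ d) (vcomp (pullback.snd _ _) (pullback.fst _ _ ≫ s)
    (by rw [← pullback.condition, Category.assoc]))
    (by rw [vcomp_vcod, Category.assoc, Category.assoc, h]))

@[simp]
theorem vact_p {A K : E} (d : K ⟶ (vertFun C A).obj) (s : K ⟶ C.Mor)
    (h : s ≫ C.cod = d ≫ (vertFun C A).p) : vact d s h ≫ (vertFun C A).p = s ≫ C.dom :=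
  vlam_p _ _

theorem vapp_vact {A K L : E} (σ : L ⟶ K) (d : K ⟶ (vertFun C A).obj) (s : K ⟶ C.Mor)
    (h : s ≫ C.cod = d ≫ (vertFun C A).p) (a : L ⟶ C.Vert)
    (h₁ : (σ ≫ vact d s h) ≫ (vertFun C A).p = a ≫ C.vcod)
    (h₂ : a ≫ C.vcod = (σ ≫ s) ≫ C.dom)
    (h₃ : (σ ≫ d) ≫ (vertFun C A).p = vcomp a (σ ≫ s) h₂ ≫ C.vcod) :
    vapp (σ ≫ vact d s h) a h₁ = vapp (σ ≫ d) (vcomp a (σ ≫ s) h₂) h₃ := by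
  have e : σ ≫ s ≫ C.dom = a ≫ C.vcod := by rw [h₂, Category.assoc]
  refine (vapp_vlam σ _ _ a h₁ e).trans ?_
  have e₁ : pullback.lift σ a e ≫ pullback.fst _ _ ≫ d = σ ≫ d := by simp
  have e₂ : (pullback.lift σ a e ≫ pullback.snd _ _) ≫ C.vcod =
      (pullback.lift σ a e ≫ pullback.fst _ _ ≫ s) ≫ C.dom := by simp [← e]
  have e₃ : pullback.lift σ a e ≫ vcomp (pullback.snd _ _) (pullback.fst _ _ ≫ s)
      (by rw [← pullback.condition, Category.assoc]) = vcomp a (σ ≫ s) h₂ :=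
    (comp_vcomp _ _ _ _ e₂).trans (vcomp_congr (by simp) (by simp) _ _)
  rw [comp_vapp _ _ _ _ (by rw [e₁, e₃, h₃])]
  exact vapp_congr e₁ e₃ _ _

variable (C) in
/-- The right adjoint of the global points functor, on objects: the elements of dimension `n` are
the functions from the vertices of the `n`-cube to `A`. -/
def codisc (A : E) : CubicalSet C where
  carrier := (vertFun C A).obj
  dim := (vertFun C A).p
  act := vact
  act_dim := vact_p
  act_nat {L K} σ d s h h' := by
    refine vapp_ext (by rw [Category.assoc, vact_p, vact_p, Category.assoc]) ?_
    intro M τ a h₁ h₂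
    have e₁ : a ≫ C.vcod = (τ ≫ σ ≫ s) ≫ C.dom := by rw [← h₁]; simp
    have e₂ : a ≫ C.vcod = ((τ ≫ σ) ≫ s) ≫ C.dom := by rw [← h₁]; simp
    rw [vapp_congr (Category.assoc _ _ _).symm rfl h₁ (by rw [← h₁]; simp),
      vapp_vact (τ ≫ σ) d s h a _ e₂ (by rw [vcomp_vcod]; simp [h]),
      vapp_vact τ (σ ≫ d) (σ ≫ s) h' a _ e₁ (by rw [vcomp_vcod]; simp [h])]
    exact vapp_congr (by simp) (vcomp_congr rfl (by simp) _ _) _ _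
  act_ident {K} d h := by
    refine vapp_ext (by rw [vact_p]; simp [C.ident_dom]) ?_
    intro M τ a h₁ h₂
    have e₁ : a ≫ C.vcod = (τ ≫ (d ≫ (vertFun C A).p) ≫ C.ident) ≫ C.dom := by
      rw [← h₂]; simp [C.ident_dom]
    rw [vapp_vact τ _ _ h a _ e₁ (by rw [vcomp_vcod]; simp [C.ident_cod])]
    refine vapp_congr rfl ?_ _ _
    have e₂ : a ≫ C.vcod = ((a ≫ C.vcod) ≫ C.ident) ≫ C.dom := by simp [C.ident_dom]
    exact (vcomp_congr rfl (by rw [← h₂]; simp) _ e₂).trans (vcomp_ident a e₂)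
  act_comp {K} d s r h h₁ h₂ h₃ := by
    refine vapp_ext (by rw [vact_p, vact_p, C.comp_dom]) ?_
    intro M τ a k₁ k₂
    have e₁ : a ≫ C.vcod = (τ ≫ r) ≫ C.dom := by
      rw [← k₁, Category.assoc, vact_p, Category.assoc]
    have e₂ : vcomp a (τ ≫ r) e₁ ≫ C.vcod = (τ ≫ s) ≫ C.dom := by
      rw [vcomp_vcod, Category.assoc, h₂, Category.assoc]
    have e₃ : (τ ≫ r) ≫ C.cod = (τ ≫ s) ≫ C.dom := by rw [Category.assoc, h₂, Category.assoc]
    have e₄ : a ≫ C.vcod = (τ ≫ C.comp r s h₂) ≫ C.dom := by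
      rw [e₁, Category.assoc, Category.assoc, C.comp_dom]
    rw [vapp_vact τ _ r _ a _ e₁ (by
        rw [Category.assoc, vact_p, vcomp_vcod, Category.assoc, h₂]),
      vapp_vact τ d s h _ _ e₂ (by rw [vcomp_vcod, Category.assoc, Category.assoc, h]),
      vapp_vact τ d _ h₃ a _ e₄ (by rw [vcomp_vcod, Category.assoc, Category.assoc, h₃])]
    refine vapp_congr rfl ?_ _ _
    rw [vcomp_comp _ _ _ _ e₃ _ (by rw [C.comp_dom, e₁])]
    exact vcomp_congr rfl (C.comp_nat _ _ _ _ _).symm _ _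

/-- Evaluation of an element of `codisc A` at a vertex. -/
def capp {A K : E} (d : K ⟶ (codisc C A).carrier) (w : K ⟶ C.Vert)
    (h : w ≫ C.vcod = d ≫ (codisc C A).dim) : K ⟶ A :=
  vapp d w h.symm

theorem comp_capp {A K L : E} (σ : L ⟶ K) (d : K ⟶ (codisc C A).carrier) (w : K ⟶ C.Vert)
    (h : w ≫ C.vcod = d ≫ (codisc C A).dim)
    (h' : (σ ≫ w) ≫ C.vcod = (σ ≫ d) ≫ (codisc C A).dim) :
    σ ≫ capp d w h = capp (σ ≫ d) (σ ≫ w) h' :=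
  comp_vapp _ _ _ _ _

theorem capp_congr {A K : E} {d d' : K ⟶ (codisc C A).carrier} {w w' : K ⟶ C.Vert}
    (hd : d = d') (hw : w = w') (h : w ≫ C.vcod = d ≫ (codisc C A).dim)
    (h' : w' ≫ C.vcod = d' ≫ (codisc C A).dim) : capp d w h = capp d' w' h' :=
  vapp_congr hd hw _ _

theorem capp_ext {A K : E} {d d' : K ⟶ (codisc C A).carrier}
    (h : d ≫ (codisc C A).dim = d' ≫ (codisc C A).dim)
    (w : ∀ {L : E} (σ : L ⟶ K) (a : L ⟶ C.Vert) (h₁ : a ≫ C.vcod = (σ ≫ d) ≫ (codisc C A).dim)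
      (h₂ : a ≫ C.vcod = (σ ≫ d') ≫ (codisc C A).dim), capp (σ ≫ d) a h₁ = capp (σ ≫ d') a h₂) :
    d = d' :=
  vapp_ext h fun σ a h₁ h₂ => w σ a h₁.symm h₂.symm

/-- The element of `codisc A` with given values. -/
def clam {A K : E} (n : K ⟶ NN.N) (k : pullback n C.vcod ⟶ A) : K ⟶ (codisc C A).carrier :=
  vlam n k

theorem clam_dim {A K : E} (n : K ⟶ NN.N) (k : pullback n C.vcod ⟶ A) :
    clam n k ≫ (codisc C A).dim = n :=
  vlam_p _ _

theorem capp_clam {A K L : E} (σ : L ⟶ K) (n : K ⟶ NN.N) (k : pullback n C.vcod ⟶ A)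
    (a : L ⟶ C.Vert) (h : a ≫ C.vcod = (σ ≫ clam n k) ≫ (codisc C A).dim)
    (h' : σ ≫ n = a ≫ C.vcod) : capp (σ ≫ clam n k) a h = pullback.lift σ a h' ≫ k :=
  vapp_vlam _ _ _ _ _ _

theorem capp_act {A K : E} (d : K ⟶ (codisc C A).carrier) (s : K ⟶ C.Mor)
    (h : s ≫ C.cod = d ≫ (codisc C A).dim) (a : K ⟶ C.Vert)
    (h₁ : a ≫ C.vcod = (codisc C A).act d s h ≫ (codisc C A).dim)
    (h₂ : a ≫ C.vcod = s ≫ C.dom) (h₃ : vcomp a s h₂ ≫ C.vcod = d ≫ (codisc C A).dim) :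
    capp ((codisc C A).act d s h) a h₁ = capp d (vcomp a s h₂) h₃ := by
  have e₁ : a ≫ C.vcod = (𝟙 K ≫ s) ≫ C.dom := by rw [Category.id_comp, h₂]
  have e₂ : (𝟙 K ≫ d) ≫ (vertFun C A).p = vcomp a (𝟙 K ≫ s) e₁ ≫ C.vcod := by
    rw [vcomp_vcod, Category.id_comp, Category.id_comp]; exact h.symm
  have e₃ : (𝟙 K ≫ vact d s h) ≫ (vertFun C A).p = a ≫ C.vcod := by
    exact (congrArg (· ≫ _) (Category.id_comp _)).trans ((vact_p _ _ _).trans h₂.symm)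
  refine (vapp_congr (Category.id_comp _).symm rfl _ e₃).trans ?_
  refine (vapp_vact (𝟙 K) d s h a e₃ e₁ e₂).trans ?_
  exact vapp_congr (Category.id_comp _) (vcomp_congr rfl (Category.id_comp _) _ _) _ _

/-- The carrier of `toCodisc`. -/
def toCodiscHom {X : CubicalSet C} {A : E} (g : (Γ C).obj X ⟶ A) :
    X.carrier ⟶ (codisc C A).carrier :=
  clam X.dim (restrict (pullback.fst _ _) (pullback.snd X.dim C.vcod)
    pullback.condition.symm ≫ g)

theorem capp_toCodiscHom {X : CubicalSet C} {A : E} (g : (Γ C).obj X ⟶ A) {L : E}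
    (y : L ⟶ X.carrier) (a : L ⟶ C.Vert)
    (h₁ : a ≫ C.vcod = (y ≫ toCodiscHom g) ≫ (codisc C A).dim) (h₂ : a ≫ C.vcod = y ≫ X.dim) :
    capp (y ≫ toCodiscHom g) a h₁ = restrict y a h₂ ≫ g := by
  refine (capp_clam _ _ _ _ _ h₂.symm).trans ?_
  rw [← Category.assoc, comp_restrict _ _ _ _ (by simp [h₂])]
  congr 1
  exact restrict_congr (by simp) (by simp) _ _

theorem toCodiscHom_dim {X : CubicalSet C} {A : E} (g : (Γ C).obj X ⟶ A) :
    toCodiscHom g ≫ (codisc C A).dim = X.dim :=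
  clam_dim _ _

/-- The map into `codisc A` determined by a function on global points. -/
def toCodisc {X : CubicalSet C} {A : E} (g : (Γ C).obj X ⟶ A) : X ⟶ codisc C A where
  hom := toCodiscHom g
  hom_dim := toCodiscHom_dim g
  act_hom {K} x s h h' := by
    refine capp_ext ?_ ?_
    · rw [act_dim, Category.assoc, toCodiscHom_dim, X.act_dim]
    · intro L τ a h₁ h₂
      have e₀ : a ≫ C.vcod = (τ ≫ s) ≫ C.dom := by
        rw [h₂, Category.assoc, act_dim, Category.assoc]
      have e₁ : (τ ≫ s) ≫ C.cod = ((τ ≫ x) ≫ toCodiscHom g) ≫ (codisc C A).dim := by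
        simp only [Category.assoc, toCodiscHom_dim, h]
      have e₂ : (τ ≫ s) ≫ C.cod = (τ ≫ x) ≫ X.dim := by simp [h]
      have e₄ : (τ ≫ s) ≫ C.cod = (τ ≫ x ≫ toCodiscHom g) ≫ (codisc C A).dim := by
        rw [e₁]; simp only [Category.assoc]
      have e₅ : τ ≫ X.act x s h ≫ toCodiscHom g = X.act (τ ≫ x) (τ ≫ s) e₂ ≫ toCodiscHom g := by
        rw [← Category.assoc, X.act_nat _ _ _ _ e₂]
      have e₆ : τ ≫ (codisc C A).act (x ≫ toCodiscHom g) s h' =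
          (codisc C A).act ((τ ≫ x) ≫ toCodiscHom g) (τ ≫ s) e₁ :=
        ((codisc C A).act_nat _ _ _ _ e₄).trans
          ((codisc C A).act_congr (Category.assoc _ _ _).symm rfl _ _)
      rw [capp_congr e₅ rfl h₁ (by rw [Category.assoc, toCodiscHom_dim, X.act_dim, e₀]),
        capp_congr e₆ rfl h₂ (by rw [e₀, act_dim]),
        capp_toCodiscHom g _ a _ (by rw [e₀, X.act_dim]),
        capp_act _ _ _ _ _ e₀ (by rw [vcomp_vcod, e₁]),
        capp_toCodiscHom g _ _ _ (by rw [vcomp_vcod, e₂]),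
        restrict_act _ _ _ _ e₀]

theorem toCodisc_hom {X : CubicalSet C} {A : E} (g : (Γ C).obj X ⟶ A) :
    (toCodisc g).hom = toCodiscHom g := rfl

/-- The counit: evaluation of a function at the vertex of the `0`-cube. -/
def codiscCounit (A : E) : (Γ C).obj (codisc C A) ⟶ A :=
  capp (Γι (codisc C A)) (idVert _) (by rw [idVert_vcod, Γι_dim])

theorem comp_codiscCounit {A K : E} (x : K ⟶ (Γ C).obj (codisc C A))
    (h : idVert K ≫ C.vcod = (x ≫ Γι _) ≫ (codisc C A).dim) :
    x ≫ codiscCounit A = capp (x ≫ Γι _) (idVert K) h := by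
  rw [codiscCounit, comp_capp _ _ _ _ (by simp)]
  exact capp_congr rfl (comp_idVert _) _ _

theorem toCodisc_counit {X : CubicalSet C} {A : E} (g : (Γ C).obj X ⟶ A) :
    (Γ C).map (toCodisc g) ≫ codiscCounit A = g := by
  have e : idVert ((Γ C).obj X) ≫ C.vcod = (𝟙 _ ≫ Γι X) ≫ X.dim := by simp
  rw [comp_codiscCounit _ (by rw [Γmap_ι, Category.assoc, toCodisc_hom, toCodiscHom_dim, Γι_dim, idVert_vcod]),
    capp_congr (Γmap_ι _) rfl _ (by
      rw [Category.assoc, toCodisc_hom, toCodiscHom_dim, Γι_dim, idVert_vcod])]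
  refine (capp_toCodiscHom g _ _ _ (by simp)).trans ?_
  rw [restrict_congr (Category.id_comp _).symm rfl _ e, restrict_idVert, Category.id_comp]

/-- The value of `f x` at a vertex `a` is the value, at the unique vertex of the `0`-cube, of `f`
applied to the restriction of `x` to `a`. Hence `f` is recovered from its effect on global points.
-/
theorem toCodisc_counit_self {X : CubicalSet C} {A : E} (f : X ⟶ codisc C A) :
    toCodisc ((Γ C).map f ≫ codiscCounit A) = f := by
  refine hom_ext (capp_ext (by rw [Hom.dim_eq, Hom.dim_eq]) ?_)
  intro L σ a h₁ h₂
  have e₀ : a ≫ C.vcod = σ ≫ X.dim := by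
    rw [h₂, Category.assoc, f.dim_eq]
  refine (capp_toCodiscHom _ _ _ _ e₀).trans ?_
  have e₁ : (a ≫ C.vertι) ≫ C.cod = (σ ≫ f.hom) ≫ (codisc C A).dim := by
    rw [← h₂, vcod, Category.assoc]
  rw [← Category.assoc, restrict_map f _ _ _ h₂, comp_codiscCounit _ (by simp),
    capp_congr (restrict_ι _ _ _) rfl _ (by rw [act_dim]; simp),
    capp_act _ _ e₁ _ _ (by simp) (by rw [vcomp_vcod, e₁])]
  exact capp_congr rfl (idVert_vcomp a _) _ _

theorem codisc_hom_ext {X : CubicalSet C} {A : E} {f g : X ⟶ codisc C A}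
    (h : (Γ C).map f ≫ codiscCounit A = (Γ C).map g ≫ codiscCounit A) : f = g := by
  rw [← toCodisc_counit_self f, h, toCodisc_counit_self]

end CubicalSet
end RightAdjoint
end
end CubicalReals

/-! ### Dependent products along maps of constant cubical sets. -/

namespace CubicalReals
noncomputable section

section DependentProducts

variable {E : Type u} [Category.{v} E] [HasFiniteLimits E] {NN : NNO E}
  {C : CubeCategory NN}

attribute [local simp] pullback.lift_fst pullback.lift_snd pullback.lift_fst_assoc
  pullback.lift_snd_assoc prod.lift_fst prod.lift_snd prod.lift_fst_assoc prod.lift_snd_assoc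

namespace CubicalSet

variable [LocallyCartesianClosed E] {A B : E} (f : A ⟶ B) {T : CubicalSet C}
  (g : T ⟶ (Δ C).obj A)

/-- The carrier of the dependent product of `g : T ⟶ Δ A` along `Δ f`. -/
def piCar : DepProd ((Δ C).map f).hom g.hom := depProd _ _

variable {f g}

theorem pi_app_dim {K : E} (d : K ⟶ (piCar f g).obj) (a : K ⟶ ((Δ C).obj A).carrier)
    (h : d ≫ (piCar f g).p = a ≫ ((Δ C).map f).hom) :
    (piCar f g).app d a h ≫ T.dim = d ≫ (piCar f g).p ≫ ((Δ C).obj B).dim := by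
  rw [← g.dim_eq, ← Category.assoc, (piCar f g).app_over, ← Category.assoc, h, Category.assoc,
    Hom.dim_eq]

/-- The argument of an element of a dependent product in a different dimension. -/
def shift {K : E} (a : K ⟶ ((Δ C).obj A).carrier) (n : K ⟶ NN.N) : K ⟶ ((Δ C).obj A).carrier :=
  Δel (a ≫ Δval A) n

/-- An argument in a constant cubical set exists in every dimension. A function `d` can therefore be
restricted along `s` by applying it to the argument moved to the codomain of `s` and then
restricting the result. This is why the dependent product in `E` serves as carrier, without
quantifying over maps of cubes. -/
theorem pi_shift {K : E} (d : K ⟶ (piCar f g).obj) (s : K ⟶ C.Mor)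
    (h : s ≫ C.cod = d ≫ (piCar f g).p ≫ ((Δ C).obj B).dim) (a : K ⟶ ((Δ C).obj A).carrier)
    (ha : Δel (d ≫ (piCar f g).p ≫ Δval B) (s ≫ C.dom) = a ≫ ((Δ C).map f).hom) :
    d ≫ (piCar f g).p = shift a (s ≫ C.cod) ≫ ((Δ C).map f).hom := by
  refine Δel_ext ?_ ?_
  · have := congrArg (· ≫ Δval B) ha
    simp only [Δel_val, Category.assoc, Δmap_val] at this
    rw [Category.assoc, this, Category.assoc, Δmap_val, shift, Δel_val_assoc, Category.assoc]
  · rw [Category.assoc, Category.assoc, Hom.dim_eq, shift, Δel_dim, h]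

/-- The value of the restriction along `s` of `d` at `a`. -/
def piActApp {K : E} (d : K ⟶ (piCar f g).obj) (s : K ⟶ C.Mor)
    (h : s ≫ C.cod = d ≫ (piCar f g).p ≫ ((Δ C).obj B).dim) (a : K ⟶ ((Δ C).obj A).carrier)
    (ha : Δel (d ≫ (piCar f g).p ≫ Δval B) (s ≫ C.dom) = a ≫ ((Δ C).map f).hom) :
    K ⟶ T.carrier :=
  T.act ((piCar f g).app d (shift a (s ≫ C.cod)) (pi_shift d s h a ha)) s
    (by rw [pi_app_dim, h])

theorem comp_piActApp {K L : E} (σ : L ⟶ K) (d : K ⟶ (piCar f g).obj) (s : K ⟶ C.Mor)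
    (h : s ≫ C.cod = d ≫ (piCar f g).p ≫ ((Δ C).obj B).dim) (a : K ⟶ ((Δ C).obj A).carrier)
    (ha : Δel (d ≫ (piCar f g).p ≫ Δval B) (s ≫ C.dom) = a ≫ ((Δ C).map f).hom)
    (h' : (σ ≫ s) ≫ C.cod = (σ ≫ d) ≫ (piCar f g).p ≫ ((Δ C).obj B).dim)
    (ha' : Δel ((σ ≫ d) ≫ (piCar f g).p ≫ Δval B) ((σ ≫ s) ≫ C.dom) =
      (σ ≫ a) ≫ ((Δ C).map f).hom) :
    σ ≫ piActApp d s h a ha = piActApp (σ ≫ d) (σ ≫ s) h' (σ ≫ a) ha' := by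
  have e : (σ ≫ d) ≫ (piCar f g).p =
      (σ ≫ shift a (s ≫ C.cod)) ≫ ((Δ C).map f).hom := by
    rw [Category.assoc, pi_shift d s h a ha, Category.assoc]
  rw [piActApp, T.act_nat _ _ _ _ (by
    rw [(piCar f g).app_nat _ _ _ _ e, pi_app_dim, h']), piActApp]
  refine T.act_congr ?_ rfl _ _
  rw [(piCar f g).app_nat _ _ _ _ e]
  exact (piCar f g).app_congr rfl (by rw [shift, comp_Δel, shift]; simp) _ _

theorem piActApp_congr {K : E} {d d' : K ⟶ (piCar f g).obj} {s s' : K ⟶ C.Mor}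
    {a a' : K ⟶ ((Δ C).obj A).carrier} (hd : d = d') (hs : s = s') (haa : a = a')
    (h : s ≫ C.cod = d ≫ (piCar f g).p ≫ ((Δ C).obj B).dim)
    (ha : Δel (d ≫ (piCar f g).p ≫ Δval B) (s ≫ C.dom) = a ≫ ((Δ C).map f).hom)
    (h' : s' ≫ C.cod = d' ≫ (piCar f g).p ≫ ((Δ C).obj B).dim)
    (ha' : Δel (d' ≫ (piCar f g).p ≫ Δval B) (s' ≫ C.dom) = a' ≫ ((Δ C).map f).hom) :
    piActApp d s h a ha = piActApp d' s' h' a' ha' := by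
  subst hd hs haa; rfl

theorem piActApp_over {K : E} (d : K ⟶ (piCar f g).obj) (s : K ⟶ C.Mor)
    (h : s ≫ C.cod = d ≫ (piCar f g).p ≫ ((Δ C).obj B).dim) (a : K ⟶ ((Δ C).obj A).carrier)
    (ha : Δel (d ≫ (piCar f g).p ≫ Δval B) (s ≫ C.dom) = a ≫ ((Δ C).map f).hom) :
    piActApp d s h a ha ≫ g.hom = a := by
  rw [piActApp, g.act_eq]
  refine Δel_ext ?_ ?_
  · rw [act_Δval, (piCar f g).app_over, shift, Δel_val]
  · have := congrArg (· ≫ ((Δ C).obj B).dim) ha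
    simp only [Δel_dim, Category.assoc, Hom.dim_eq] at this
    rw [act_dim, this]

/-- The action on the dependent product. -/
def piAct {K : E} (d : K ⟶ (piCar f g).obj) (s : K ⟶ C.Mor)
    (h : s ≫ C.cod = d ≫ (piCar f g).p ≫ ((Δ C).obj B).dim) : K ⟶ (piCar f g).obj :=
  (piCar f g).lam (Δel (d ≫ (piCar f g).p ≫ Δval B) (s ≫ C.dom))
    (piActApp (pullback.fst _ _ ≫ d) (pullback.fst _ _ ≫ s)
      (by rw [Category.assoc, h, Category.assoc]) (pullback.snd _ _)
      (by rw [← pullback.condition, comp_Δel]; simp)) (piActApp_over _ _ _ _ _)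

theorem piAct_p {K : E} (d : K ⟶ (piCar f g).obj) (s : K ⟶ C.Mor)
    (h : s ≫ C.cod = d ≫ (piCar f g).p ≫ ((Δ C).obj B).dim) :
    piAct d s h ≫ (piCar f g).p = Δel (d ≫ (piCar f g).p ≫ Δval B) (s ≫ C.dom) :=
  (piCar f g).lam_p _ _ _

theorem app_piAct {K L : E} (σ : L ⟶ K) (d : K ⟶ (piCar f g).obj) (s : K ⟶ C.Mor)
    (h : s ≫ C.cod = d ≫ (piCar f g).p ≫ ((Δ C).obj B).dim)
    (a : L ⟶ ((Δ C).obj A).carrier)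
    (h₁ : (σ ≫ piAct d s h) ≫ (piCar f g).p = a ≫ ((Δ C).map f).hom)
    (h₂ : (σ ≫ s) ≫ C.cod = (σ ≫ d) ≫ (piCar f g).p ≫ ((Δ C).obj B).dim)
    (h₃ : Δel ((σ ≫ d) ≫ (piCar f g).p ≫ Δval B) ((σ ≫ s) ≫ C.dom) =
      a ≫ ((Δ C).map f).hom) :
    (piCar f g).app (σ ≫ piAct d s h) a h₁ = piActApp (σ ≫ d) (σ ≫ s) h₂ a h₃ := by
  have e : σ ≫ Δel (d ≫ (piCar f g).p ≫ Δval B) (s ≫ C.dom) = a ≫ ((Δ C).map f).hom := by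
    rw [comp_Δel, ← h₃]; simp
  refine ((piCar f g).app_lam σ _ _ _ a h₁ e).trans ?_
  refine (comp_piActApp _ _ _ _ _ _ (by simpa using h₂) (by simpa using h₃)).trans ?_
  exact piActApp_congr (by simp) (by simp) (by simp) _ _ _ _

variable (f g) in
/-- The dependent product of `g : T ⟶ Δ A` along `Δ f`. -/
def pi : CubicalSet C where
  carrier := (piCar f g).obj
  dim := (piCar f g).p ≫ ((Δ C).obj B).dim
  act := piAct
  act_dim d s h := by rw [← Category.assoc, piAct_p, Δel_dim]
  act_nat {L K} σ d s h h' := by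
    refine (piCar f g).ext _ _ ?_ ?_
    · rw [Category.assoc, piAct_p, piAct_p, comp_Δel]; simp
    · intro M τ a h₁ h₂
      have e₁ : ((τ ≫ σ) ≫ piAct d s h) ≫ (piCar f g).p = a ≫ ((Δ C).map f).hom := by
        rw [← h₁]; simp
      have e₂ : Δel (((τ ≫ σ) ≫ d) ≫ (piCar f g).p ≫ Δval B) (((τ ≫ σ) ≫ s) ≫ C.dom) =
          a ≫ ((Δ C).map f).hom := by
        rw [← e₁, Category.assoc _ (piAct _ _ _), piAct_p, comp_Δel]; simp
      rw [(piCar f g).app_congr (Category.assoc _ _ _).symm rfl h₁ e₁,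
        app_piAct (τ ≫ σ) d s h a e₁ (by simp [h]) e₂,
        app_piAct τ _ _ h' a h₂ (by simp [h]) (by simpa using e₂)]
      exact piActApp_congr (by simp) (by simp) rfl _ _ _ _
  act_ident {K} d h := by
    refine (piCar f g).ext _ _ ?_ ?_
    · rw [piAct_p]
      exact Δel_ext (by simp) (by simp [C.ident_dom])
    · intro M τ a h₁ h₂
      have e₁ : a ≫ ((Δ C).obj A).dim = τ ≫ d ≫ (piCar f g).p ≫ ((Δ C).obj B).dim := by
        rw [← ((Δ C).map f).dim_eq, ← Category.assoc, ← h₂]; simp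
      rw [app_piAct τ _ _ h a h₁ (by simp [C.ident_cod]) (by
        rw [← h₁, Category.assoc _ (piAct _ _ _), piAct_p, comp_Δel]; simp)]
      have e₂ : ((((piCar f g).app (τ ≫ d) a h₂) ≫ T.dim) ≫ C.ident) ≫ C.cod =
          (piCar f g).app (τ ≫ d) a h₂ ≫ T.dim := by
        rw [Category.assoc, C.ident_cod, Category.comp_id]
      rw [piActApp]
      refine (T.act_congr ?_ ?_ _ e₂).trans (T.act_ident _ e₂)
      · refine (piCar f g).app_congr rfl (Δel_ext ?_ ?_) _ _
        · rw [shift, Δel_val]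
        · rw [shift, Δel_dim, e₁]; simp [C.ident_cod]
      · rw [pi_app_dim]; simp
  act_comp {K} d s r h h₁ h₂ h₃ := by
    refine (piCar f g).ext _ _ ?_ ?_
    · rw [piAct_p, piAct_p, ← Category.assoc (piAct d s h), piAct_p, Δel_val, C.comp_dom]
    · intro M τ a k₁ k₂
      have e₁ : Δel ((τ ≫ piAct d s h) ≫ (piCar f g).p ≫ Δval B) ((τ ≫ r) ≫ C.dom) =
          a ≫ ((Δ C).map f).hom := by
        rw [← k₁, Category.assoc _ (piAct (piAct d s h) r h₁), piAct_p, comp_Δel]; simp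
      have e₂ : (τ ≫ r) ≫ C.cod =
          (τ ≫ piAct d s h) ≫ (piCar f g).p ≫ ((Δ C).obj B).dim := by
        rw [Category.assoc, h₁, Category.assoc]
      have e₃ : (τ ≫ s) ≫ C.cod = (τ ≫ d) ≫ (piCar f g).p ≫ ((Δ C).obj B).dim := by
        simp [h]
      have e₄ := pi_shift _ _ e₂ a e₁
      have e₅ : Δel ((τ ≫ d) ≫ (piCar f g).p ≫ Δval B) ((τ ≫ s) ≫ C.dom) =
          shift a ((τ ≫ r) ≫ C.cod) ≫ ((Δ C).map f).hom := by
        rw [← e₄, Category.assoc τ (piAct d s h), piAct_p, comp_Δel]; simp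
      have e₆ : Δel ((τ ≫ d) ≫ (piCar f g).p ≫ Δval B) ((τ ≫ C.comp r s h₂) ≫ C.dom) =
          a ≫ ((Δ C).map f).hom := by
        rw [← k₂, Category.assoc _ (piAct _ _ _), piAct_p, comp_Δel]; simp
      have e₇ : (τ ≫ C.comp r s h₂) ≫ C.cod =
          (τ ≫ d) ≫ (piCar f g).p ≫ ((Δ C).obj B).dim := by
        rw [Category.assoc, h₃, Category.assoc]
      have e₈ : (τ ≫ r) ≫ C.cod = (τ ≫ s) ≫ C.dom := by simp [h₂]
      rw [app_piAct τ _ r h₁ a k₁ e₂ e₁, app_piAct τ d _ h₃ a k₂ e₇ e₆]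
      have e₉ : (τ ≫ r) ≫ C.cod = piActApp (τ ≫ d) (τ ≫ s) e₃ _ e₅ ≫ T.dim := by
        rw [piActApp, T.act_dim, e₈]
      rw [piActApp, T.act_congr (app_piAct τ d s h _ e₄ e₃ e₅) rfl _ e₉]
      refine (T.act_comp _ _ _ _ _ e₈ (by rw [C.comp_cod, pi_app_dim, e₃])).trans ?_
      rw [piActApp]
      refine T.act_congr ?_ (C.comp_nat _ _ _ _ _).symm _ _
      refine (piCar f g).app_congr rfl ?_ _ _
      rw [shift, shift, shift, Δel_val, Category.assoc τ (C.comp r s h₂), C.comp_cod,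
        Category.assoc]

variable (f g) in
/-- The projection of the dependent product. -/
def piProj : pi f g ⟶ (Δ C).obj B where
  hom := (piCar f g).p
  hom_dim := rfl
  act_hom d s h h' := by
    refine (piAct_p d s h).trans (Δel_ext ?_ ?_)
    · rw [Δel_val, act_Δval]; exact (Category.assoc _ _ _).symm
    · rw [Δel_dim, act_dim]

theorem app_piAct_act {K : E} (d : K ⟶ (piCar f g).obj) (a : K ⟶ ((Δ C).obj A).carrier)
    (hd : d ≫ (piCar f g).p = a ≫ ((Δ C).map f).hom) (s : K ⟶ C.Mor)
    (h : s ≫ C.cod = d ≫ (piCar f g).p ≫ ((Δ C).obj B).dim)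
    (ha : s ≫ C.cod = a ≫ ((Δ C).obj A).dim)
    (e : piAct d s h ≫ (piCar f g).p = ((Δ C).obj A).act a s ha ≫ ((Δ C).map f).hom)
    (h' : s ≫ C.cod = (piCar f g).app d a hd ≫ T.dim) :
    (piCar f g).app (piAct d s h) (((Δ C).obj A).act a s ha) e =
      T.act ((piCar f g).app d a hd) s h' := by
  have e₁ : (𝟙 K ≫ piAct d s h) ≫ (piCar f g).p =
      ((Δ C).obj A).act a s ha ≫ ((Δ C).map f).hom := by rw [Category.id_comp, e]
  have e₂ : Δel ((𝟙 K ≫ d) ≫ (piCar f g).p ≫ Δval B) ((𝟙 K ≫ s) ≫ C.dom) =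
      ((Δ C).obj A).act a s ha ≫ ((Δ C).map f).hom := by rw [← e, piAct_p]; simp
  refine ((piCar f g).app_congr (Category.id_comp _).symm rfl _ e₁).trans ?_
  rw [app_piAct (𝟙 K) d s h _ e₁ (by simpa using h) e₂, piActApp]
  refine T.act_congr ((piCar f g).app_congr (Category.id_comp _) (Δel_ext ?_ ?_) _ _)
    (Category.id_comp _) _ _
  · rw [shift, Δel_val, act_Δval]
  · rw [shift, Δel_dim, ← ha]; simp

theorem comp_app {K : E} {Z : CubicalSet C} (u : Z ⟶ pi f g) (v : Z ⟶ (Δ C).obj A)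
    (huv : u ≫ piProj f g = v ≫ (Δ C).map f) (x : K ⟶ Z.carrier) (d : K ⟶ (piCar f g).obj)
    (a : K ⟶ ((Δ C).obj A).carrier) (hd : d = x ≫ u.hom) (ha : a = x ≫ v.hom)
    (h : d ≫ (piCar f g).p = a ≫ ((Δ C).map f).hom) :
    x ≫ (piCar f g).app u.hom v.hom (congrArg Hom.hom huv) = (piCar f g).app d a h := by
  subst hd ha
  exact (piCar f g).app_nat _ _ _ _ h

/-- The map determined by an element of a dependent product and an argument. -/
def piApp {Z : CubicalSet C} (u : Z ⟶ pi f g) (v : Z ⟶ (Δ C).obj A)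
    (huv : u ≫ piProj f g = v ≫ (Δ C).map f) : Z ⟶ T where
  hom := (piCar f g).app u.hom v.hom (congrArg Hom.hom huv)
  hom_dim := (pi_app_dim _ _ _).trans u.hom_dim
  act_hom {K} x s h h' := by
    have hx : (x ≫ u.hom) ≫ (piCar f g).p = (x ≫ v.hom) ≫ ((Δ C).map f).hom :=
      (Category.assoc _ _ _).trans
        ((congrArg (x ≫ ·) (congrArg Hom.hom huv)).trans (Category.assoc _ _ _).symm)
    have h₁ : s ≫ C.cod = (x ≫ u.hom) ≫ (pi f g).dim := by
      rw [Category.assoc, u.dim_eq, h]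
    have h₂ : s ≫ C.cod = (x ≫ v.hom) ≫ ((Δ C).obj A).dim := by
      rw [Category.assoc, v.dim_eq, h]
    have e : piAct (x ≫ u.hom) s h₁ ≫ (piCar f g).p =
        ((Δ C).obj A).act (x ≫ v.hom) s h₂ ≫ ((Δ C).map f).hom := by
      refine (piAct_p _ _ _).trans (Δel_ext ?_ ?_)
      · rw [Δel_val, Category.assoc, Δmap_val, act_Δval_assoc]
        exact (Category.assoc _ _ _).symm.trans ((congrArg (· ≫ Δval B) hx).trans (by
          rw [Category.assoc, Category.assoc, Category.assoc, Δmap_val]))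
      · rw [Δel_dim, Category.assoc, Hom.dim_eq, act_dim]
    have e' : s ≫ C.cod = (piCar f g).app (x ≫ u.hom) (x ≫ v.hom) hx ≫ T.dim := by
      exact Eq.trans h₁ (pi_app_dim _ _ _).symm
    refine (comp_app u v huv _ _ _ (u.act_hom x s h h₁).symm (v.act_hom x s h h₂).symm e).trans ?_
    refine (app_piAct_act _ _ hx s h₁ h₂ e e').trans (T.act_congr ?_ rfl _ _)
    exact (comp_app u v huv x _ _ rfl rfl hx).symm

theorem piApp_comp {Z : CubicalSet C} (u : Z ⟶ pi f g) (v : Z ⟶ (Δ C).obj A)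
    (huv : u ≫ piProj f g = v ≫ (Δ C).map f) : piApp u v huv ≫ g = v :=
  hom_ext ((piCar f g).app_over _ _ _)

theorem comp_piApp {Z Z' : CubicalSet C} (σ : Z' ⟶ Z) (u : Z ⟶ pi f g) (v : Z ⟶ (Δ C).obj A)
    (huv : u ≫ piProj f g = v ≫ (Δ C).map f)
    (h : (σ ≫ u) ≫ piProj f g = (σ ≫ v) ≫ (Δ C).map f) :
    σ ≫ piApp u v huv = piApp (σ ≫ u) (σ ≫ v) h :=
  hom_ext ((piCar f g).app_nat _ _ _ _ (congrArg Hom.hom h))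

variable (f g) in
/-- The evaluation map of the dependent product. -/
def piEval : pullback (piProj f g) ((Δ C).map f) ⟶ T :=
  piApp (pullback.fst _ _) (pullback.snd _ _) pullback.condition

/-- The carrier of a pullback. -/
theorem isPullback_carrier {X Y Z : CubicalSet C} (a : X ⟶ Z) (b : Y ⟶ Z) :
    IsPullback (pullback.fst a b).hom (pullback.snd a b).hom a.hom b.hom :=
  isPullback_hom (IsPullback.of_hasPullback a b)

/-- The carrier of a pullback, compared with the pullback of carriers. -/
def carPullback {X Y Z : CubicalSet C} (a : X ⟶ Z) (b : Y ⟶ Z) :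
    pullback a.hom b.hom ⟶ (pullback a b).carrier :=
  (isPullback_carrier a b).lift (pullback.fst _ _) (pullback.snd _ _) pullback.condition

variable {Z : CubicalSet C} (z : Z ⟶ (Δ C).obj B) (k : pullback z ((Δ C).map f) ⟶ T)
    (hk : k ≫ g = pullback.snd z ((Δ C).map f))

/-- The carrier map of the transpose. -/
def piLamHom : Z.carrier ⟶ (piCar f g).obj :=
  (piCar f g).lam z.hom (carPullback z ((Δ C).map f) ≫ k.hom) (by
    have := congrArg Hom.hom hk
    rw [comp_hom] at this
    rw [Category.assoc, this]
    exact (isPullback_carrier _ _).lift_snd _ _ _)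

theorem piLamHom_p : piLamHom z k hk ≫ (piCar f g).p = z.hom := (piCar f g).lam_p _ _ _

theorem app_piLamHom {K : E} (x : K ⟶ Z.carrier) (a : K ⟶ ((Δ C).obj A).carrier)
    (h : (x ≫ piLamHom z k hk) ≫ (piCar f g).p = a ≫ ((Δ C).map f).hom)
    (w : K ⟶ (pullback z ((Δ C).map f)).carrier)
    (h₁ : w ≫ (pullback.fst z ((Δ C).map f)).hom = x)
    (h₂ : w ≫ (pullback.snd z ((Δ C).map f)).hom = a) :
    (piCar f g).app (x ≫ piLamHom z k hk) a h = w ≫ k.hom := by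
  have h' : x ≫ z.hom = a ≫ ((Δ C).map f).hom := by
    rw [← h, Category.assoc, piLamHom_p]
  refine ((piCar f g).app_lam x _ _ _ a h h').trans ?_
  rw [← Category.assoc]
  congr 1
  refine (isPullback_carrier _ _).hom_ext ?_ ?_
  · rw [h₁, carPullback, Category.assoc, IsPullback.lift_fst, pullback.lift_fst]
  · rw [h₂, carPullback, Category.assoc, IsPullback.lift_snd, pullback.lift_snd]

/-- The transpose of a map into `g`. -/
def piLam : Z ⟶ pi f g where
  hom := piLamHom z k hk
  hom_dim := by
    exact ((Category.assoc _ _ _).symm.trans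
      (congrArg (· ≫ ((Δ C).obj B).dim) (piLamHom_p z k hk))).trans z.dim_eq
  act_hom {K} x s h h' := by
    have hp : ∀ (x : K ⟶ Z.carrier), (x ≫ piLamHom z k hk) ≫ (piCar f g).p = x ≫ z.hom := by
      intro x; rw [Category.assoc, piLamHom_p]
    refine (piCar f g).ext _ _ ?_ ?_
    · refine (hp _).trans (Eq.trans ?_ (piAct_p _ _ h').symm)
      rw [z.act_eq]
      refine Δel_ext ?_ ?_
      · rw [act_Δval, Δel_val, ← hp]; exact Category.assoc _ _ _
      · rw [act_dim, Δel_dim]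
    · intro L τ a h₁ h₂
      have hd : s ≫ C.cod = (x ≫ piLamHom z k hk) ≫ (piCar f g).p ≫ ((Δ C).obj B).dim := h'
      have e₁ : ((τ ≫ Z.act x s h) ≫ piLamHom z k hk) ≫ (piCar f g).p =
          a ≫ ((Δ C).map f).hom :=
        Eq.trans (congrArg (· ≫ (piCar f g).p) (Category.assoc _ _ _)) h₁
      have e₂ : Δel ((τ ≫ x ≫ piLamHom z k hk) ≫ (piCar f g).p ≫ Δval B) ((τ ≫ s) ≫ C.dom) =
          a ≫ ((Δ C).map f).hom := by
        refine Eq.trans ?_ h₂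
        refine Eq.trans ?_ (Category.assoc _ _ _).symm
        refine Eq.trans ?_ (congrArg (τ ≫ ·) (piAct_p _ _ hd)).symm
        rw [comp_Δel]; simp
      have e₃ : (τ ≫ s) ≫ C.cod =
          (τ ≫ x ≫ piLamHom z k hk) ≫ (piCar f g).p ≫ ((Δ C).obj B).dim :=
        Eq.trans (Category.assoc _ _ _) ((congrArg (τ ≫ ·) hd).trans (Category.assoc _ _ _).symm)
      have e₄ := pi_shift _ _ e₃ a e₂
      have e₄' : (τ ≫ x) ≫ z.hom = shift a ((τ ≫ s) ≫ C.cod) ≫ ((Δ C).map f).hom := by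
        rw [← e₄, Category.assoc, Category.assoc, hp]
      obtain ⟨w, hw₁, hw₂⟩ := exists_pullback_el (IsPullback.of_hasPullback z ((Δ C).map f)) _ _ e₄'
      have hws : (τ ≫ s) ≫ C.cod = w ≫ (pullback z ((Δ C).map f)).dim := by
        rw [← (pullback.fst z ((Δ C).map f)).dim_eq, ← Category.assoc, hw₁, Category.assoc, h,
          Category.assoc]
      refine ((piCar f g).app_congr (Category.assoc _ _ _).symm rfl _ e₁).trans ?_
      refine (app_piLamHom z k hk _ a e₁ ((pullback z ((Δ C).map f)).act w (τ ≫ s) hws) ?_ ?_).trans ?_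
      · rw [Hom.act_eq, Z.act_nat _ _ _ _ (by simp [h])]
        exact Z.act_congr hw₁ rfl _ _
      · rw [Hom.act_eq]
        refine Δel_ext ?_ ?_
        · rw [act_Δval, hw₂, shift, Δel_val]
        · have := congrArg (· ≫ ((Δ C).obj B).dim) e₂
          simp only [Δel_dim, Category.assoc, Hom.dim_eq] at this
          rw [act_dim, ← this, Category.assoc]
      · refine Eq.trans ?_ (app_piAct τ _ s hd a h₂ e₃ e₂).symm
        rw [k.act_eq, piActApp]
        refine T.act_congr ?_ rfl _ _
        have e₅ : ((τ ≫ x) ≫ piLamHom z k hk) ≫ (piCar f g).p =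
            shift a ((τ ≫ s) ≫ C.cod) ≫ ((Δ C).map f).hom := by
          rw [← e₄, Category.assoc τ x]
        rw [← app_piLamHom z k hk _ _ e₅ w hw₁ hw₂]
        exact (piCar f g).app_congr (Category.assoc _ _ _) rfl _ _

theorem piLam_comp : piLam z k hk ≫ piProj f g = z := hom_ext (piLamHom_p z k hk)

theorem piApp_piLam {Z' : CubicalSet C} (σ : Z' ⟶ Z) (v : Z' ⟶ (Δ C).obj A)
    (huv : (σ ≫ piLam z k hk) ≫ piProj f g = v ≫ (Δ C).map f)
    (h : σ ≫ z = v ≫ (Δ C).map f) :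
    piApp (σ ≫ piLam z k hk) v huv = pullback.lift σ v h ≫ k := by
  refine hom_ext (app_piLamHom z k hk σ.hom v.hom (congrArg Hom.hom huv)
    (pullback.lift σ v h).hom ?_ ?_)
  · rw [← comp_hom, pullback.lift_fst]
  · rw [← comp_hom, pullback.lift_snd]

theorem pi_hom_ext {u u' : Z ⟶ pi f g} (h : u ≫ piProj f g = u' ≫ piProj f g)
    (w : ∀ {Z' : CubicalSet C} (σ : Z' ⟶ Z) (v : Z' ⟶ (Δ C).obj A)
      (h₁ : (σ ≫ u) ≫ piProj f g = v ≫ (Δ C).map f)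
      (h₂ : (σ ≫ u') ≫ piProj f g = v ≫ (Δ C).map f), piApp (σ ≫ u) v h₁ = piApp (σ ≫ u') v h₂) :
    u = u' := by
  have c := pullback.condition (f := u ≫ piProj f g) (g := (Δ C).map f)
  have e₁ : (pullback.fst (u ≫ piProj f g) ((Δ C).map f) ≫ u) ≫ piProj f g =
      pullback.snd (u ≫ piProj f g) ((Δ C).map f) ≫ (Δ C).map f := by rw [Category.assoc, c]
  have e₂ : (pullback.fst (u ≫ piProj f g) ((Δ C).map f) ≫ u') ≫ piProj f g =
      pullback.snd (u ≫ piProj f g) ((Δ C).map f) ≫ (Δ C).map f := by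
    rw [Category.assoc, ← h, c]
  have key := w (pullback.fst (u ≫ piProj f g) ((Δ C).map f)) (pullback.snd _ _) e₁ e₂
  refine hom_ext ((piCar f g).ext u.hom u'.hom (congrArg Hom.hom h) ?_)
  intro L σ a h₁ h₂
  obtain ⟨x, hx₁, hx₂⟩ := exists_pullback_el
    (IsPullback.of_hasPullback (u ≫ piProj f g) ((Δ C).map f)) σ a
    (by rw [← h₁]; exact (Category.assoc _ _ _).symm)
  have h₁' := comp_app _ _ e₁ x (σ ≫ u.hom) a (by rw [← hx₁]; exact Category.assoc _ _ _) hx₂.symm h₁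
  have h₂' := comp_app _ _ e₂ x (σ ≫ u'.hom) a (by rw [← hx₁]; exact Category.assoc _ _ _) hx₂.symm h₂
  exact h₁'.symm.trans ((congrArg (x ≫ ·) (congrArg Hom.hom key)).trans h₂')

variable (f g) in
theorem isDependentProduct_pi :
    IsDependentProduct ((Δ C).map f) g (piProj f g) (piEval f g) where
  ev_comp := piApp_comp _ _ _
  existsUnique {Z} z k hk := by
    have key : ∀ (u : Z ⟶ pi f g) (h : u ≫ piProj f g = z)
        (h' : pullback.fst z ((Δ C).map f) ≫ u ≫ piProj f g =
          pullback.snd z ((Δ C).map f) ≫ (Δ C).map f),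
        pullback.lift (pullback.fst z ((Δ C).map f) ≫ u) (pullback.snd z ((Δ C).map f))
        (by rw [Category.assoc, h, pullback.condition]) ≫ piEval f g =
        piApp (pullback.fst z ((Δ C).map f) ≫ u) (pullback.snd z ((Δ C).map f))
          (by rw [Category.assoc, h']) := by
      intro u h h'
      rw [piEval, comp_piApp _ _ _ _ (by simpa using h')]
      congr 1 <;> simp
    refine ⟨piLam z k hk, ⟨piLam_comp z k hk, ?_⟩, ?_⟩
    · rw [key _ (piLam_comp z k hk) (by rw [piLam_comp, pullback.condition]),
        piApp_piLam z k hk _ _ _ pullback.condition]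
      refine (congrArg (· ≫ k) (pullback.hom_ext ?_ ?_)).trans (Category.id_comp k) <;> simp
    · rintro u ⟨h, hu⟩
      refine pi_hom_ext (by rw [h, piLam_comp]) ?_
      intro Z' σ v h₁ h₂
      have e : σ ≫ z = v ≫ (Δ C).map f := by rw [← h₁, Category.assoc, h]
      rw [piApp_piLam z k hk σ v h₂ e, ← hu, piEval, ← Category.assoc,
        comp_piApp _ _ _ _ (by simp [h, e])]
      congr 1 <;> simp

end CubicalSet
end DependentProducts
end
end CubicalReals

/-! ### H-propositions, fibrations, truncation, and global points. -/

namespace CubicalReals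
noncomputable section

section Fibrations

variable {E : Type u} [Category.{v} E] [HasFiniteLimits E] {NN : NNO E}
  {C : CubeCategory NN}

attribute [local simp] pullback.lift_fst pullback.lift_snd pullback.lift_fst_assoc
  pullback.lift_snd_assoc prod.lift_fst prod.lift_snd prod.lift_fst_assoc prod.lift_snd_assoc

open CubicalSet

section HProp

variable [HasFiniteCoproducts E] {J : Endpoints C}

theorem HomotopicOver.precomp {A A' X B : CubicalSet C} {p : X ⟶ B} {f g : A ⟶ X}
    (h : HomotopicOver J p f g) (σ : A' ⟶ A) : HomotopicOver J p (σ ≫ f) (σ ≫ g) := by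
  obtain ⟨H, h₁, h₂, h₃⟩ := h
  have key : ∀ i : ⊤_ (CubicalSet C) ⟶ interval C,
      prod.lift (𝟙 A') (terminal.from A' ≫ i) ≫ prod.map σ (𝟙 _) =
        σ ≫ prod.lift (𝟙 A) (terminal.from A ≫ i) := by
    intro i
    rw [prod.lift_map, prod.comp_lift, Category.id_comp, Category.comp_id, Category.comp_id,
      ← Category.assoc, terminal.comp_from]
  refine ⟨prod.map σ (𝟙 _) ≫ H, ?_, ?_, ?_⟩
  · rw [Category.assoc, h₁]; simp
  · rw [reassoc_of% key, h₂]
  · rw [reassoc_of% key, h₃]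

/-- The definition is the generic case, for the two projections; all others arise by substitution.
-/
theorem IsHProp.homotopic {A X B : CubicalSet C} {p : X ⟶ B} (h : IsHProp J p) (f g : A ⟶ X)
    (w : f ≫ p = g ≫ p) : HomotopicOver J p f g := by
  have := HomotopicOver.precomp h (pullback.lift f g w)
  simpa using this

theorem HomotopicOver.refl {A X B : CubicalSet C} (p : X ⟶ B) (f : A ⟶ X) :
    HomotopicOver J p f f :=
  ⟨prod.fst ≫ f, by simp, by simp, by simp⟩

theorem isHProp_of_mono {X B : CubicalSet C} (p : X ⟶ B) [Mono p] : IsHProp J p := by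
  have : pullback.fst p p = pullback.snd p p := by
    rw [← cancel_mono p, pullback.condition]
  rw [IsHProp, this]
  exact HomotopicOver.refl _ _

theorem IsHProp.of_isPullback {X' X B' B : CubicalSet C} {a : X' ⟶ X} {q : X' ⟶ B'} {p : X ⟶ B}
    {b : B' ⟶ B} (sq : IsPullback a q p b) (h : IsHProp J p) : IsHProp J q := by
  obtain ⟨H, h₁, h₂, h₃⟩ := h.homotopic (pullback.fst q q ≫ a) (pullback.snd q q ≫ a)
    (by rw [Category.assoc, Category.assoc, sq.w, pullback.condition_assoc])
  refine ⟨sq.lift H (prod.fst ≫ pullback.fst q q ≫ q) (by rw [h₁]; simp [sq.w]), ?_, ?_, ?_⟩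
  · simp
  · refine sq.hom_ext ?_ ?_
    · simp [h₂]
    · simp
  · refine sq.hom_ext ?_ ?_
    · simp [h₃]
    · simp [pullback.condition]

/-- The product of two h-propositions. -/
theorem IsHProp.inter {X Y B : CubicalSet C} {p : X ⟶ B} {q : Y ⟶ B} (hp : IsHProp J p)
    (hq : IsHProp J q) : IsHProp J (pullback.fst p q ≫ p) := by
  let f := pullback.fst (pullback.fst p q ≫ p) (pullback.fst p q ≫ p)
  let g := pullback.snd (pullback.fst p q ≫ p) (pullback.fst p q ≫ p)
  have c : f ≫ pullback.fst p q ≫ p = g ≫ pullback.fst p q ≫ p := pullback.condition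
  change HomotopicOver J _ f g
  obtain ⟨H, h₁, h₂, h₃⟩ := hp.homotopic (f ≫ pullback.fst p q) (g ≫ pullback.fst p q)
    (by simpa using c)
  obtain ⟨K, k₁, k₂, k₃⟩ := hq.homotopic (f ≫ pullback.snd p q) (g ≫ pullback.snd p q)
    (by simpa [← pullback.condition] using c)
  refine ⟨pullback.lift H K ?_, ?_, ?_, ?_⟩
  · rw [h₁, k₁]; simp [pullback.condition]
  · rw [pullback.lift_fst_assoc, h₁]; simp
  · apply pullback.hom_ext <;> simp [h₂, k₂]
  · apply pullback.hom_ext <;> simp [h₃, k₃]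

/-- Function extensionality: the pointwise homotopy between the values of two functions is
transposed into a homotopy between the functions. -/
theorem isHProp_piProj [LocallyCartesianClosed E] {A B : E} (f : A ⟶ B) {T : CubicalSet C}
    {g : T ⟶ (Δ C).obj A} (hg : IsHProp J g) : IsHProp J (piProj f g) := by
  let u := pullback.fst (piProj f g) (piProj f g)
  let u' := pullback.snd (piProj f g) (piProj f g)
  have c : u ≫ piProj f g = u' ≫ piProj f g := pullback.condition
  change HomotopicOver J _ u u'
  let F := pullback.fst (u ≫ piProj f g) ((Δ C).map f)
  let V := pullback.snd (u ≫ piProj f g) ((Δ C).map f)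
  have e : (F ≫ u) ≫ piProj f g = V ≫ (Δ C).map f := by
    rw [Category.assoc]; exact pullback.condition
  have e' : (F ≫ u') ≫ piProj f g = V ≫ (Δ C).map f := by
    rw [Category.assoc, ← c]; exact pullback.condition
  obtain ⟨H, h₁, h₂, h₃⟩ := hg.homotopic (piApp _ _ e) (piApp _ _ e')
    (by rw [piApp_comp, piApp_comp])
  rw [piApp_comp] at h₁
  let z : pullback (piProj f g) (piProj f g) ⨯ interval C ⟶ (Δ C).obj B :=
    prod.fst ≫ u ≫ piProj f g
  -- Exchanges the interval variable with the argument of the function.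
  let j : pullback z ((Δ C).map f) ⟶ pullback (u ≫ piProj f g) ((Δ C).map f) ⨯ interval C :=
    prod.lift (pullback.lift (pullback.fst z _ ≫ prod.fst) (pullback.snd z _)
      (by rw [Category.assoc]; exact pullback.condition)) (pullback.fst z _ ≫ prod.snd)
  have hk : (j ≫ H) ≫ g = pullback.snd z ((Δ C).map f) := by
    rw [Category.assoc, h₁]; simp [j, V]
  -- Both endpoints are treated alike: transposition commutes with evaluating the interval variable
  -- at `i`.
  have hend : ∀ (i : ⊤_ (CubicalSet C) ⟶ interval C) (w : pullback (piProj f g) (piProj f g) ⟶ pi f g)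
      (hw : w ≫ piProj f g = u ≫ piProj f g) (ew : (F ≫ w) ≫ piProj f g = V ≫ (Δ C).map f),
      prod.lift (𝟙 _) (terminal.from _ ≫ i) ≫ H = piApp _ _ ew →
      prod.lift (𝟙 _) (terminal.from _ ≫ i) ≫ piLam z (j ≫ H) hk = w := by
    intro i w hw ew hH
    refine pi_hom_ext (by rw [Category.assoc, piLam_comp, hw]; simp [z]) ?_
    intro Z' σ v k₁ k₂
    have k₃ : (σ ≫ prod.lift (𝟙 _) (terminal.from _ ≫ i)) ≫ z = v ≫ (Δ C).map f := by
      rw [← k₂]; simp [z, hw]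
    have k₄ : σ ≫ u ≫ piProj f g = v ≫ (Δ C).map f := by
      rw [← k₂, Category.assoc, hw]
    have k₅ : ((σ ≫ prod.lift (𝟙 _) (terminal.from _ ≫ i)) ≫ piLam z (j ≫ H) hk) ≫ piProj f g =
        v ≫ (Δ C).map f := by rw [Category.assoc, piLam_comp, k₃]
    have : piApp _ _ k₁ = piApp _ _ k₅ := by congr 1; rw [Category.assoc]
    rw [this, piApp_piLam _ _ _ _ _ _ k₃, ← Category.assoc]
    have hj : pullback.lift (σ ≫ prod.lift (𝟙 _) (terminal.from _ ≫ i)) v k₃ ≫ j =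
        pullback.lift σ v k₄ ≫ prod.lift (𝟙 _) (terminal.from _ ≫ i) := by
      refine Limits.prod.hom_ext (pullback.hom_ext ?_ ?_) ?_
      · simp [j]
      · simp [j]
      · simp [j]
    rw [hj, Category.assoc, hH, comp_piApp _ _ _ _ (by simp [F, V, ← k₂])]
    congr 1 <;> simp [F, V]
  refine ⟨piLam z (j ≫ H) hk, piLam_comp _ _ _, hend _ _ rfl e h₂, hend _ _ c.symm e' h₃⟩

end HProp

/-- The map to the constant cubical set `Δ 1`. -/
def CubicalSet.toΔTerminal (X : CubicalSet C) : X ⟶ (Δ C).obj (⊤_ E) :=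
  mkΔ (terminal.from _) (fun _ _ _ => Subsingleton.elim _ _)

namespace KanFibrations

variable [HasFiniteCoproducts E] {J : Endpoints C} (M : KanFibrations J)

theorem of_isPullback {X' X B' B : CubicalSet C} {a : X' ⟶ X} {q : X' ⟶ B'} {p : X ⟶ B}
    {b : B' ⟶ B} (sq : IsPullback a q p b) (h : M.Fib p) : M.Fib q :=
  M.isStableUnderBaseChange.of_isPullback sq h

theorem comp_mem {X Y Z : CubicalSet C} {f : X ⟶ Y} {g : Y ⟶ Z} (hf : M.Fib f) (hg : M.Fib g) :
    M.Fib (f ≫ g) :=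
  M.isStableUnderComposition.comp_mem f g hf hg

/-- An isomorphism is a base change of the identity of `Δ 1`, which is a fibration as a map between
constant cubical sets. -/
theorem fib_of_isIso {X Y : CubicalSet C} (f : X ⟶ Y) [IsIso f] : M.Fib f :=
  M.of_isPullback (a := f ≫ toΔTerminal Y) (b := toΔTerminal Y)
    (p := 𝟙 ((Δ C).obj (⊤_ E))) (IsPullback.of_vert_isIso ⟨by simp⟩)
    (by rw [← (Δ C).map_id]; exact M.constant _)

instance isIso_terminal_from_Δ : IsIso (terminal.from ((Δ C).obj (⊤_ E))) :=
  ⟨toΔTerminal _, val_injective (Subsingleton.elim _ _), Subsingleton.elim _ _⟩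

theorem fib_terminal_from_Δ (A : E) : M.Fib (terminal.from ((Δ C).obj A)) := by
  have := M.comp_mem (M.constant (C := C) ((Δ C).map (terminal.from A)))
    (M.fib_of_isIso (terminal.from ((Δ C).obj (⊤_ E))))
  rwa [terminal.comp_from] at this

theorem fib_fst (Y : CubicalSet C) (A : E) : M.Fib (prod.fst : Y ⨯ (Δ C).obj A ⟶ Y) :=
  M.of_isPullback (isPullback_prod Y ((Δ C).obj A)).flip (M.fib_terminal_from_Δ A)

theorem fib_snd {X Y Z : CubicalSet C} {f : X ⟶ Z} (g : Y ⟶ Z) (hf : M.Fib f) :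
    M.Fib (pullback.snd f g) :=
  M.of_isPullback (IsPullback.of_hasPullback f g) hf

theorem fib_pullback_fst {X Y Z : CubicalSet C} (f : X ⟶ Z) {g : Y ⟶ Z} (hg : M.Fib g) :
    M.Fib (pullback.fst f g) :=
  M.of_isPullback (IsPullback.of_hasPullback f g).flip hg

end KanFibrations

/-! ### Propositional truncation -/

section Truncation

variable [HasFiniteCoproducts E] {J : Endpoints C} {M : KanFibrations J}

theorem IsPropTrunc.exists_section {W T Z Z' P : CubicalSet C} {w : W ⟶ Z} {t : T ⟶ Z} {η : W ⟶ T}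
    (h : IsPropTrunc J M.Fib w t η) {σ : Z' ⟶ Z} (s : Z' ⟶ T) (hs : s ≫ t = σ) (p : P ⟶ Z')
    (hp : M.Fib p) (hp' : IsHProp J p)
    (k : pullback w σ ⟶ P) (hk : k ≫ p = pullback.snd w σ) : ∃ v : Z' ⟶ P, v ≫ p = 𝟙 Z' := by
  obtain ⟨k', hk'⟩ := h.elim σ p hp hp' ⟨k, hk⟩
  exact ⟨pullback.lift s (𝟙 _) (by rw [hs, Category.id_comp]) ≫ k', by simp [hk']⟩

/-- The elimination rule: to inhabit an h-propositional fibration over `Z`, it suffices to do so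
over `W`. -/
theorem MerelyInhabited.exists_section {W Z P : CubicalSet C} {w : W ⟶ Z}
    (h : MerelyInhabited M w) (p : P ⟶ Z) (hp : M.Fib p) (hp' : IsHProp J p)
    (k : W ⟶ P) (hk : k ≫ p = w) : ∃ v : Z ⟶ P, v ≫ p = 𝟙 Z := by
  obtain ⟨T, t, η, h, s, hs⟩ := h
  refine h.exists_section s hs p hp hp' (pullback.fst w (𝟙 Z) ≫ k) ?_
  rw [Category.assoc, hk, pullback.condition, Category.comp_id]

/-- The truncation of `w'` need not be the pullback of that of `w`; stable elimination maps the
latter into the former. -/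
theorem MerelyInhabited.of_section {W T Z Z' W' : CubicalSet C} {w : W ⟶ Z} {t : T ⟶ Z} {η : W ⟶ T}
    (h : IsPropTrunc J M.Fib w t η) {σ : Z' ⟶ Z} (s : Z' ⟶ T) (hs : s ≫ t = σ) (w' : W' ⟶ Z')
    (hw' : M.Fib w') (k : pullback w σ ⟶ W') (hk : k ≫ w' = pullback.snd w σ) :
    MerelyInhabited M w' := by
  obtain ⟨T', t', η', h'⟩ := M.trunc w' hw'
  exact ⟨T', t', η', h', h.exists_section s hs t' h'.fib h'.hprop (k ≫ η')
    (by rw [Category.assoc, h'.fac, hk])⟩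

end Truncation

/-! ### Points of merely inhabited types -/

section Points

variable [LocallyCartesianClosed E] [FinitaryExtensive E] {J : Endpoints C} {M : KanFibrations J}

/-- `p : P ⟶ Z` is the universal cubical set over `Z` with a lift of its global points to `w`. -/
structure IsPointLift {W Z P : CubicalSet C} (w : W ⟶ Z) (p : P ⟶ Z)
    (r : (Γ C).obj P ⟶ (Γ C).obj W) : Prop where
  fac : r ≫ (Γ C).map w = (Γ C).map p
  exists_lift {X : CubicalSet C} (z : X ⟶ Z) (g : (Γ C).obj X ⟶ (Γ C).obj W) :
    g ≫ (Γ C).map w = (Γ C).map z → ∃ u : X ⟶ P, u ≫ p = z ∧ (Γ C).map u ≫ r = g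
  ext {X : CubicalSet C} {u u' : X ⟶ P} : u ≫ p = u' ≫ p →
    (Γ C).map u ≫ r = (Γ C).map u' ≫ r → u = u'

theorem codisc_comp_counit {X : CubicalSet C} {A B : E} (f : X ⟶ codisc C A) (g : A ⟶ B) :
    (Γ C).map (f ≫ toCodisc (codiscCounit A ≫ g)) ≫ codiscCounit B =
      (Γ C).map f ≫ codiscCounit A ≫ g := by
  rw [Functor.map_comp, Category.assoc, toCodisc_counit]

/-- `P` is the pullback of `codisc (Γ W) ⟶ codisc (Γ Z)` along the unit `Z ⟶ codisc (Γ Z)`; its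
universal property is that of the adjunction. -/
theorem exists_isPointLift {W Z : CubicalSet C} (w : W ⟶ Z) :
    ∃ (P : CubicalSet C) (p : P ⟶ Z) (r : (Γ C).obj P ⟶ (Γ C).obj W), IsPointLift w p r := by
  let a : Z ⟶ codisc C ((Γ C).obj Z) := toCodisc (𝟙 _)
  let b : codisc C ((Γ C).obj W) ⟶ codisc C ((Γ C).obj Z) :=
    toCodisc (codiscCounit _ ≫ (Γ C).map w)
  have ha : ∀ {X : CubicalSet C} (z : X ⟶ Z), (Γ C).map (z ≫ a) ≫ codiscCounit _ =
      (Γ C).map z := by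
    intro X z
    rw [Functor.map_comp, Category.assoc, toCodisc_counit, Category.comp_id]
  refine ⟨pullback a b, pullback.fst a b, (Γ C).map (pullback.snd a b) ≫ codiscCounit _, ?_, ?_, ?_⟩
  · rw [Category.assoc, ← codisc_comp_counit, ← pullback.condition, ha]
  · intro X z g hg
    refine ⟨pullback.lift z (toCodisc g) (codisc_hom_ext ?_), pullback.lift_fst _ _ _, ?_⟩
    · rw [ha, codisc_comp_counit, reassoc_of% toCodisc_counit g, hg]
    · rw [← Category.assoc, ← Functor.map_comp, pullback.lift_snd, toCodisc_counit]
  · intro X u u' h₁ h₂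
    refine pullback.hom_ext h₁ (codisc_hom_ext ?_)
    simpa using h₂

/-- By the universal property a homotopy need only be described on global points, without any
continuity. It can thus be defined by cases, with the map to `2` that separates the endpoints. -/
theorem IsPointLift.isHProp {W Z P : CubicalSet C} {w : W ⟶ Z} {p : P ⟶ Z}
    {r : (Γ C).obj P ⟶ (Γ C).obj W} (h : IsPointLift w p r) : IsHProp J p := by
  obtain ⟨e, he₀, he₁⟩ := J.separated
  let f := pullback.fst p p
  let g := pullback.snd p p
  have c : f ≫ p = g ≫ p := pullback.condition
  change HomotopicOver J p f g
  obtain ⟨H, h₁, h₂⟩ := h.exists_lift (X := pullback p p ⨯ interval C) (prod.fst ≫ f ≫ p)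
    (ite ((Γ C).map prod.snd ≫ e) ((Γ C).map (prod.fst ≫ f) ≫ r) ((Γ C).map (prod.fst ≫ g) ≫ r))
    (by
      rw [ite_comp, Category.assoc, Category.assoc, h.fac, ← Functor.map_comp,
        ← Functor.map_comp, Category.assoc, Category.assoc, ← c, ite_self])
  refine ⟨H, h₁, h.ext ?_ ?_, h.ext ?_ ?_⟩
  · rw [Category.assoc, h₁]; simp
  · rw [Functor.map_comp, Category.assoc, h₂, ite_left]
    · rw [← Category.assoc, ← Functor.map_comp]; simp
    · rw [← Category.assoc, ← Functor.map_comp, prod.lift_snd, Functor.map_comp, Category.assoc,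
        he₀, ← Category.assoc]
      exact comp_inl_eq_left _
  · rw [Category.assoc, h₁]; simp [c]
  · rw [Functor.map_comp, Category.assoc, h₂, ite_right]
    · rw [← Category.assoc, ← Functor.map_comp]; simp
    · rw [← Category.assoc, ← Functor.map_comp, prod.lift_snd, Functor.map_comp, Category.assoc,
        he₁, ← Category.assoc]
      exact comp_inr_eq_right _

/-- Paths can be lifted along `w`, disregarding their starting points. -/
def HasPathLifting {W Z : CubicalSet C} (w : W ⟶ Z) : Prop :=
  ∀ {A : CubicalSet C} {K : E} (d : (Δ C).obj K ⟶ interval C) (a : A ⟶ (Δ C).obj K) (l : A ⟶ W)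
    (b : A ⨯ interval C ⟶ Z), l ≫ w = prod.lift (𝟙 A) (a ≫ d) ≫ b →
    ∃ h : A ⨯ interval C ⟶ W, h ≫ w = b

theorem KanFibrations.hasPathLifting {W Z : CubicalSet C} {w : W ⟶ Z} (hw : M.Fib w) :
    HasPathLifting w := by
  intro A K d a l b e
  have := M.hurewicz d a w hw
  exact ⟨(CommSq.mk e).lift, (CommSq.mk e).fac_right⟩

theorem isPullback_prod_map {X Y : CubicalSet C} (f : X ⟶ Y) (I : CubicalSet C) :
    IsPullback (prod.map f (𝟙 I)) prod.fst prod.fst f :=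
  IsPullback.of_right (h₁₂ := prod.snd) (h₂₂ := terminal.from Y) (v₁₃ := terminal.from I)
    (by
      rw [prod.map_snd, Category.comp_id, terminal.comp_from]
      exact (isPullback_prod X I).flip) (prod.map_fst _ _) (isPullback_prod Y I).flip

/-- `A` splits according to the summand in which the starting point lies, and by extensivity `A × I`
splits accordingly, so paths lift on each piece. Working with path lifting avoids asking whether
sums of fibrations are fibrations. -/
theorem HasPathLifting.of_isColimit {W₁ W₂ S Z : CubicalSet C} {i : W₁ ⟶ S} {j : W₂ ⟶ S}
    (hc : IsColimit (BinaryCofan.mk i j)) {s : S ⟶ Z} (h₁ : HasPathLifting (i ≫ s))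
    (h₂ : HasPathLifting (j ≫ s)) : HasPathLifting s := by
  intro A K d a l b e
  have hA : ∀ {W : CubicalSet C} (i : W ⟶ S), HasPathLifting (i ≫ s) →
      ∃ h : pullback l i ⨯ interval C ⟶ W,
        h ≫ i ≫ s = prod.map (pullback.fst l i) (𝟙 _) ≫ b := by
    intro W i hi
    refine hi d (pullback.fst l i ≫ a) (pullback.snd l i) _ ?_
    rw [← pullback.condition_assoc, e, ← Category.assoc, ← Category.assoc]
    congr 1
    apply Limits.prod.hom_ext <;> simp
  obtain ⟨k₁, hk₁⟩ := hA i h₁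
  obtain ⟨k₂, hk₂⟩ := hA j h₂
  have c₁ := ((isColimit_iff_isPullback hc (pullback.condition (f := l))
    (pullback.condition (f := l))).mpr
    ⟨IsPullback.of_hasPullback _ _, IsPullback.of_hasPullback _ _⟩).some
  have c₂ := ((isColimit_iff_isPullback c₁ (prod.map_fst (pullback.fst l i) (𝟙 (interval C)))
    (prod.map_fst (pullback.fst l j) (𝟙 (interval C)))).mpr
    ⟨isPullback_prod_map _ _, isPullback_prod_map _ _⟩).some
  obtain ⟨k, e₁, e₂⟩ : ∃ k : A ⨯ interval C ⟶ S,
      prod.map (pullback.fst l i) (𝟙 _) ≫ k = k₁ ≫ i ∧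
      prod.map (pullback.fst l j) (𝟙 _) ≫ k = k₂ ≫ j :=
    let k := BinaryCofan.IsColimit.desc' c₂ (k₁ ≫ i) (k₂ ≫ j)
    ⟨k.1, k.2.1, k.2.2⟩
  refine ⟨k, BinaryCofan.IsColimit.hom_ext c₂ ?_ ?_⟩
  · change prod.map (pullback.fst l i) (𝟙 _) ≫ _ = prod.map (pullback.fst l i) (𝟙 _) ≫ _
    rw [reassoc_of% e₁, hk₁]
  · change prod.map (pullback.fst l j) (𝟙 _) ≫ _ = prod.map (pullback.fst l j) (𝟙 _) ≫ _
    rw [reassoc_of% e₂, hk₂]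

/-- A point `(a, i)` of `A × I` lies on the line through `(a, r a)`. Taking all points of `A` as a
constant context, path lifting along these lines gives lifts of all points at once. -/
theorem exists_lift_points {W Z A : CubicalSet C} {w : W ⟶ Z} (hw : HasPathLifting w)
    (r : A ⟶ interval C) (b : A ⨯ interval C ⟶ Z) (l : (Γ C).obj A ⟶ (Γ C).obj W)
    (hl : l ≫ (Γ C).map w = (Γ C).map (prod.lift (𝟙 A) r ≫ b)) :
    ∃ g : (Γ C).obj (A ⨯ interval C) ⟶ (Γ C).obj W, g ≫ (Γ C).map w = (Γ C).map b := by
  let ε : (Δ C).obj ((Γ C).obj A) ⟶ A := ofΓ (𝟙 _)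
  obtain ⟨h, hh⟩ := hw (ε ≫ r) (𝟙 ((Δ C).obj ((Γ C).obj A))) (ofΓ l) (prod.map ε (𝟙 _) ≫ b) (by
    have e₁ : ε ≫ prod.lift (𝟙 A) r ≫ b = ofΓ (l ≫ (Γ C).map w) := by
      rw [ofΓ_comp, Category.id_comp, hl]
    rw [ofΓ_comp, ← e₁]
    simp only [← Category.assoc]
    congr 1
    apply Limits.prod.hom_ext <;> simp)
  let c : (Δ C).obj ((Γ C).obj (A ⨯ interval C)) ⟶ A ⨯ interval C := ofΓ (𝟙 _)
  -- The generic point of `A × I`, read as a generic point of `A` together with a position on its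
  -- line.
  let q : (Δ C).obj ((Γ C).obj (A ⨯ interval C)) ⟶ (Δ C).obj ((Γ C).obj A) ⨯ interval C :=
    prod.lift ((Δ C).map ((Γ C).map prod.fst)) (c ≫ prod.snd)
  have hq : q ≫ prod.map ε (𝟙 _) = c := by
    refine Limits.prod.hom_ext ?_ ?_
    · simp only [q, ε, c, prod.lift_map, prod.lift_fst]
      rw [map_comp_ofΓ, ofΓ_comp, Category.comp_id, Category.id_comp]
    · simp [q]
  refine ⟨toΓ (q ≫ h), ?_⟩
  rw [← toΓ_comp, Category.assoc, hh, reassoc_of% hq, toΓ_comp, toΓ_ofΓ,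
    Category.id_comp]

/-- Filling a box in `P` means choosing lifts of points compatible with the box. On points of the
box they are prescribed; on the complement the lifts from `exists_lift_points` are used, and no
compatibility between the two is required. This is also why the starting points in `HasPathLifting`
can be disregarded. -/
theorem IsPointLift.fib {W Z P : CubicalSet C} {w : W ⟶ Z} {p : P ⟶ Z}
    {r : (Γ C).obj P ⟶ (Γ C).obj W} (h : IsPointLift w p r) (hw : HasPathLifting w) :
    M.Fib p := by
  refine M.fib_of_boxes p fun {S A} m hm => ⟨fun {s b} sq => ?_⟩
  obtain ⟨ρ, l, hl⟩ := hm.graph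
  obtain ⟨D, d, ⟨hc⟩⟩ := hm.decidable
  obtain ⟨g₀, hg₀⟩ := exists_lift_points hw ρ b ((Γ C).map (l ≫ s) ≫ r) (by
    rw [Category.assoc, h.fac, ← Functor.map_comp, ← hl, Category.assoc, Category.assoc, sq.w])
  obtain ⟨g, hg₁, hg₂⟩ : ∃ g : (Γ C).obj (A ⨯ interval C) ⟶ (Γ C).obj W,
      (Γ C).map m ≫ g = (Γ C).map s ≫ r ∧ d ≫ g = d ≫ g₀ :=
    let g := BinaryCofan.IsColimit.desc' hc ((Γ C).map s ≫ r) (d ≫ g₀)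
    ⟨g.1, g.2.1, g.2.2⟩
  obtain ⟨u, hu₁, hu₂⟩ := h.exists_lift b g (BinaryCofan.IsColimit.hom_ext hc
    (by
      change (Γ C).map m ≫ _ = (Γ C).map m ≫ _
      rw [reassoc_of% hg₁, h.fac, ← Functor.map_comp, ← Functor.map_comp, sq.w])
    (by
      change d ≫ _ = d ≫ _
      rw [reassoc_of% hg₂, hg₀]))
  refine ⟨⟨⟨u, h.ext ?_ ?_, hu₁⟩⟩⟩
  · rw [Category.assoc, hu₁, sq.w]
  · rw [Functor.map_comp, Category.assoc, hu₂, hg₁]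

/-- `w` maps to its universal point lift, which is an h-propositional fibration, so the truncation
can be eliminated into it. A section there is a choice of preimages of global points. -/
theorem MerelyInhabited.exists_points {W Z : CubicalSet C} {w : W ⟶ Z} (hw : HasPathLifting w)
    (h : MerelyInhabited M w) : ∃ s : (Γ C).obj Z ⟶ (Γ C).obj W, s ≫ (Γ C).map w = 𝟙 _ := by
  obtain ⟨P, p, r, hr⟩ := exists_isPointLift w
  obtain ⟨u, hu, -⟩ := hr.exists_lift w (𝟙 _) (Category.id_comp _)
  obtain ⟨v, hv⟩ := h.exists_section p (hr.fib hw) hr.isHProp u hu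
  exact ⟨(Γ C).map v ≫ r, by rw [Category.assoc, hr.fac, ← Functor.map_comp, hv, CategoryTheory.Functor.map_id]⟩

end Points

end Fibrations
end
end CubicalReals

/-! ### The exponential of `Ω`-valued predicates. -/

namespace CubicalReals
noncomputable section

section PowerObjects

variable {E : Type u} [Category.{v} E] [HasFiniteLimits E] {NN : NNO E}
  {C : CubeCategory NN}

attribute [local simp] pullback.lift_fst pullback.lift_snd pullback.lift_fst_assoc
  pullback.lift_snd_assoc prod.lift_fst prod.lift_snd prod.lift_fst_assoc prod.lift_snd_assoc

open CubicalSet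

theorem mem_pullback_fst_iff {A B D K : E} (f : A ⟶ D) (m : B ⟶ D) (x : K ⟶ A) :
    Mem (pullback.fst f m) x ↔ Mem m (x ≫ f) := by
  constructor
  · rintro ⟨l, rfl⟩
    exact ⟨l ≫ pullback.snd f m, by rw [Category.assoc, Category.assoc, pullback.condition]⟩
  · rintro ⟨l, hl⟩
    exact ⟨pullback.lift x l hl.symm, pullback.lift_fst _ _ _⟩

theorem mem_prod_map_iff {A B A' B' K : E} (m : A ⟶ B) (n : A' ⟶ B') (x : K ⟶ B) (y : K ⟶ B') :
    Mem (prod.map m n) (prod.lift x y) ↔ Mem m x ∧ Mem n y := by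
  constructor
  · rintro ⟨l, hl⟩
    refine ⟨⟨l ≫ prod.fst, ?_⟩, ⟨l ≫ prod.snd, ?_⟩⟩
    · simpa using congrArg (· ≫ prod.fst) hl
    · simpa using congrArg (· ≫ prod.snd) hl
  · rintro ⟨⟨a, ha⟩, ⟨b, hb⟩⟩
    exact ⟨prod.lift a b, by rw [prod.lift_map, ha, hb]⟩

/-- The exponential is the dependent product of `Ω × Q ⟶ Q` along `Q ⟶ 1`. -/
theorem exists_exponential [LocallyCartesianClosed E] (Q Ω : E) :
    ∃ (X : E) (e : X ⨯ Q ⟶ Ω), ∀ {K : E} (k : K ⨯ Q ⟶ Ω),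
      ∃! u : K ⟶ X, prod.map u (𝟙 Q) ≫ e = k := by
  let D := depProd (terminal.from Q) (prod.snd : Ω ⨯ Q ⟶ Q)
  let e : D.obj ⨯ Q ⟶ Ω :=
    D.app prod.fst prod.snd (Subsingleton.elim _ _) ≫ prod.fst
  have he : ∀ {K : E} (d : K ⟶ D.obj) (a : K ⟶ Q) (h : d ≫ D.p = a ≫ terminal.from Q),
      D.app d a h = prod.lift (prod.lift d a ≫ e) a := by
    intro K d a h
    refine Limits.prod.hom_ext ?_ ?_
    · rw [prod.lift_fst, ← Category.assoc, D.app_nat _ _ _ _ (Subsingleton.elim _ _)]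
      exact congrArg (· ≫ prod.fst) (D.app_congr (by simp) (by simp) _ _)
    · rw [prod.lift_snd, D.app_over]
  refine ⟨D.obj, e, fun {K} k => ?_⟩
  let k' : pullback (terminal.from K) (terminal.from Q) ⟶ Ω ⨯ Q :=
    prod.lift (prod.lift (pullback.fst _ _) (pullback.snd _ _) ≫ k) (pullback.snd _ _)
  refine ⟨D.lam (terminal.from K) k' (by simp [k']), ?_, ?_⟩
  · have e₁ : (prod.fst ≫ D.lam (terminal.from K) k' (by simp [k'])) ≫ D.p =
        (prod.snd : K ⨯ Q ⟶ Q) ≫ terminal.from Q := Subsingleton.elim _ _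
    have := congrArg (· ≫ prod.fst) (he _ _ e₁)
    simp only [prod.lift_fst] at this
    rw [D.app_lam _ _ _ _ _ _ (Subsingleton.elim _ _)] at this
    have e₂ : prod.map (D.lam (terminal.from K) k' (by simp [k'])) (𝟙 Q) =
        prod.lift (prod.fst ≫ D.lam (terminal.from K) k' (by simp [k'])) prod.snd := by
      apply Limits.prod.hom_ext <;> simp
    change prod.map _ _ ≫ e = k
    rw [e₂, ← this]
    simp [k', prod.comp_lift_assoc]
  · intro u hu
    refine D.ext _ _ (Subsingleton.elim _ _) ?_
    intro L σ a h₁ h₂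
    rw [he, D.app_lam _ _ _ _ _ _ (Subsingleton.elim _ _)]
    have : prod.lift (σ ≫ u) a = prod.lift σ a ≫ prod.map u (𝟙 Q) := by
      apply Limits.prod.hom_ext <;> simp
    rw [this, Category.assoc, hu]
    apply Limits.prod.hom_ext <;> simp [k', prod.comp_lift_assoc]

/-- Negation is universal quantification of the empty subobject along `t`. -/
theorem exists_negation [LocallyCartesianClosed E] [FinitaryExtensive E] {T Ω : E} (t : T ⟶ Ω) :
    ∃ (N : E) (n : N ⟶ Ω), Mono n ∧ ∀ {K : E} (x : K ⟶ Ω), Mem n x ↔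
      ∀ {L : E} (σ : L ⟶ K), Mem t (σ ≫ x) → Nonempty (IsInitial L) := by
  have : Mono (initial.to T) := ⟨fun a b _ => hom_ext_empty a _ _⟩
  obtain ⟨N, n, hn, h⟩ := exists_forall_sub t (initial.to T)
  refine ⟨N, n, hn, fun x => (h x).trans ⟨?_, ?_⟩⟩
  · rintro h L σ ⟨a, ha⟩
    obtain ⟨l, -⟩ := h σ a ha
    exact ⟨initialIsInitial.ofStrict l⟩
  · intro h L σ a ha
    exact ⟨(h σ ⟨a, ha⟩).some.to _, (h σ ⟨a, ha⟩).some.hom_ext _ _⟩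

/-- The object of `Ω`-valued predicates on `Q`, with the negation of `t : 1 ⟶ Ω`. -/
structure PredicateObject (Q : E) {Ω : E} (t : ⊤_ E ⟶ Ω) where
  obj : E
  ev : obj ⨯ Q ⟶ Ω
  existsUnique {K : E} (k : K ⨯ Q ⟶ Ω) : ∃! u : K ⟶ obj, prod.map u (𝟙 Q) ≫ ev = k
  Neg : E
  neg : Neg ⟶ Ω
  mono_neg : Mono neg
  mem_neg_iff {K : E} (x : K ⟶ Ω) : Mem neg x ↔
    ∀ {L : E} (σ : L ⟶ K), Mem t (σ ≫ x) → Nonempty (IsInitial L)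

theorem exists_predicateObject [LocallyCartesianClosed E] [FinitaryExtensive E] (Q : E) {Ω : E}
    (t : ⊤_ E ⟶ Ω) : Nonempty (PredicateObject Q t) := by
  obtain ⟨X, e, he⟩ := exists_exponential Q Ω
  obtain ⟨N, n, hn, h⟩ := exists_negation t
  exact ⟨{ obj := X, ev := e, existsUnique := he, Neg := N, neg := n, mono_neg := hn,
           mem_neg_iff := h }⟩

instance mono_of_terminal {Ω : E} (t : ⊤_ E ⟶ Ω) : Mono t :=
  ⟨fun _ _ _ => Subsingleton.elim _ _⟩

attribute [instance] PredicateObject.mono_neg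

namespace CubicalSet

/-- The pairing of maps into constant cubical sets. -/
def pairΔ {Z : CubicalSet C} {A B : E} (a : Z ⟶ (Δ C).obj A) (b : Z ⟶ (Δ C).obj B) :
    Z ⟶ (Δ C).obj (A ⨯ B) :=
  mkΔ (prod.lift (val a) (val b)) (fun x s h => by
    rw [prod.comp_lift, prod.comp_lift, act_val, act_val])

@[simp]
theorem val_pairΔ {Z : CubicalSet C} {A B : E} (a : Z ⟶ (Δ C).obj A) (b : Z ⟶ (Δ C).obj B) :
    val (pairΔ a b) = prod.lift (val a) (val b) :=
  val_mkΔ _ (fun x s h => by rw [prod.comp_lift, prod.comp_lift, act_val, act_val])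

theorem comp_pairΔ {Z Z' : CubicalSet C} {A B : E} (σ : Z' ⟶ Z) (a : Z ⟶ (Δ C).obj A)
    (b : Z ⟶ (Δ C).obj B) : σ ≫ pairΔ a b = pairΔ (σ ≫ a) (σ ≫ b) :=
  val_injective (by simp [val_comp])

@[simp]
theorem pairΔ_fst {Z : CubicalSet C} {A B : E} (a : Z ⟶ (Δ C).obj A) (b : Z ⟶ (Δ C).obj B) :
    pairΔ a b ≫ (Δ C).map prod.fst = a :=
  val_injective (by simp [val_comp_map])

/-- A map to a constant cubical set is determined by its invariant underlying function, and a
factorization of that function through a monomorphism is again invariant. -/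
theorem mem_Δ_iff {Z : CubicalSet C} {A B : E} (m : A ⟶ B) [Mono m] (b : Z ⟶ (Δ C).obj B) :
    Mem ((Δ C).map m) b ↔ Mem m (val b) := by
  constructor
  · rintro ⟨l, rfl⟩
    exact ⟨val l, (val_comp_map _ _).symm⟩
  · exact exists_Δ_factor m b

theorem mem_pullback_Δ_iff {Z B : CubicalSet C} {A Ω : E} (χ : B ⟶ (Δ C).obj Ω) (m : A ⟶ Ω)
    [Mono m] (z : Z ⟶ B) : Mem (pullback.fst χ ((Δ C).map m)) z ↔ Mem m (val (z ≫ χ)) :=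
  (mem_pullback_fst_iff _ _ _).trans (mem_Δ_iff _ _)

theorem mem_hom_pullback_Δ {B : CubicalSet C} {K A Ω : E} (χ : B ⟶ (Δ C).obj Ω) (m : A ⟶ Ω)
    (x : K ⟶ B.carrier) (h : Mem m (x ≫ val χ)) :
    Mem (pullback.fst χ ((Δ C).map m)).hom x := by
  obtain ⟨l, hl⟩ := h
  obtain ⟨w, hw, -⟩ := exists_pullback_el (IsPullback.of_hasPullback χ ((Δ C).map m)) x
    (Δel l (x ≫ B.dim)) (Δel_ext (by
      rw [Category.assoc, Category.assoc, Δmap_val, Δel_val_assoc, hl, val_eq]) (by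
      rw [Category.assoc, Category.assoc, Hom.dim_eq, Hom.dim_eq, Δel_dim]))
  exact ⟨w, hw⟩

end CubicalSet

namespace PredicateObject

variable [LocallyCartesianClosed E] [FinitaryExtensive E] {Q Ω : E} {t : ⊤_ E ⟶ Ω}
  (U : PredicateObject Q t)

/-- Application of a predicate. -/
def app {K : E} (x : K ⟶ U.obj) (q : K ⟶ Q) : K ⟶ Ω := prod.lift x q ≫ U.ev

theorem comp_app {K L : E} (σ : L ⟶ K) (x : K ⟶ U.obj) (q : K ⟶ Q) :
    σ ≫ U.app x q = U.app (σ ≫ x) (σ ≫ q) := by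
  rw [app, app, prod.comp_lift_assoc]

variable {U} in
theorem hom_ext {K : E} {x y : K ⟶ U.obj}
    (h : U.app (prod.fst ≫ x) prod.snd = U.app (prod.fst ≫ y) (prod.snd : K ⨯ Q ⟶ Q)) : x = y := by
  refine (U.existsUnique (prod.map y (𝟙 Q) ≫ U.ev)).unique ?_ rfl
  have : ∀ z : K ⟶ U.obj, prod.map z (𝟙 Q) ≫ U.ev = U.app (prod.fst ≫ z) prod.snd := by
    intro z
    rw [app]; congr 1; apply Limits.prod.hom_ext <;> simp
  rw [this, this, h]

theorem exists_app {K : E} (k : K ⨯ Q ⟶ Ω) :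
    ∃ u : K ⟶ U.obj, U.app (prod.fst ≫ u) prod.snd = k := by
  obtain ⟨u, hu, -⟩ := U.existsUnique k
  refine ⟨u, hu ▸ ?_⟩
  rw [app]; congr 1; apply Limits.prod.hom_ext <;> simp

variable (C) in
/-- The evaluation map in cubical sets. -/
def evΔ : (Δ C).obj U.obj ⨯ (Δ C).obj Q ⟶ (Δ C).obj Ω :=
  pairΔ prod.fst prod.snd ≫ (Δ C).map U.ev

theorem lift_evΔ {Z : CubicalSet C} (x : Z ⟶ (Δ C).obj U.obj) (q : Z ⟶ (Δ C).obj Q) :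
    val (prod.lift x q ≫ U.evΔ C) = U.app (val x) (val q) := by
  rw [evΔ, ← Category.assoc, comp_pairΔ, prod.lift_fst, prod.lift_snd, val_comp_map, val_pairΔ, app]

/-- The transpose of a family of predicates. -/
abbrev uncurry {Y : CubicalSet C} (χ : Y ⟶ (Δ C).obj U.obj) : Y ⨯ (Δ C).obj Q ⟶ (Δ C).obj Ω :=
  prod.map χ (𝟙 _) ≫ U.evΔ C

theorem val_comp_uncurry {Z Y : CubicalSet C} (χ : Y ⟶ (Δ C).obj U.obj)
    (z : Z ⟶ Y ⨯ (Δ C).obj Q) :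
    val (z ≫ U.uncurry χ) = U.app (val (z ≫ prod.fst ≫ χ)) (val (z ≫ prod.snd)) := by
  rw [← lift_evΔ, ← Category.assoc]
  congr 2
  apply Limits.prod.hom_ext <;> simp

theorem comp_val_uncurry {Y : CubicalSet C} {K : E} (χ : Y ⟶ (Δ C).obj U.obj)
    (x : K ⟶ (Y ⨯ (Δ C).obj Q).carrier) :
    x ≫ val (U.uncurry χ) = U.app ((x ≫ (prod.fst : Y ⨯ (Δ C).obj Q ⟶ Y).hom) ≫ val χ)
      ((x ≫ (prod.snd : Y ⨯ (Δ C).obj Q ⟶ _).hom) ≫ Δval Q) := by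
  have := U.val_comp_uncurry χ (𝟙 (Y ⨯ (Δ C).obj Q))
  simp only [Category.id_comp] at this
  rw [this, comp_app]
  congr 1
  · rw [val_comp, Category.assoc]
  · rw [val_eq, Category.assoc]

-- An element `y` of any dimension can be paired with every rational in that dimension, which gives
-- the transpose in `E`. It is invariant under restriction because `k` takes values in a constant
-- cubical set, so it defines a map to `Δ(U.obj)`.
variable (C) in
theorem isExponential : IsExponential (U.evΔ C) := by
  intro Y k
  obtain ⟨u, hu⟩ := U.exists_app (K := Y.carrier)
    (pairEl (X := Y) (Y := (Δ C).obj Q) prod.fst (Δel prod.snd (prod.fst ≫ Y.dim)) (by simp) ≫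
      val k)
  have hu' : ∀ {K : E} (y : K ⟶ Y.carrier) (q : K ⟶ Q)
      (h : y ≫ Y.dim = Δel q (y ≫ Y.dim) ≫ ((Δ C).obj Q).dim),
      U.app (y ≫ u) q = pairEl y (Δel q (y ≫ Y.dim)) h ≫ val k := by
    intro K y q h
    have := congrArg (prod.lift y q ≫ ·) hu
    simp only [comp_app] at this
    rw [prod.lift_fst_assoc, prod.lift_snd, ← Category.assoc] at this
    rw [this]
    congr 1
    refine prod_el_ext (by simp) ?_
    rw [Category.assoc, pairEl_snd, pairEl_snd, comp_Δel]
    simp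
  have hinv : ∀ {K : E} (y : K ⟶ Y.carrier) (s : K ⟶ C.Mor) (h : s ≫ C.cod = y ≫ Y.dim),
      Y.act y s h ≫ u = y ≫ u := by
    intro K y s h
    refine hom_ext ?_
    have e₁ : ((prod.fst : K ⨯ Q ⟶ K) ≫ s) ≫ C.cod = (prod.fst ≫ y) ≫ Y.dim := by
      rw [Category.assoc, h, Category.assoc]
    rw [← Category.assoc, ← Category.assoc, Y.act_nat _ _ _ _ e₁, hu' _ _ (by simp),
      hu' _ _ (by simp)]
    have e₂ : ((prod.fst : K ⨯ Q ⟶ K) ≫ s) ≫ C.cod = pairEl (X := Y) (Y := (Δ C).obj Q)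
        ((prod.fst : K ⨯ Q ⟶ K) ≫ y) (Δel prod.snd ((prod.fst ≫ y) ≫ Y.dim)) (by simp) ≫
        (Y ⨯ (Δ C).obj Q).dim := by
      rw [← (prod.fst : Y ⨯ (Δ C).obj Q ⟶ Y).dim_eq, ← Category.assoc, pairEl_fst, e₁]
    rw [← act_val k _ _ e₂]
    congr 1
    refine prod_el_ext ?_ ?_
    · rw [pairEl_fst, Hom.act_eq]
      exact Y.act_congr (pairEl_fst _ _ _).symm rfl _ _
    · rw [pairEl_snd, Hom.act_eq]
      refine Δel_ext ?_ ?_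
      · rw [act_Δval, pairEl_snd, Δel_val, Δel_val]
      · rw [act_dim, Δel_dim, act_dim]
  refine ⟨mkΔ u hinv, val_injective ?_, ?_⟩
  · rw [← Category.id_comp (val (prod.map _ _ ≫ _))]
    refine (U.comp_val_uncurry (mkΔ u hinv) (𝟙 _)).trans ?_
    rw [val_mkΔ, Category.id_comp, Category.id_comp, hu' _ _ (by simp)]
    refine (congrArg (· ≫ val k) (prod_el_ext ?_ ?_)).trans (Category.id_comp _)
    · rw [pairEl_fst, Category.id_comp]
    · rw [pairEl_snd, Category.id_comp]
      exact Δel_ext (by simp) (by simp [Hom.dim_eq])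
  · intro w hw
    refine val_injective (hom_ext ?_)
    rw [val_mkΔ, hu' _ _ (by simp), ← hw, U.comp_val_uncurry w, pairEl_fst, pairEl_snd, Δel_val]

/-- The family of cubical sets classified by a family of predicates. -/
abbrev El {Y : CubicalSet C} (χ : Y ⟶ (Δ C).obj U.obj) :
    pullback (U.uncurry χ) ((Δ C).map t) ⟶ Y ⨯ (Δ C).obj Q :=
  classified t (U.uncurry χ)

/-- Emptiness of a cubical set is emptiness of its carrier, so the negation computed in `E` is also
the negation in cubical sets. -/
theorem isNegation_classified {B : CubicalSet C} (χ : B ⟶ (Δ C).obj Ω) :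
    IsNegation (classified t χ) (pullback.fst χ ((Δ C).map U.neg)) := by
  refine ⟨inferInstance, fun Z z => (mem_pullback_Δ_iff χ U.neg z).trans ?_⟩
  rw [isInitial_iff, U.mem_neg_iff]
  constructor
  · intro h
    refine h (pullback.snd (classified t χ) z).hom ?_
    rw [← val_comp, ← Category.assoc, ← pullback.condition, Category.assoc, pullback.condition,
      val_comp, val_comp_map]
    exact ⟨_, Category.assoc _ _ _⟩
  · intro h L σ hσ
    obtain ⟨w, hw⟩ := mem_hom_pullback_Δ χ t (σ ≫ z.hom) (by
      rwa [val_comp, ← Category.assoc] at hσ)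
    obtain ⟨v, -, -⟩ := exists_pullback_el (IsPullback.of_hasPullback (classified t χ) z) w σ hw
    exact ⟨h.some.ofStrict v⟩

end PredicateObject

end PowerObjects
end
end CubicalReals

/-! ### The type of cocuts, and its universal property for classified families. -/

namespace CubicalReals
noncomputable section

section Reals

variable {E : Type u} [Category.{v} E] [HasFiniteLimits E] {NN : NNO E}
  {C : CubeCategory NN} [LocallyCartesianClosed E] [FinitaryExtensive E]

attribute [local simp] pullback.lift_fst pullback.lift_snd pullback.lift_fst_assoc
  pullback.lift_snd_assoc prod.lift_fst prod.lift_snd prod.lift_fst_assoc prod.lift_snd_assoc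
  coprod.inl_desc coprod.inr_desc coprod.inl_desc_assoc coprod.inr_desc_assoc

open CubicalSet

namespace PredicateObject

variable {QQ : Rationals NN} {Ω : E} {t : ⊤_ E ⟶ Ω} (U : PredicateObject QQ.Q t)

/-- The object of predicates with bounds `a ∉ x` and `b ∈ x`. -/
def bounds : pullback (prod.lift (U.app prod.fst (prod.snd ≫ prod.fst))
    (U.app prod.fst (prod.snd ≫ prod.snd))) (prod.map U.neg t) ⟶ U.obj ⨯ (QQ.Q ⨯ QQ.Q) :=
  pullback.fst _ _

instance : Mono U.bounds := inferInstanceAs (Mono (pullback.fst _ _))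

theorem mem_bounds_iff {K : E} (x : K ⟶ U.obj) (a b : K ⟶ QQ.Q) :
    Mem U.bounds (prod.lift x (prod.lift a b)) ↔ Mem U.neg (U.app x a) ∧ Mem t (U.app x b) := by
  rw [bounds, mem_pullback_fst_iff, prod.comp_lift, mem_prod_map_iff, comp_app, comp_app]
  simp

/-- The object of predicates `x` and `a < b` with `a ∉ x`. -/
def below : pullback (U.app prod.fst (prod.snd ≫ QQ.ltFst)) U.neg ⟶ U.obj ⨯ QQ.ltObj :=
  pullback.fst _ _

/-- The object of predicates `x` and `a < b` with `b ∈ x`. -/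
def above : pullback (U.app prod.fst (prod.snd ≫ QQ.ltSnd)) t ⟶ U.obj ⨯ QQ.ltObj :=
  pullback.fst _ _

instance : Mono U.below := inferInstanceAs (Mono (pullback.fst _ _))
instance : Mono U.above := inferInstanceAs (Mono (pullback.fst _ _))

theorem mem_below_iff {K : E} (x : K ⟶ U.obj ⨯ QQ.ltObj) :
    Mem U.below x ↔ Mem U.neg (U.app (x ≫ prod.fst) (x ≫ prod.snd ≫ QQ.ltFst)) := by
  rw [below, mem_pullback_fst_iff, comp_app]

theorem mem_above_iff {K : E} (x : K ⟶ U.obj ⨯ QQ.ltObj) :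
    Mem U.above x ↔ Mem t (U.app (x ≫ prod.fst) (x ≫ prod.snd ≫ QQ.ltSnd)) := by
  rw [above, mem_pullback_fst_iff, comp_app]

/-- Membership of all `b > a` is a quantification along the smaller-rational map `ltFst`, so it
defines a subobject of pairs `(x, a)`. -/
theorem exists_upperBound : ∃ (D : E) (i : D ⟶ U.obj ⨯ QQ.Q),
    ∀ {K : E} (x : K ⟶ U.obj) (a : K ⟶ QQ.Q), Mem i (prod.lift x a) ↔
      ∀ {L : E} (τ : L ⟶ K) (b : L ⟶ QQ.Q), QQ.Lt (τ ≫ a) b → Mem t (U.app (τ ≫ x) b) := by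
  have : Mono U.above := inferInstance
  obtain ⟨D, i, -, h⟩ := exists_forall_sub (prod.map (𝟙 U.obj) QQ.ltFst) U.above
  refine ⟨D, i, fun x a => (h _).trans ⟨fun H L τ b hb => ?_, fun H L τ l hl => ?_⟩⟩
  · obtain ⟨l, h₁, h₂⟩ := QQ.exists_ltObj hb
    have := H τ (prod.lift (τ ≫ x) l) (by
      rw [prod.lift_map, prod.comp_lift, h₁, Category.comp_id])
    rw [mem_above_iff] at this
    simpa [h₂] using this
  · rw [mem_above_iff]
    have e₁ := congrArg (· ≫ prod.fst) hl
    have e₂ := congrArg (· ≫ prod.snd) hl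
    simp only [Category.assoc, prod.map_fst, prod.map_snd, Category.comp_id, prod.lift_fst,
      prod.lift_snd] at e₁ e₂
    rw [e₁]
    refine H τ _ ?_
    rw [← e₂]
    have := QQ.lt_ltFst_ltSnd.comp (l ≫ prod.snd)
    simpa using this

/-- Closedness is an implication between subobjects, quantified over rationals; it needs no
truncation and defines a subobject of `U.obj` in `E`. -/
theorem exists_closed {D : E} (i : D ⟶ U.obj ⨯ QQ.Q) : ∃ (F : E) (j : F ⟶ U.obj), Mono j ∧
    ∀ {K : E} (x : K ⟶ U.obj), Mem j x ↔
      ∀ {L : E} (τ : L ⟶ K) (a : L ⟶ QQ.Q), Mem i (prod.lift (τ ≫ x) a) →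
        Mem t (U.app (τ ≫ x) a) := by
  obtain ⟨F, j, hj, h⟩ := exists_forall_sub (i ≫ prod.fst) (pullback.fst (i ≫ U.ev) t)
  refine ⟨F, j, hj, fun x => (h _).trans ⟨fun H L τ a => ?_, fun H L τ d hd => ?_⟩⟩
  · rintro ⟨d, hd⟩
    have := H τ d (by rw [← Category.assoc, hd, prod.lift_fst])
    rwa [mem_pullback_fst_iff, ← Category.assoc, hd] at this
  · rw [mem_pullback_fst_iff]
    have e : prod.lift (τ ≫ x) (d ≫ i ≫ prod.snd) = d ≫ i := by
      rw [← hd]; apply Limits.prod.hom_ext <;> simp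
    have := H τ (d ≫ i ≫ prod.snd) ⟨d, e.symm⟩
    rwa [app, e, Category.assoc] at this

end PredicateObject

/-- The ingredients of the type of Dedekind real numbers. -/
structure CutData {J : Endpoints C} (M : KanFibrations J) {QQ : Rationals NN} {Ω : E}
    {t : ⊤_ E ⟶ Ω} (U : PredicateObject QQ.Q t) where
  Bounded : CubicalSet C
  bounded : Bounded ⟶ (Δ C).obj U.obj
  unitBounded : (Δ C).obj _ ⟶ Bounded
  isPropTrunc_bounded : IsPropTrunc J M.Fib ((Δ C).map (U.bounds ≫ prod.fst)) bounded unitBounded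
  Located : CubicalSet C
  located : Located ⟶ (Δ C).obj (U.obj ⨯ QQ.ltObj)
  unitLocated : (Δ C).obj _ ⟶ Located
  isPropTrunc_located : IsPropTrunc J M.Fib ((Δ C).map (coprod.desc U.below U.above)) located
    unitLocated
  UpperBound : E
  upperBound : UpperBound ⟶ U.obj ⨯ QQ.Q
  mem_upperBound_iff {K : E} (x : K ⟶ U.obj) (a : K ⟶ QQ.Q) : Mem upperBound (prod.lift x a) ↔
    ∀ {L : E} (τ : L ⟶ K) (b : L ⟶ QQ.Q), QQ.Lt (τ ≫ a) b → Mem t (U.app (τ ≫ x) b)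
  Closed : E
  closed : Closed ⟶ U.obj
  mono_closed : Mono closed
  mem_closed_iff {K : E} (x : K ⟶ U.obj) : Mem closed x ↔
    ∀ {L : E} (τ : L ⟶ K) (a : L ⟶ QQ.Q), Mem upperBound (prod.lift (τ ≫ x) a) →
      Mem t (U.app (τ ≫ x) a)

theorem exists_cutData {J : Endpoints C} (M : KanFibrations J) {QQ : Rationals NN} {Ω : E}
    {t : ⊤_ E ⟶ Ω} (U : PredicateObject QQ.Q t) : Nonempty (CutData M U) := by
  obtain ⟨_, _, _, hB⟩ := M.trunc ((Δ C).map (U.bounds ≫ prod.fst)) (M.constant _)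
  obtain ⟨_, _, _, hL⟩ := M.trunc ((Δ C).map (coprod.desc U.below U.above)) (M.constant _)
  obtain ⟨D, i, hi'⟩ := U.exists_upperBound
  obtain ⟨F, j, hj, hj'⟩ := U.exists_closed i
  exact ⟨⟨_, _, _, hB, _, _, _, hL, D, i, hi', F, j, hj, hj'⟩⟩

/-- The total space `c` of a family has the same sections as the family classified by `χ`. -/
def Represents {Ω : E} (t : ⊤_ E ⟶ Ω) {A B : CubicalSet C} (c : A ⟶ B) (χ : B ⟶ (Δ C).obj Ω) :
    Prop :=
  ∀ {Z : CubicalSet C} (z : Z ⟶ B), Mem c z ↔ Mem t (val (z ≫ χ))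

theorem represents_classified {Ω : E} (t : ⊤_ E ⟶ Ω) {B : CubicalSet C} (χ : B ⟶ (Δ C).obj Ω) :
    Represents t (classified t χ) χ := fun z => mem_pullback_Δ_iff χ t z

theorem isInitial_pullback_of_mem {A A' B Z : CubicalSet C} {c : A ⟶ B} {c' : A' ⟶ B}
    (h : Mem c' c) (z : Z ⟶ B) (h' : Nonempty (IsInitial (pullback c' z))) :
    Nonempty (IsInitial (pullback c z)) := by
  obtain ⟨l, hl⟩ := h
  exact isInitial_of_hom (pullback.lift (pullback.fst c z ≫ l) (pullback.snd c z)
    (by rw [Category.assoc, hl, pullback.condition])) h'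

theorem mem_self {E' : Type*} [Category E'] {A B : E'} (c : A ⟶ B) : Mem c c := ⟨𝟙 _, Category.id_comp _⟩

/-- Negation depends only on which elements have lifts, so a representing map also computes the
negation of a family that is not itself a subobject. -/
theorem Represents.mem_negation_iff {Q Ω : E} {t : ⊤_ E ⟶ Ω} (U : PredicateObject Q t)
    {A B N : CubicalSet C} {c : A ⟶ B} {χ : B ⟶ (Δ C).obj Ω} (h : Represents t c χ) {n : N ⟶ B}
    (hn : IsNegation c n) {Z : CubicalSet C} (z : Z ⟶ B) :
    Mem n z ↔ Mem U.neg (val (z ≫ χ)) := by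
  have h' : Represents t (classified t χ) χ := represents_classified t χ
  refine (hn.2 Z z).trans (Iff.trans ⟨?_, ?_⟩ (((U.isNegation_classified χ).2 Z z).symm.trans
    (mem_pullback_Δ_iff χ U.neg z)))
  · exact isInitial_pullback_of_mem ((h _).mpr ((h' _).mp (mem_self _))) z
  · exact isInitial_pullback_of_mem ((h' _).mpr ((h _).mp (mem_self _))) z

namespace CutData

variable {J : Endpoints C} {M : KanFibrations J} {QQ : Rationals NN} {Ω : E}
  {t : ⊤_ E ⟶ Ω} {U : PredicateObject QQ.Q t} (D : CutData M U)

instance : Mono D.closed := D.mono_closed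

/-- The projection of the type of located predicates. -/
abbrev allLocated : pi (prod.fst : U.obj ⨯ QQ.ltObj ⟶ U.obj) D.located ⟶ (Δ C).obj U.obj :=
  piProj prod.fst D.located

/-- The type of Dedekind real numbers. -/
abbrev Reals : CubicalSet C :=
  pullback (pullback.fst D.bounded D.allLocated ≫ D.bounded) ((Δ C).map D.closed)

/-- The inclusion of the type of Dedekind real numbers. -/
abbrev incl : D.Reals ⟶ (Δ C).obj U.obj :=
  pullback.fst _ _ ≫ pullback.fst D.bounded D.allLocated ≫ D.bounded

theorem fib_allLocated : M.Fib D.allLocated :=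
  M.pi _ _ _ _ (M.constant _) D.isPropTrunc_located.fib (isDependentProduct_pi _ _)

theorem fib_incl : M.Fib D.incl :=
  M.comp_mem (M.fib_pullback_fst _ (M.constant _))
    (M.comp_mem (M.fib_pullback_fst _ D.fib_allLocated) D.isPropTrunc_bounded.fib)

theorem isHProp_incl : IsHProp J D.incl :=
  (D.isPropTrunc_bounded.hprop.inter (isHProp_piProj _ D.isPropTrunc_located.hprop)).inter
    (isHProp_of_mono _)

theorem fib_reals : M.Fib (terminal.from D.Reals) := by
  have := M.comp_mem D.fib_incl (M.fib_terminal_from_Δ _)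
  rwa [terminal.comp_from] at this

theorem mem_allLocated_iff {Y : CubicalSet C} (χ : Y ⟶ (Δ C).obj U.obj) :
    Mem D.allLocated χ ↔ Mem D.located (pullback.snd χ ((Δ C).map prod.fst)) := by
  constructor
  · rintro ⟨l, hl⟩
    exact ⟨piApp (pullback.fst χ ((Δ C).map prod.fst) ≫ l) (pullback.snd χ ((Δ C).map prod.fst))
      (by rw [Category.assoc, hl, pullback.condition]), piApp_comp _ _ _⟩
  · rintro ⟨k, hk⟩
    exact ⟨piLam χ k hk, piLam_comp _ _ _⟩

theorem mem_incl_iff {Y : CubicalSet C} (χ : Y ⟶ (Δ C).obj U.obj) :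
    Mem D.incl χ ↔ Mem D.bounded χ ∧
      Mem D.located (pullback.snd χ ((Δ C).map prod.fst)) ∧ Mem D.closed (val χ) := by
  rw [← mem_allLocated_iff]
  constructor
  · rintro ⟨l, rfl⟩
    refine ⟨⟨l ≫ pullback.fst _ _ ≫ pullback.fst _ _, by simp⟩,
      ⟨l ≫ pullback.fst _ _ ≫ pullback.snd _ _, by
        rw [Category.assoc, Category.assoc, ← pullback.condition (f := D.bounded)]⟩, ?_⟩
    rw [← mem_Δ_iff]
    exact ⟨l ≫ pullback.snd _ _, by simp [pullback.condition]⟩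
  · rintro ⟨⟨b, hb⟩, ⟨l, hl⟩, h⟩
    rw [← mem_Δ_iff] at h
    obtain ⟨c, hc⟩ := h
    refine ⟨pullback.lift (pullback.lift b l (hb.trans hl.symm)) c ?_, ?_⟩
    · rw [pullback.lift_fst_assoc, hb, hc]
    · rw [pullback.lift_fst_assoc, pullback.lift_fst_assoc, hb]

variable {Y A : CubicalSet C} {c : A ⟶ Y ⨯ (Δ C).obj QQ.Q} {χ : Y ⟶ (Δ C).obj U.obj}

omit D in
theorem lift_uncurry {Z : CubicalSet C} (y : Z ⟶ Y) (a : Z ⟶ (Δ C).obj QQ.Q) :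
    val (prod.lift y a ≫ U.uncurry χ) = U.app (val (y ≫ χ)) (val a) := by
  rw [U.val_comp_uncurry]; simp

omit D in
theorem _root_.CubicalReals.Represents.mem_lift_iff (h : Represents t c (U.uncurry χ))
    {Z : CubicalSet C} (y : Z ⟶ Y) (a : Z ⟶ (Δ C).obj QQ.Q) :
    Mem c (prod.lift y a) ↔ Mem t (U.app (val (y ≫ χ)) (val a)) := by
  rw [h, lift_uncurry]

/-- Actual bounds of `c` are bounds of the predicate `χ`, hence an element of `U.bounds`; the
truncation is then eliminated into the h-proposition `bounded` reindexed along `χ`. The argument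
uses only that `χ` represents `c`, so it serves both `El(χ)` and arbitrary cocuts. -/
theorem mem_bounded (h : Represents t c (U.uncurry χ)) {N : CubicalSet C}
    {n : N ⟶ Y ⨯ (Δ C).obj QQ.Q} (hn : IsNegation c n)
    (hm : MerelyInhabited M (pullback.fst (n ≫ prod.fst) (c ≫ prod.fst) ≫ n ≫ prod.fst)) :
    Mem D.bounded χ := by
  let w := pullback.fst (n ≫ prod.fst) (c ≫ prod.fst) ≫ n ≫ prod.fst
  let F := pullback.fst (n ≫ prod.fst) (c ≫ prod.fst)
  let G := pullback.snd (n ≫ prod.fst) (c ≫ prod.fst)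
  have hG : G ≫ c ≫ prod.fst = w := pullback.condition.symm
  have h₁ := (h.mem_negation_iff U hn (F ≫ n)).mp ⟨F, rfl⟩
  have h₂ := (h (G ≫ c)).mp ⟨G, rfl⟩
  rw [U.val_comp_uncurry] at h₁ h₂
  have h₃ : Mem U.bounds (val (pairΔ (w ≫ χ) (pairΔ ((F ≫ n) ≫ prod.snd) ((G ≫ c) ≫ prod.snd)))) := by
    rw [val_pairΔ, val_pairΔ, U.mem_bounds_iff]
    refine ⟨?_, ?_⟩
    · simpa [w, F] using h₁
    · rw [← hG]; simpa using h₂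
  obtain ⟨κ, hκ⟩ := exists_Δ_factor _ _ h₃
  have hκ' : κ ≫ (Δ C).map (U.bounds ≫ prod.fst) = w ≫ χ := by
    rw [Functor.map_comp, reassoc_of% hκ, pairΔ_fst]
  obtain ⟨v, hv⟩ := hm.exists_section (pullback.fst χ D.bounded)
    (M.fib_pullback_fst _ D.isPropTrunc_bounded.fib)
    (D.isPropTrunc_bounded.hprop.of_isPullback (IsPullback.of_hasPullback _ _).flip)
    (pullback.lift w (κ ≫ D.unitBounded) (by
      rw [Category.assoc κ, D.isPropTrunc_bounded.fac]; exact hκ'.symm)) (pullback.lift_fst _ _ _)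
  exact ⟨v ≫ pullback.snd _ _, by rw [Category.assoc, ← pullback.condition, reassoc_of% hv]⟩

/-- Locatedness is used once, for the generic pair `a < b` over `Y`; the two summands map to
`U.below` and `U.above`, and the truncation is eliminated into `located`. -/
theorem mem_located (h : Represents t c (U.uncurry χ)) {N : CubicalSet C}
    {n : N ⟶ Y ⨯ (Δ C).obj QQ.Q} (hn : IsNegation c n)
    (hl : ∀ {Z : CubicalSet C} (y : Z ⟶ Y) (a b : Z ⟶ (Δ C).obj QQ.Q), RatLt QQ a b →
      ∃ (S : CubicalSet C) (i : pullback n (prod.lift y a) ⟶ S)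
        (j : pullback c (prod.lift y b) ⟶ S) (s : S ⟶ Z),
        Nonempty (IsColimit (BinaryCofan.mk i j)) ∧
        i ≫ s = pullback.snd n (prod.lift y a) ∧ j ≫ s = pullback.snd c (prod.lift y b) ∧
        MerelyInhabited M s) :
    Mem D.located (pullback.snd χ ((Δ C).map prod.fst)) := by
  let y := pullback.fst χ ((Δ C).map (prod.fst : U.obj ⨯ QQ.ltObj ⟶ U.obj))
  let H := pullback.snd χ ((Δ C).map (prod.fst : U.obj ⨯ QQ.ltObj ⟶ U.obj))
  have hy : y ≫ χ = H ≫ (Δ C).map prod.fst := pullback.condition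
  let a := H ≫ (Δ C).map (prod.snd ≫ QQ.ltFst)
  let b := H ≫ (Δ C).map (prod.snd ≫ QQ.ltSnd)
  have hab : RatLt QQ a b := by
    have := QQ.lt_ltFst_ltSnd.comp (val H ≫ prod.snd)
    rw [Category.assoc, Category.assoc] at this
    rwa [RatLt, val_comp_map, val_comp_map]
  obtain ⟨S, i, j, s, ⟨hc⟩, hi, hj, hm⟩ := hl y a b hab
  have e : ∀ {Z : CubicalSet C} (q : Z ⟶ _) (f : QQ.ltObj ⟶ QQ.Q),
      val (q ≫ prod.lift y (H ≫ (Δ C).map (prod.snd ≫ f)) ≫ U.uncurry χ) =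
      U.app (val (q ≫ H) ≫ prod.fst) (val (q ≫ H) ≫ prod.snd ≫ f) := by
    intro Z q f
    rw [← Category.assoc, prod.comp_lift, lift_uncurry, Category.assoc, hy, ← Category.assoc,
      ← Category.assoc, val_comp_map, val_comp_map]
  have h₁ := (h.mem_negation_iff U hn (pullback.snd n (prod.lift y a) ≫ prod.lift y a)).mp
    ⟨_, pullback.condition⟩
  have h₂ := (h (pullback.snd c (prod.lift y b) ≫ prod.lift y b)).mp
    ⟨_, pullback.condition⟩
  rw [Category.assoc, e, ← U.mem_below_iff] at h₁
  rw [Category.assoc, e, ← U.mem_above_iff] at h₂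
  obtain ⟨κ₁, hκ₁⟩ := exists_Δ_factor _ _ h₁
  obtain ⟨κ₂, hκ₂⟩ := exists_Δ_factor _ _ h₂
  obtain ⟨k, hk₁, hk₂⟩ : ∃ k : S ⟶ (Δ C).obj _,
      i ≫ k = κ₁ ≫ (Δ C).map coprod.inl ∧ j ≫ k = κ₂ ≫ (Δ C).map coprod.inr :=
    let k := BinaryCofan.IsColimit.desc' hc (κ₁ ≫ (Δ C).map coprod.inl)
      (κ₂ ≫ (Δ C).map coprod.inr)
    ⟨k.1, k.2.1, k.2.2⟩
  have hk : k ≫ (Δ C).map (coprod.desc U.below U.above) = s ≫ H := by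
    refine BinaryCofan.IsColimit.hom_ext hc ?_ ?_
    · change i ≫ _ = i ≫ _
      rw [reassoc_of% hk₁, ← Functor.map_comp, coprod.inl_desc, hκ₁, reassoc_of% hi]
    · change j ≫ _ = j ≫ _
      rw [reassoc_of% hk₂, ← Functor.map_comp, coprod.inr_desc, hκ₂, reassoc_of% hj]
  obtain ⟨v, hv⟩ := hm.exists_section (pullback.fst H D.located)
    (M.fib_pullback_fst _ D.isPropTrunc_located.fib)
    (D.isPropTrunc_located.hprop.of_isPullback (IsPullback.of_hasPullback _ _).flip)
    (pullback.lift s (k ≫ D.unitLocated) (by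
      rw [Category.assoc, D.isPropTrunc_located.fac, hk])) (pullback.lift_fst _ _ _)
  exact ⟨v ≫ pullback.snd _ _, by rw [Category.assoc, ← pullback.condition, reassoc_of% hv]⟩

theorem mem_closed (h : Represents t c (U.uncurry χ))
    (hcl : ∀ {Z : CubicalSet C} (y : Z ⟶ Y) (a : Z ⟶ (Δ C).obj QQ.Q),
      (∀ {Z' : CubicalSet C} (ρ : Z' ⟶ Z) (b : Z' ⟶ (Δ C).obj QQ.Q), RatLt QQ (ρ ≫ a) b →
        ∃ l : Z' ⟶ A, l ≫ c = prod.lift (ρ ≫ y) b) → ∃ l : Z ⟶ A, l ≫ c = prod.lift y a) :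
    Mem D.closed (val χ) := by
  rw [D.mem_closed_iff]
  rintro L τ a ⟨d, hd⟩
  -- Closedness of `c` is applied in the context of all elements of `Y` with a generic bound of
  -- their predicate, and then evaluated at the element given by `τ` and `d`.
  let y := pullback.fst χ ((Δ C).map (D.upperBound ≫ prod.fst))
  let H := pullback.snd χ ((Δ C).map (D.upperBound ≫ prod.fst))
  have hy : y ≫ χ = H ≫ (Δ C).map (D.upperBound ≫ prod.fst) := pullback.condition
  have key := hcl y (H ≫ (Δ C).map (D.upperBound ≫ prod.snd)) (fun {Z'} ρ b hb => by
    refine (h.mem_lift_iff _ _).mpr ?_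
    have hu : Mem D.upperBound (prod.lift (val (ρ ≫ H) ≫ D.upperBound ≫ prod.fst)
        (val (ρ ≫ H) ≫ D.upperBound ≫ prod.snd)) :=
      ⟨val (ρ ≫ H), by apply Limits.prod.hom_ext <;> simp⟩
    have := (D.mem_upperBound_iff _ _).mp hu (𝟙 _) (val b) (by
      rw [RatLt, ← Category.assoc, val_comp_map] at hb
      rwa [Category.id_comp])
    rwa [Category.id_comp, ← val_comp_map, Category.assoc, ← hy, ← Category.assoc] at this)
  have key' := (h.mem_lift_iff _ _).mp key
  obtain ⟨w, hw₁, hw₂⟩ := exists_pullback_el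
    (IsPullback.of_hasPullback χ ((Δ C).map (D.upperBound ≫ prod.fst))) τ (Δel d (τ ≫ Y.dim))
    (Δel_ext (by
      rw [Category.assoc, Category.assoc, Δmap_val, Δel_val_assoc, reassoc_of% hd, prod.lift_fst,
        val_eq]) (by rw [Category.assoc, Category.assoc, Hom.dim_eq, Hom.dim_eq, Δel_dim]))
  have := key'.comp w
  rw [U.comp_app, val_comp, val_comp_map, val_eq H, ← Category.assoc, hw₁, Category.assoc,
    ← Category.assoc w, hw₂, Δel_val_assoc, reassoc_of% hd, prod.lift_snd] at this
  exact this

theorem mem_incl_of_isCocut (h : Represents t c (U.uncurry χ)) (hc : IsCocut M QQ c) :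
    Mem D.incl χ := by
  obtain ⟨N, n, hn, hm⟩ := hc.bounded
  obtain ⟨N', n', hn', hm'⟩ := hc.located
  exact (D.mem_incl_iff χ).mpr ⟨D.mem_bounded h hn hm, D.mem_located h hn' hm',
    D.mem_closed h hc.closed⟩

omit [LocallyCartesianClosed E] [FinitaryExtensive E] D in
theorem isPullback_of_mem {E' : Type*} [Category E'] {A B A' B' : E'} {m : A ⟶ B} {m' : A' ⟶ B'}
    [Mono m] [Mono m'] {f : B ⟶ B'} {κ : A ⟶ A'} (w : m ≫ f = κ ≫ m')
    (h : ∀ {Z : E'} (x : Z ⟶ B), Mem m' (x ≫ f) → Mem m x) : IsPullback m κ f m' where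
  w := w
  isLimit' := by
    have h' : ∀ s : PullbackCone f m', ∃ l, l ≫ m = s.fst := fun s =>
      h s.fst ⟨s.snd, s.condition.symm⟩
    choose l hl using h'
    exact ⟨PullbackCone.IsLimit.mk w l hl
      (fun s => by
        rw [← cancel_mono m', Category.assoc, ← w, ← Category.assoc, hl, s.condition])
      (fun s k h₁ _ => by rw [← cancel_mono m, h₁, hl])⟩

/-- Over the pullback of the object of bounds along `χ` there are actual bounds, so the given
element of `bounded` yields mere inhabitation of the type of bounds of `El(χ)`. -/
theorem bounded_el (h : Mem D.bounded χ) :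
    ∃ (N : CubicalSet C) (n : N ⟶ Y ⨯ (Δ C).obj QQ.Q), IsNegation (U.El χ) n ∧
      MerelyInhabited M (pullback.fst (n ≫ prod.fst) (U.El χ ≫ prod.fst) ≫ n ≫ prod.fst) := by
  refine ⟨_, _, U.isNegation_classified _, ?_⟩
  obtain ⟨s, hs⟩ := h
  have hfib : ∀ {A Ω : E} (χ : Y ⨯ (Δ C).obj QQ.Q ⟶ (Δ C).obj Ω) (m : A ⟶ Ω),
      M.Fib (pullback.fst χ ((Δ C).map m) ≫ prod.fst) := fun χ m =>
    M.comp_mem (M.fib_pullback_fst _ (M.constant _)) (M.fib_fst _ _)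
  let v := pullback.fst ((Δ C).map (U.bounds ≫ prod.fst)) χ
  let y := pullback.snd ((Δ C).map (U.bounds ≫ prod.fst)) χ
  have hy : val (y ≫ χ) = val v ≫ U.bounds ≫ prod.fst := by
    rw [← val_comp_map, pullback.condition]
  have hb : Mem U.bounds (prod.lift (val v ≫ U.bounds ≫ prod.fst)
      (prod.lift (val v ≫ U.bounds ≫ prod.snd ≫ prod.fst)
        (val v ≫ U.bounds ≫ prod.snd ≫ prod.snd))) :=
    ⟨val v, Limits.prod.hom_ext (by simp) (Limits.prod.hom_ext (by simp) (by simp))⟩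
  rw [U.mem_bounds_iff, ← hy, ← val_comp_map, ← val_comp_map, ← lift_uncurry, ← lift_uncurry,
    ← mem_pullback_Δ_iff, ← mem_pullback_Δ_iff] at hb
  obtain ⟨⟨l₁, h₁⟩, ⟨l₂, h₂⟩⟩ := hb
  refine MerelyInhabited.of_section D.isPropTrunc_bounded s hs _
    (M.comp_mem (M.fib_pullback_fst _ (hfib _ _)) (hfib _ _)) (pullback.lift l₁ l₂ ?_) ?_
  · rw [reassoc_of% h₁, reassoc_of% h₂, prod.lift_fst, prod.lift_fst]
  · rw [pullback.lift_fst_assoc, reassoc_of% h₁, prod.lift_fst]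

/-- The required sum is the pullback, along the given pair `a < b`, of the map that combines `below`
and `above`. It is a coproduct because `Δ` preserves coproducts and cubical sets are extensive. -/
theorem located_el (h : Mem D.located (pullback.snd χ ((Δ C).map prod.fst))) :
    ∃ (N : CubicalSet C) (n : N ⟶ Y ⨯ (Δ C).obj QQ.Q), IsNegation (U.El χ) n ∧
    ∀ {Z : CubicalSet C} (y : Z ⟶ Y) (a b : Z ⟶ (Δ C).obj QQ.Q), RatLt QQ a b →
      ∃ (S : CubicalSet C) (i : pullback n (prod.lift y a) ⟶ S)
        (j : pullback (U.El χ) (prod.lift y b) ⟶ S) (s : S ⟶ Z),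
        Nonempty (IsColimit (BinaryCofan.mk i j)) ∧
        i ≫ s = pullback.snd n (prod.lift y a) ∧ j ≫ s = pullback.snd (U.El χ) (prod.lift y b) ∧
        MerelyInhabited M s := by
  refine ⟨_, _, U.isNegation_classified _, ?_⟩
  intro Z y a b hab
  obtain ⟨s, hs⟩ := h
  obtain ⟨l, hl₁, hl₂⟩ := QQ.exists_ltObj hab
  -- Invariance under restriction holds because the recorded difference is determined by `a` and
  -- `b`.
  let l' : Z ⟶ (Δ C).obj QQ.ltObj := mkΔ l (fun x s h => QQ.ltObj_hom_ext
    (by rw [Category.assoc, Category.assoc, hl₁, act_val])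
    (by rw [Category.assoc, Category.assoc, hl₂, act_val]))
  have hl' : val l' = l := val_mkΔ _ _
  let H : Z ⟶ (Δ C).obj (U.obj ⨯ QQ.ltObj) := pairΔ (y ≫ χ) l'
  have hH : val H = prod.lift (val (y ≫ χ)) l := by rw [val_pairΔ, hl']
  have e₁ : ∀ {Z' : CubicalSet C} (x : Z' ⟶ Z), Mem (pullback.fst (U.uncurry χ) ((Δ C).map U.neg))
      (x ≫ prod.lift y a) ↔ Mem ((Δ C).map U.below) (x ≫ H) := by
    intro Z' x
    rw [mem_pullback_Δ_iff, mem_Δ_iff, Category.assoc, val_comp, lift_uncurry, U.mem_below_iff,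
      val_comp x H, hH, U.comp_app]
    simp [hl₁]
  have e₂ : ∀ {Z' : CubicalSet C} (x : Z' ⟶ Z), Mem (U.El χ)
      (x ≫ prod.lift y b) ↔ Mem ((Δ C).map U.above) (x ≫ H) := by
    intro Z' x
    rw [mem_pullback_Δ_iff, mem_Δ_iff, Category.assoc, val_comp, lift_uncurry, U.mem_above_iff,
      val_comp x H, hH, U.comp_app]
    simp [hl₂]
  let cover := (Δ C).map (coprod.desc U.below U.above)
  obtain ⟨κ₁, hκ₁⟩ := (e₁ (pullback.snd _ _)).mp ⟨_, pullback.condition⟩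
  obtain ⟨κ₂, hκ₂⟩ := (e₂ (pullback.snd _ _)).mp ⟨_, pullback.condition⟩
  have p₁ := isPullback_of_mem hκ₁.symm (fun x hx => by
    obtain ⟨k, hk⟩ := (e₁ x).mpr hx
    exact ⟨pullback.lift k x hk, pullback.lift_snd _ _ _⟩)
  have p₂ := isPullback_of_mem hκ₂.symm (fun x hx => by
    obtain ⟨k, hk⟩ := (e₂ x).mpr hx
    exact ⟨pullback.lift k x hk, pullback.lift_snd _ _ _⟩)
  have c₁ : (Δ C).map coprod.inl ≫ cover = (Δ C).map U.below := by
    rw [← Functor.map_comp, coprod.inl_desc]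
  have c₂ : (Δ C).map coprod.inr ≫ cover = (Δ C).map U.above := by
    rw [← Functor.map_comp, coprod.inr_desc]
  let i := pullback.lift (f := cover) (g := H) (κ₁ ≫ (Δ C).map coprod.inl) (pullback.snd _ _)
    (by rw [Category.assoc, c₁, hκ₁])
  let j := pullback.lift (f := cover) (g := H) (κ₂ ≫ (Δ C).map coprod.inr) (pullback.snd _ _)
    (by rw [Category.assoc, c₂, hκ₂])
  have q := (IsPullback.of_hasPullback cover H).flip
  have hc := mapIsColimitOfPreservesOfIsColimit (Δ C) _ _ (coprodIsCoprod
    (pullback (U.app prod.fst (prod.snd ≫ QQ.ltFst)) U.neg)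
    (pullback (U.app prod.fst (prod.snd ≫ QQ.ltSnd)) t))
  refine ⟨pullback cover H, i, j, pullback.snd _ _, ?_, pullback.lift_snd _ _ _,
    pullback.lift_snd _ _ _, ?_⟩
  · refine (isColimit_iff_isPullback hc (pullback.lift_fst _ _ _)
      (pullback.lift_fst _ _ _)).mpr ⟨?_, ?_⟩
    · refine IsPullback.of_right ?_ (pullback.lift_fst _ _ _) q
      rwa [pullback.lift_snd, c₁]
    · refine IsPullback.of_right ?_ (pullback.lift_fst _ _ _) q
      rwa [pullback.lift_snd, c₂]
  · refine MerelyInhabited.of_section D.isPropTrunc_located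
      (pullback.lift y H (pairΔ_fst _ _).symm ≫ s) (by rw [Category.assoc, hs, pullback.lift_snd]) _
      (M.fib_snd _ (M.constant _)) (𝟙 _) (Category.id_comp _)

theorem closed_el (h : Mem D.closed (val χ)) {Z : CubicalSet C} (y : Z ⟶ Y)
    (a : Z ⟶ (Δ C).obj QQ.Q)
    (H : ∀ {Z' : CubicalSet C} (ρ : Z' ⟶ Z) (b : Z' ⟶ (Δ C).obj QQ.Q), RatLt QQ (ρ ≫ a) b →
      Mem (U.El χ) (prod.lift (ρ ≫ y) b)) : Mem (U.El χ) (prod.lift y a) := by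
  rw [mem_pullback_Δ_iff, lift_uncurry, val_comp]
  refine (D.mem_closed_iff _).mp h y.hom (val a) ((D.mem_upperBound_iff _ _).mpr ?_)
  intro L τ b hb
  obtain ⟨l, hl₁, hl₂⟩ := QQ.exists_ltObj hb
  -- The hypothesis is applied to the generic `b > a` and evaluated at the given one.
  have := H (pullback.fst a ((Δ C).map QQ.ltFst)) (pullback.snd _ _ ≫ (Δ C).map QQ.ltSnd) (by
    rw [pullback.condition, RatLt, val_comp_map, val_comp_map]
    exact QQ.lt_ltFst_ltSnd.comp _)
  rw [mem_pullback_Δ_iff, lift_uncurry, val_comp_map] at this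
  obtain ⟨w, hw₁, hw₂⟩ := exists_pullback_el (IsPullback.of_hasPullback a ((Δ C).map QQ.ltFst)) τ
    (Δel l (τ ≫ Z.dim)) (Δel_ext (by
      rw [Category.assoc, Category.assoc, Δmap_val, Δel_val_assoc, hl₁, val_eq])
      (by rw [Category.assoc, Category.assoc, Hom.dim_eq, Hom.dim_eq, Δel_dim]))
  have := this.comp w
  rw [U.comp_app, val_eq (pullback.snd _ _), ← Category.assoc w, ← Category.assoc w, hw₂,
    Δel_val, hl₂, Category.assoc, val_comp, ← Category.assoc w, hw₁, val_comp] at this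
  exact this

theorem isCocut_el (h : Mem D.incl χ) : IsCocut M QQ (U.El χ) := by
  obtain ⟨h₁, h₂, h₃⟩ := (D.mem_incl_iff χ).mp h
  exact { fib := M.fib_pullback_fst _ (M.constant _)
          hprop := isHProp_of_mono _
          bounded := D.bounded_el h₁
          closed := fun y a H => D.closed_el h₃ y a H
          located := D.located_el h₂ }

theorem mem_incl_iff_isCocut : Mem D.incl χ ↔ IsCocut M QQ (U.El χ) :=
  ⟨D.isCocut_el, fun h => D.mem_incl_of_isCocut (represents_classified t _) h⟩

omit [LocallyCartesianClosed E] [FinitaryExtensive E] D in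
-- Two maps with the same members classify the same subobject, namely the pullback of `t` along `χ`.
theorem _root_.CubicalReals.IsExtensional.eq_of_mem_iff (ht : IsExtensional t) {B : E}
    {χ χ' : B ⟶ Ω} (h : ∀ {K : E} (x : K ⟶ B), Mem t (x ≫ χ) ↔ Mem t (x ≫ χ')) : χ = χ' := by
  have p : ∀ χ' : B ⟶ Ω, (∀ {K : E} (x : K ⟶ B), Mem t (x ≫ χ) ↔ Mem t (x ≫ χ')) →
      IsPullback (terminal.from _) (pullback.fst χ t) t χ' := by
    intro χ' h
    obtain ⟨l, hl⟩ := (h (pullback.fst χ t)).mp ⟨_, pullback.condition.symm⟩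
    rw [Subsingleton.elim l (terminal.from _)] at hl
    refine (isPullback_of_mem hl.symm ?_).flip
    intro Z x hx
    rwa [mem_pullback_fst_iff, h]
  exact ht _ inferInstance _ _ (p χ (fun _ => Iff.rfl)) (p χ' h)

omit D in
theorem mem_of_equivalentOver {B : CubicalSet C} {χ χ' : B ⟶ (Δ C).obj Ω}
    (h : Mem (classified t χ') (classified t χ)) {K : E} (x : K ⟶ B.carrier)
    (hx : Mem t (x ≫ val χ)) : Mem t (x ≫ val χ') := by
  obtain ⟨w, hw⟩ := mem_hom_pullback_Δ χ t x hx
  have := ((mem_pullback_Δ_iff χ' t _).mp h).comp w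
  rwa [val_comp, ← Category.assoc, hw] at this

omit D in
-- Only the two maps of the equivalence matter: they show that `χ` and `χ'` have the same members.
theorem eq_of_equivalentOver (ht : IsExtensional t) {χ χ' : Y ⟶ (Δ C).obj U.obj}
    (h : EquivalentOver J (U.El χ) (U.El χ')) : χ = χ' := by
  obtain ⟨u, w, hu, hw, -, -⟩ := h
  refine (U.isExponential C Y (U.uncurry χ')).unique (val_injective ?_) rfl
  exact ht.eq_of_mem_iff (fun x => ⟨mem_of_equivalentOver ⟨u, hu⟩ x,
    mem_of_equivalentOver ⟨w, hw⟩ x⟩)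

/-- Equivalence makes the underlying predicates equal; the h-proposition `incl` then supplies a
homotopy between its two sections over that predicate. -/
theorem homotopicOver_of_equivalentOver (ht : IsExtensional t) {r r' : Y ⟶ D.Reals}
    (h : EquivalentOver J (U.El (r ≫ D.incl)) (U.El (r' ≫ D.incl))) :
    HomotopicOver J (terminal.from D.Reals) r r' := by
  obtain ⟨H, h₁, h₂, h₃⟩ := D.isHProp_incl.homotopic r r' (eq_of_equivalentOver ht h)
  exact ⟨H, Subsingleton.elim _ _, h₂, h₃⟩

/-- Two h-propositions over the same base with the same sections map to each other, and the
composites are homotopic to identities. -/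
theorem exists_equivalentOver (h : Represents t c (U.uncurry χ)) (hc : IsCocut M QQ c) :
    ∃ r : Y ⟶ D.Reals, EquivalentOver J c (U.El (r ≫ D.incl)) := by
  obtain ⟨r, rfl⟩ := D.mem_incl_of_isCocut h hc
  have h' : Represents t (U.El (r ≫ D.incl)) _ := represents_classified t _
  obtain ⟨u, hu⟩ := (h' c).mpr ((h c).mp (mem_self c))
  obtain ⟨w, hw⟩ := (h (U.El (r ≫ D.incl))).mpr ((h' _).mp (mem_self _))
  exact ⟨r, u, w, hu, hw, hc.hprop.homotopic _ _ (by rw [Category.assoc, hw, hu, Category.id_comp]),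
    (isHProp_of_mono _).homotopic _ _ (by rw [Category.assoc, hu, hw, Category.id_comp])⟩

end CutData

end Reals
end
end CubicalReals

/-! ### Vertices of cubes and their connectedness by lines. -/

namespace CubicalReals
noncomputable section

section Vertices

variable {E : Type u} [Category.{v} E] [HasFiniteLimits E] {NN : NNO E}
  {C : CubeCategory NN}

attribute [local simp] pullback.lift_fst pullback.lift_snd pullback.lift_fst_assoc
  pullback.lift_snd_assoc prod.lift_fst prod.lift_snd prod.lift_fst_assoc prod.lift_snd_assoc

open CubicalSet

namespace CubeCategory

/-- The map into `[n + 1]` determined by maps into `[n]` and `[1]`. -/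
def pairing {K : E} (n : K ⟶ NN.N) (f g : K ⟶ C.Mor) (hfg : f ≫ C.dom = g ≫ C.dom)
    (hf : f ≫ C.cod = n) (hg : g ≫ C.cod = NN.oneAt K) : K ⟶ C.Mor :=
  (C.existsUnique_pair n f g hfg hf hg).choose

theorem proj₁_dom' {K : E} (n : K ⟶ NN.N) : (n ≫ C.proj₁) ≫ C.dom = n ≫ NN.succ := by
  rw [Category.assoc, C.proj₁_dom]

theorem proj₂_dom' {K : E} (n : K ⟶ NN.N) : (n ≫ C.proj₂) ≫ C.dom = n ≫ NN.succ := by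
  rw [Category.assoc, C.proj₂_dom]

section

variable {K : E} (n : K ⟶ NN.N) (f g : K ⟶ C.Mor) (hfg : f ≫ C.dom = g ≫ C.dom)
    (hf : f ≫ C.cod = n) (hg : g ≫ C.cod = NN.oneAt K)

theorem pairing_cod : pairing n f g hfg hf hg ≫ C.cod = n ≫ NN.succ :=
  (C.existsUnique_pair n f g hfg hf hg).choose_spec.1.choose.trans (proj₁_dom' n)

theorem pairing_proj₁ (h : pairing n f g hfg hf hg ≫ C.cod = (n ≫ C.proj₁) ≫ C.dom) :
    C.comp (pairing n f g hfg hf hg) (n ≫ C.proj₁) h = f :=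
  (C.existsUnique_pair n f g hfg hf hg).choose_spec.1.choose_spec.choose_spec.1

theorem pairing_proj₂ (h : pairing n f g hfg hf hg ≫ C.cod = (n ≫ C.proj₂) ≫ C.dom) :
    C.comp (pairing n f g hfg hf hg) (n ≫ C.proj₂) h = g :=
  (C.existsUnique_pair n f g hfg hf hg).choose_spec.1.choose_spec.choose_spec.2

theorem pairing_dom : pairing n f g hfg hf hg ≫ C.dom = f ≫ C.dom := by
  have h := (pairing_cod n f g hfg hf hg).trans (proj₁_dom' (C := C) n).symm
  rw [← C.comp_dom _ _ h, pairing_proj₁]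

end

theorem proj_ext {K : E} (n : K ⟶ NN.N) {h h' : K ⟶ C.Mor} (e : h ≫ C.cod = n ≫ NN.succ)
    (e' : h' ≫ C.cod = n ≫ NN.succ)
    (h₁ : C.comp h (n ≫ C.proj₁) (e.trans (proj₁_dom' n).symm) =
      C.comp h' (n ≫ C.proj₁) (e'.trans (proj₁_dom' n).symm))
    (h₂ : C.comp h (n ≫ C.proj₂) (e.trans (proj₂_dom' n).symm) =
      C.comp h' (n ≫ C.proj₂) (e'.trans (proj₂_dom' n).symm)) : h = h' := by
  refine (C.existsUnique_pair n _ _ ?_ ?_ ?_).unique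
    ⟨e.trans (proj₁_dom' n).symm, e.trans (proj₂_dom' n).symm, rfl, rfl⟩
    ⟨e'.trans (proj₁_dom' n).symm, e'.trans (proj₂_dom' n).symm, h₁.symm, h₂.symm⟩
  · rw [C.comp_dom, C.comp_dom]
  · rw [C.comp_cod, Category.assoc, C.proj₁_cod, Category.comp_id]
  · rw [C.comp_cod, Category.assoc, C.proj₂_cod, NN.comp_oneAt]

/-- The vertex of `[n + 1]` determined by vertices of `[n]` and `[1]`. -/
def vertPair {K : E} (v w : K ⟶ C.Vert) (hw : w ≫ C.vcod = NN.oneAt K) : K ⟶ C.Vert :=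
  vertEl (pairing (v ≫ C.vcod) (v ≫ C.vertι) (w ≫ C.vertι)
    (by rw [comp_vertι_dom, comp_vertι_dom]) (by rw [vcod, Category.assoc])
    (by rw [← hw, vcod, Category.assoc])) (by rw [pairing_dom, comp_vertι_dom])

theorem vertPair_vcod {K : E} (v w : K ⟶ C.Vert) (hw : w ≫ C.vcod = NN.oneAt K) :
    vertPair v w hw ≫ C.vcod = (v ≫ C.vcod) ≫ NN.succ := by
  rw [vertPair, vertEl_vcod, pairing_cod]

theorem vertPair_congr {K : E} {v v' w w' : K ⟶ C.Vert} (hv : v = v') (hww : w = w')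
    (hw : w ≫ C.vcod = NN.oneAt K) (hw' : w' ≫ C.vcod = NN.oneAt K) :
    vertPair v w hw = vertPair v' w' hw' := by subst hv hww; rfl

theorem vert_proj_ext {K : E} (n : K ⟶ NN.N) {v v' : K ⟶ C.Vert} (e : v ≫ C.vcod = n ≫ NN.succ)
    (e' : v' ≫ C.vcod = n ≫ NN.succ)
    (h₁ : vcomp v (n ≫ C.proj₁) (e.trans (proj₁_dom' n).symm) =
      vcomp v' (n ≫ C.proj₁) (e'.trans (proj₁_dom' n).symm))
    (h₂ : vcomp v (n ≫ C.proj₂) (e.trans (proj₂_dom' n).symm) =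
      vcomp v' (n ≫ C.proj₂) (e'.trans (proj₂_dom' n).symm)) : v = v' := by
  refine vert_ext (proj_ext n ?_ ?_ ?_ ?_)
  · rw [← e, vcod, Category.assoc]
  · rw [← e', vcod, Category.assoc]
  · simpa only [vcomp_ι] using congrArg (· ≫ C.vertι) h₁
  · simpa only [vcomp_ι] using congrArg (· ≫ C.vertι) h₂

theorem vertPair_proj₁ {K : E} (n : K ⟶ NN.N) (v w : K ⟶ C.Vert)
    (hw : w ≫ C.vcod = NN.oneAt K) (hv : v ≫ C.vcod = n)
    (h : vertPair v w hw ≫ C.vcod = (n ≫ C.proj₁) ≫ C.dom) :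
    vcomp (vertPair v w hw) (n ≫ C.proj₁) h = v := by
  subst hv
  refine vert_ext ((vcomp_ι _ _ _).trans ?_)
  exact (C.comp_congr (vertEl_ι _ _) rfl _ (by rw [pairing_cod, proj₁_dom'])).trans
    (pairing_proj₁ _ _ _ _ _ _ _)

theorem vertPair_proj₂ {K : E} (n : K ⟶ NN.N) (v w : K ⟶ C.Vert)
    (hw : w ≫ C.vcod = NN.oneAt K) (hv : v ≫ C.vcod = n)
    (h : vertPair v w hw ≫ C.vcod = (n ≫ C.proj₂) ≫ C.dom) :
    vcomp (vertPair v w hw) (n ≫ C.proj₂) h = w := by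
  subst hv
  refine vert_ext ((vcomp_ι _ _ _).trans ?_)
  exact (C.comp_congr (vertEl_ι _ _) rfl _ (by rw [pairing_cod, proj₂_dom'])).trans
    (pairing_proj₂ _ _ _ _ _ _ _)

theorem vcomp_pairing {K : E} (n : K ⟶ NN.N) (f g : K ⟶ C.Mor) (hfg : f ≫ C.dom = g ≫ C.dom)
    (hf : f ≫ C.cod = n) (hg : g ≫ C.cod = NN.oneAt K) (v : K ⟶ C.Vert)
    (h : v ≫ C.vcod = pairing n f g hfg hf hg ≫ C.dom) (h₁ : v ≫ C.vcod = f ≫ C.dom)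
    (h₂ : v ≫ C.vcod = g ≫ C.dom) :
    vcomp v (pairing n f g hfg hf hg) h =
      vertPair (vcomp v f h₁) (vcomp v g h₂) (by rw [vcomp_vcod, hg]) := by
  have hn : vcomp v f h₁ ≫ C.vcod = n := by rw [vcomp_vcod, hf]
  have e₁ := (pairing_cod n f g hfg hf hg).trans (proj₁_dom' (C := C) n).symm
  have e₂ := (pairing_cod n f g hfg hf hg).trans (proj₂_dom' (C := C) n).symm
  refine vert_proj_ext n (by rw [vcomp_vcod, pairing_cod]) (by rw [vertPair_vcod, hn]) ?_ ?_
  · rw [vertPair_proj₁ n _ _ _ hn, vcomp_comp _ _ _ _ e₁ _ (by rw [C.comp_dom, h])]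
    exact vcomp_congr rfl (pairing_proj₁ _ _ _ _ _ _ _) _ _
  · rw [vertPair_proj₂ n _ _ _ hn, vcomp_comp _ _ _ _ e₂ _ (by rw [C.comp_dom, h])]
    exact vcomp_congr rfl (pairing_proj₂ _ _ _ _ _ _ _) _ _

theorem eq_vertPair {K : E} (n : K ⟶ NN.N) (v : K ⟶ C.Vert) (h : v ≫ C.vcod = n ≫ NN.succ) :
    v = vertPair (vcomp v (n ≫ C.proj₁) (h.trans (proj₁_dom' n).symm))
      (vcomp v (n ≫ C.proj₂) (h.trans (proj₂_dom' n).symm))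
      (by rw [vcomp_vcod, Category.assoc, C.proj₂_cod, NN.comp_oneAt]) := by
  have hn : vcomp v (n ≫ C.proj₁) (h.trans (proj₁_dom' n).symm) ≫ C.vcod = n := by
    rw [vcomp_vcod, Category.assoc, C.proj₁_cod, Category.comp_id]
  refine vert_proj_ext n h (by rw [vertPair_vcod, hn]) ?_ ?_
  · rw [vertPair_proj₁ n _ _ _ hn]
  · rw [vertPair_proj₂ n _ _ _ hn]

theorem comp_vertPair {K L : E} (σ : L ⟶ K) (v w : K ⟶ C.Vert) (hw : w ≫ C.vcod = NN.oneAt K)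
    (hw' : (σ ≫ w) ≫ C.vcod = NN.oneAt L) :
    σ ≫ vertPair v w hw = vertPair (σ ≫ v) (σ ≫ w) hw' := by
  have e : vertPair v w hw ≫ C.vcod = (v ≫ C.vcod) ≫ NN.succ := vertPair_vcod v w hw
  have e' : (σ ≫ vertPair v w hw) ≫ C.vcod = ((σ ≫ v) ≫ C.vcod) ≫ NN.succ := by
    rw [Category.assoc, e]; simp
  have a : ((σ ≫ v) ≫ C.vcod) ≫ C.proj₁ = σ ≫ (v ≫ C.vcod) ≫ C.proj₁ := by simp
  have b : ((σ ≫ v) ≫ C.vcod) ≫ C.proj₂ = σ ≫ (v ≫ C.vcod) ≫ C.proj₂ := by simp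
  refine vert_proj_ext _ e' (vertPair_vcod _ _ _) ?_ ?_
  · rw [vertPair_proj₁ _ _ _ _ rfl, vcomp_congr rfl a _ (by rw [← a, e', proj₁_dom']),
      ← comp_vcomp _ _ _ (e.trans (proj₁_dom' _).symm), vertPair_proj₁ _ _ _ _ rfl]
  · rw [vertPair_proj₂ _ _ _ _ rfl, vcomp_congr rfl b _ (by rw [← b, e', proj₂_dom']),
      ← comp_vcomp _ _ _ (e.trans (proj₂_dom' _).symm), vertPair_proj₂ _ _ _ _ rfl]

theorem vert_zero_ext {K : E} {v w : K ⟶ C.Vert} (hv : v ≫ C.vcod = NN.zeroAt K)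
    (hw : w ≫ C.vcod = NN.zeroAt K) : v = w := by
  refine vert_ext (C.toZero_ext ?_ ?_ ?_)
  · rw [comp_vertι_dom, comp_vertι_dom]
  · rw [← hv, vcod, Category.assoc]
  · rw [← hw, vcod, Category.assoc]

/-- The map of cubes with domain `[n]` that is constant with value a vertex. -/
def constMor {K : E} (n : K ⟶ NN.N) (u : K ⟶ C.Vert) : K ⟶ C.Mor :=
  C.comp (C.existsUnique_toZero n).choose (u ≫ C.vertι) (by
    rw [(C.existsUnique_toZero n).choose_spec.1.2, comp_vertι_dom])

theorem constMor_dom {K : E} (n : K ⟶ NN.N) (u : K ⟶ C.Vert) : constMor n u ≫ C.dom = n := by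
  rw [constMor, C.comp_dom, (C.existsUnique_toZero n).choose_spec.1.1]

theorem constMor_cod {K : E} (n : K ⟶ NN.N) (u : K ⟶ C.Vert) :
    constMor n u ≫ C.cod = u ≫ C.vcod := by
  rw [constMor, C.comp_cod, vcod, Category.assoc]

theorem vcomp_constMor {K : E} (n : K ⟶ NN.N) (u w : K ⟶ C.Vert)
    (h : w ≫ C.vcod = constMor n u ≫ C.dom) : vcomp w (constMor n u) h = u := by
  have hn := (C.existsUnique_toZero n).choose_spec.1
  have e : w ≫ C.vcod = (C.existsUnique_toZero n).choose ≫ C.dom := by rw [h, constMor_dom, hn.1]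
  have e' : vcomp w _ e ≫ C.vcod = (u ≫ C.vertι) ≫ C.dom := by
    rw [vcomp_vcod, hn.2, comp_vertι_dom]
  refine (vcomp_comp w _ _ e _ e' h).symm.trans ?_
  refine (vcomp_congr (vert_zero_ext ?_ (idVert_vcod _)) rfl _ ?_).trans (idVert_vcomp u ?_)
  · rw [vcomp_vcod, hn.2]
  · rw [idVert_vcod, comp_vertι_dom]
  · rw [idVert_vcod, comp_vertι_dom]

theorem ident_at_dom {K : E} (n : K ⟶ NN.N) : (n ≫ C.ident) ≫ C.dom = n := by
  rw [Category.assoc, C.ident_dom, Category.comp_id]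

theorem ident_at_cod {K : E} (n : K ⟶ NN.N) : (n ≫ C.ident) ≫ C.cod = n := by
  rw [Category.assoc, C.ident_cod, Category.comp_id]

theorem vcomp_ident_at {K : E} (n : K ⟶ NN.N) (w : K ⟶ C.Vert)
    (h : w ≫ C.vcod = (n ≫ C.ident) ≫ C.dom) : vcomp w (n ≫ C.ident) h = w := by
  have hn : w ≫ C.vcod = n := h.trans (ident_at_dom n)
  subst hn
  exact vcomp_ident _ _

end CubeCategory

open CubeCategory

/-- The morphism of the category of cubes underlying an element of the interval. -/
def intervalι (C : CubeCategory NN) : (interval C).carrier ⟶ C.Mor :=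
  pullback.fst C.cod (NN.oneAt (⊤_ E))

theorem intervalι_cod : intervalι C ≫ C.cod = NN.oneAt _ := by
  refine pullback.condition.trans ?_
  rw [NN.comp_oneAt]
  rfl

/-- The element of the interval given by a morphism with codomain `[1]`. -/
def intervalEl {K : E} (f : K ⟶ C.Mor) (h : f ≫ C.cod = NN.oneAt K) : K ⟶ (interval C).carrier :=
  pullback.lift f (terminal.from K) (by rw [NN.comp_oneAt, h])

theorem intervalEl_ι {K : E} (f : K ⟶ C.Mor) (h : f ≫ C.cod = NN.oneAt K) :
    intervalEl f h ≫ intervalι C = f :=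
  pullback.lift_fst _ _ _

theorem intervalι_dom : intervalι C ≫ C.dom = (interval C).dim := rfl

/-- The vertex of the interval corresponding to a point. -/
def pointVert {K : E} (d : K ⟶ (Γ C).obj (interval C)) : K ⟶ C.Vert :=
  vertEl (d ≫ Γι (interval C) ≫ intervalι C) (by
    rw [Category.assoc, Category.assoc, intervalι_dom, Γι_dim, NN.comp_zeroAt])

theorem pointVert_vcod {K : E} (d : K ⟶ (Γ C).obj (interval C)) :
    pointVert d ≫ C.vcod = NN.oneAt K := by
  rw [pointVert, vertEl_vcod, Category.assoc, Category.assoc, intervalι_cod, NN.comp_oneAt,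
    NN.comp_oneAt]

theorem comp_pointVert {K L : E} (σ : L ⟶ K) (d : K ⟶ (Γ C).obj (interval C)) :
    σ ≫ pointVert d = pointVert (σ ≫ d) :=
  vert_ext (by rw [Category.assoc, pointVert, vertEl_ι, pointVert, vertEl_ι, Category.assoc])

/-- The point of the interval corresponding to a vertex. -/
def vertPoint {K : E} (v : K ⟶ C.Vert) (hv : v ≫ C.vcod = NN.oneAt K) :
    K ⟶ (Γ C).obj (interval C) :=
  Γel (intervalEl (v ≫ C.vertι) (by rw [← hv, vcod, Category.assoc])) (by
    rw [← intervalι_dom, ← Category.assoc, intervalEl_ι, comp_vertι_dom])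

variable [HasFiniteCoproducts E] (J : Endpoints C)

/-- The endpoint `0` of the interval, as a vertex. -/
def zeroEnd (K : E) : K ⟶ C.Vert := pointVert (toΓ (terminal.from ((Δ C).obj K) ≫ J.i₀))

theorem zeroEnd_vcod (K : E) : zeroEnd J K ≫ C.vcod = NN.oneAt K := pointVert_vcod _

theorem comp_zeroEnd {K L : E} (σ : L ⟶ K) : σ ≫ zeroEnd J K = zeroEnd J L := by
  rw [zeroEnd, comp_pointVert, ← toΓ_map_comp, ← Category.assoc, terminal.comp_from, zeroEnd]

/-- The vertices of the cubes all of whose coordinates are `0`. -/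
def zeroVert : NN.N ⟶ C.Vert :=
  prod.lift (terminal.from NN.N) (𝟙 NN.N) ≫
    NN.iter (idVert (⊤_ E)) (vertPair (𝟙 _) (zeroEnd J _) (zeroEnd_vcod J _))

theorem comp_zeroVert_zero (K : E) : NN.zeroAt K ≫ zeroVert J = idVert K := by
  rw [zeroVert, prod.comp_lift_assoc, Category.comp_id, NN.lift_iter_zero, comp_idVert]

theorem comp_zeroVert_succ {K : E} (n : K ⟶ NN.N) :
    (n ≫ NN.succ) ≫ zeroVert J = vertPair (n ≫ zeroVert J) (zeroEnd J K) (zeroEnd_vcod J K) := by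
  rw [zeroVert, prod.comp_lift_assoc, Category.comp_id, NN.lift_iter_succ,
    ← Category.assoc, comp_vertPair _ _ _ _ (by rw [comp_zeroEnd, zeroEnd_vcod])]
  refine vertPair_congr ?_ (comp_zeroEnd J _) _ _
  rw [Category.comp_id, prod.comp_lift_assoc, Category.comp_id]
  congr 2
  exact Subsingleton.elim _ _

variable [LocallyCartesianClosed E]

theorem zeroVert_vcod : zeroVert J ≫ C.vcod = 𝟙 NN.N := by
  refine NN.eq_of_induction (𝟙 _) _ _ ?_ ?_
  · intro K x hx
    rw [Category.comp_id] at hx ⊢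
    rw [hx, ← Category.assoc, comp_zeroVert_zero, idVert_vcod]
  · intro K n ih x hx
    rw [Category.comp_id] at hx ⊢
    have := ih (𝟙 K) n (by simp)
    rw [Category.comp_id, ← Category.assoc] at this
    rw [hx, ← Category.assoc, comp_zeroVert_succ, vertPair_vcod, this]

theorem comp_zeroVert_vcod {K : E} (n : K ⟶ NN.N) : (n ≫ zeroVert J) ≫ C.vcod = n := by
  rw [Category.assoc, zeroVert_vcod, Category.comp_id]

/-- The restriction of elements to the vertex all of whose coordinates are `0`. -/
def restrictZero {X : CubicalSet C} {K : E} (x : K ⟶ X.carrier) : K ⟶ (Γ C).obj X :=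
  restrict x ((x ≫ X.dim) ≫ zeroVert J) (comp_zeroVert_vcod J _)

theorem comp_restrictZero {X : CubicalSet C} {K L : E} (σ : L ⟶ K) (x : K ⟶ X.carrier) :
    σ ≫ restrictZero J x = restrictZero J (σ ≫ x) := by
  rw [restrictZero, comp_restrict _ _ _ _ (by simp [zeroVert_vcod])]
  exact restrict_congr rfl (by simp) _ _

theorem restrictZero_map {X Y : CubicalSet C} (f : X ⟶ Y) {K : E} (x : K ⟶ X.carrier) :
    restrictZero J x ≫ (Γ C).map f = restrictZero J (x ≫ f.hom) := by
  rw [restrictZero, restrict_map f _ _ _ (by rw [comp_zeroVert_vcod, Category.assoc, f.dim_eq])]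
  exact restrict_congr rfl (by rw [Category.assoc x f.hom, f.dim_eq]) _ _

section

variable {Y : CubicalSet C} {X : E} (θ : (Γ C).obj Y ⟶ X)

/-- Restrictions along vertices which agree in all but the last coordinate are identified by every
map that identifies the endpoints of lines. -/
theorem restrict_vertPair_right
    (hθ : ∀ {K : E} (y : K ⟶ Y.carrier) (v w : K ⟶ C.Vert) (hv : v ≫ C.vcod = y ≫ Y.dim)
      (hw : w ≫ C.vcod = y ≫ Y.dim), y ≫ Y.dim = NN.oneAt K →
      restrict y v hv ≫ θ = restrict y w hw ≫ θ)
    {K : E} (y : K ⟶ Y.carrier) (u w w' : K ⟶ C.Vert) (hw : w ≫ C.vcod = NN.oneAt K)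
    (hw' : w' ≫ C.vcod = NN.oneAt K) (h : vertPair u w hw ≫ C.vcod = y ≫ Y.dim)
    (h' : vertPair u w' hw' ≫ C.vcod = y ≫ Y.dim) :
    restrict y (vertPair u w hw) h ≫ θ = restrict y (vertPair u w' hw') h' ≫ θ := by
  -- The two vertices lie on the line of `y` along the map from `[1]` which is constantly `u` in the
  -- first coordinates and the identity in the last.
  let f := constMor (NN.oneAt K) u
  let g := NN.oneAt K ≫ C.ident
  let s : K ⟶ C.Mor := pairing (u ≫ C.vcod) f g
    (by rw [constMor_dom, ident_at_dom]) (constMor_cod _ _) (ident_at_cod _)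
  have hd : s ≫ C.dom = NN.oneAt K := (pairing_dom _ _ _ _ _ _).trans (constMor_dom _ _)
  have hc : s ≫ C.cod = y ≫ Y.dim := by
    rw [← h, vertPair_vcod]
    exact pairing_cod _ _ _ _ _ _
  have hs (x : K ⟶ C.Vert) (hx : x ≫ C.vcod = NN.oneAt K) :
      vcomp x s (hx.trans hd.symm) = vertPair u x hx :=
    (vcomp_pairing _ f g _ _ _ x _ (hx.trans (constMor_dom _ _).symm)
      (hx.trans (ident_at_dom _).symm)).trans
      (vertPair_congr (vcomp_constMor _ _ _ _) (vcomp_ident_at _ _ _) _ _)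
  have hs' (x : K ⟶ C.Vert) (hx : x ≫ C.vcod = NN.oneAt K)
      (hxy : vertPair u x hx ≫ C.vcod = y ≫ Y.dim) :
      restrict y (vertPair u x hx) hxy =
        restrict (Y.act y s hc) x (by rw [Y.act_dim, hd, hx]) := by
    rw [restrict_act y s x hc (hx.trans hd.symm) _ (by rw [vcomp_vcod, hc])]
    exact restrict_congr rfl (hs x hx).symm _ _
  rw [hs' w hw, hs' w' hw']
  exact hθ _ _ _ _ _ (by rw [Y.act_dim, hd])

/-- Both vertices lie on the face of `y` along the map from `[n]` which is the identity in the first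
coordinates and constantly `w` in the last; there `ih` applies. -/
theorem restrict_vertPair_left {K : E} (n : K ⟶ NN.N)
    (ih : ∀ (y : K ⟶ Y.carrier) (v w : K ⟶ C.Vert) (hv : v ≫ C.vcod = y ≫ Y.dim)
      (hw : w ≫ C.vcod = y ≫ Y.dim), y ≫ Y.dim = n →
      restrict y v hv ≫ θ = restrict y w hw ≫ θ)
    (y : K ⟶ Y.carrier) (u u' w : K ⟶ C.Vert) (hw : w ≫ C.vcod = NN.oneAt K)
    (hu : u ≫ C.vcod = n) (hu' : u' ≫ C.vcod = n)
    (h : vertPair u w hw ≫ C.vcod = y ≫ Y.dim)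
    (h' : vertPair u' w hw ≫ C.vcod = y ≫ Y.dim) :
    restrict y (vertPair u w hw) h ≫ θ = restrict y (vertPair u' w hw) h' ≫ θ := by
  let f := n ≫ C.ident
  let g := constMor n w
  let s : K ⟶ C.Mor := pairing n f g
    (by rw [constMor_dom, ident_at_dom]) (ident_at_cod _) ((constMor_cod _ _).trans hw)
  have hd : s ≫ C.dom = n := (pairing_dom _ _ _ _ _ _).trans (ident_at_dom _)
  have hc : s ≫ C.cod = y ≫ Y.dim := by
    rw [← h, vertPair_vcod, hu]
    exact pairing_cod _ _ _ _ _ _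
  have hs (x : K ⟶ C.Vert) (hx : x ≫ C.vcod = n) :
      vcomp x s (hx.trans hd.symm) = vertPair x w hw :=
    (vcomp_pairing _ f g _ _ _ x _ (hx.trans (ident_at_dom _).symm)
      (hx.trans (constMor_dom _ _).symm)).trans
      (vertPair_congr (vcomp_ident_at _ _ _) (vcomp_constMor _ _ _ _) _ _)
  have hs' (x : K ⟶ C.Vert) (hx : x ≫ C.vcod = n)
      (hxy : vertPair x w hw ≫ C.vcod = y ≫ Y.dim) :
      restrict y (vertPair x w hw) hxy =
        restrict (Y.act y s hc) x (by rw [Y.act_dim, hd, hx]) := by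
    rw [restrict_act y s x hc (hx.trans hd.symm) _ (by rw [vcomp_vcod, hc])]
    exact restrict_congr rfl (hs x hx).symm _ _
  rw [hs' u hu, hs' u' hu']
  exact ih _ _ _ _ _ (by rw [Y.act_dim, hd])

theorem restrict_eq_restrictZero_of_succ
    (hθ : ∀ {K : E} (y : K ⟶ Y.carrier) (v w : K ⟶ C.Vert) (hv : v ≫ C.vcod = y ≫ Y.dim)
      (hw : w ≫ C.vcod = y ≫ Y.dim), y ≫ Y.dim = NN.oneAt K →
      restrict y v hv ≫ θ = restrict y w hw ≫ θ) {K : E} (n : K ⟶ NN.N)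
    (ih : ∀ (y : K ⟶ Y.carrier) (v : K ⟶ C.Vert) (hv : v ≫ C.vcod = y ≫ Y.dim),
      y ≫ Y.dim = n → restrict y v hv ≫ θ = restrictZero J y ≫ θ)
    (y : K ⟶ Y.carrier) (v : K ⟶ C.Vert) (hv : v ≫ C.vcod = y ≫ Y.dim)
    (hd : y ≫ Y.dim = n ≫ NN.succ) : restrict y v hv ≫ θ = restrictZero J y ≫ θ := by
  have e := eq_vertPair n v (hv.trans hd)
  have e₀ : (y ≫ Y.dim) ≫ zeroVert J = vertPair (n ≫ zeroVert J) (zeroEnd J K) (zeroEnd_vcod J K) :=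
    (congrArg (· ≫ zeroVert J) hd).trans (comp_zeroVert_succ J n)
  have hn : ∀ (u w : K ⟶ C.Vert) (hw : w ≫ C.vcod = NN.oneAt K), u ≫ C.vcod = n →
      vertPair u w hw ≫ C.vcod = y ≫ Y.dim := by
    intro u w hw hu
    rw [vertPair_vcod, hu, hd]
  have h₁ : vcomp v (n ≫ C.proj₁) ((hv.trans hd).trans (proj₁_dom' n).symm) ≫ C.vcod = n := by
    rw [vcomp_vcod, Category.assoc, C.proj₁_cod, Category.comp_id]
  refine (congrArg (· ≫ θ) (restrict_congr rfl e hv (hn _ _ _ h₁))).trans ?_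
  -- The last coordinate is moved to `0` along a line, then the others by the hypothesis in
  -- dimension `n`.
  refine (restrict_vertPair_right θ hθ y _ _ (zeroEnd J K) _ (zeroEnd_vcod J K) _
    (hn _ _ _ h₁)).trans ?_
  refine (restrict_vertPair_left θ n (fun y v w hv hw hn => (ih y v hv hn).trans
    (ih y w hw hn).symm) y _ (n ≫ zeroVert J) _ _ h₁ (comp_zeroVert_vcod J n) _
    (hn _ _ _ (comp_zeroVert_vcod J n))).trans ?_
  exact congrArg (· ≫ θ) (restrict_congr rfl e₀.symm _ _)

end

/-- Cubes are connected: by induction on the dimension, any vertex is joined to the zero vertex by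
lines. A vertex here is an arbitrary map out of `[0]`, so coordinates need not be endpoints, and
`hθ` speaks of all vertices of a line. -/
theorem restrict_eq_restrictZero {Y : CubicalSet C} {X : E} (θ : (Γ C).obj Y ⟶ X)
    (hθ : ∀ {K : E} (y : K ⟶ Y.carrier) (v w : K ⟶ C.Vert) (hv : v ≫ C.vcod = y ≫ Y.dim)
      (hw : w ≫ C.vcod = y ≫ Y.dim), y ≫ Y.dim = NN.oneAt K →
      restrict y v hv ≫ θ = restrict y w hw ≫ θ)
    {K : E} (y : K ⟶ Y.carrier) (v : K ⟶ C.Vert) (hv : v ≫ C.vcod = y ≫ Y.dim) :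
    restrict y v hv ≫ θ = restrictZero J y ≫ θ := by
  let F := pullback C.vcod Y.dim
  have key : restrict (pullback.snd C.vcod Y.dim) (pullback.fst C.vcod Y.dim) pullback.condition ≫
      θ = restrictZero J (pullback.snd C.vcod Y.dim) ≫ θ := by
    refine NN.eq_of_induction (pullback.snd C.vcod Y.dim ≫ Y.dim) _ _ ?_ ?_
    · intro K x hx
      have e : (x ≫ pullback.fst C.vcod Y.dim) ≫ C.vcod =
          (x ≫ pullback.snd C.vcod Y.dim) ≫ Y.dim := by simp [pullback.condition]
      rw [← Category.assoc, ← Category.assoc, comp_restrict _ _ _ _ e, comp_restrictZero]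
      congr 1
      refine restrict_congr rfl (vert_zero_ext ?_ ?_) _ _
      · rw [e, Category.assoc, hx]
      · rw [comp_zeroVert_vcod, Category.assoc, hx]
    · intro K n ih x hx
      have ih' : ∀ (y : K ⟶ Y.carrier) (v : K ⟶ C.Vert) (hv : v ≫ C.vcod = y ≫ Y.dim),
          y ≫ Y.dim = n → restrict y v hv ≫ θ = restrictZero J y ≫ θ := by
        intro y v hv hn
        have := ih (𝟙 K) (pullback.lift v y hv) (by simp [hn])
        rw [← Category.assoc, ← Category.assoc, comp_restrict _ _ _ _ (by simpa using hv),
          comp_restrictZero] at this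
        refine (congrArg (· ≫ θ) (restrict_congr (pullback.lift_snd v y hv).symm
          (pullback.lift_fst v y hv).symm hv (by simpa using hv))).trans (this.trans ?_)
        rw [pullback.lift_snd]
      have e : (x ≫ pullback.fst C.vcod Y.dim) ≫ C.vcod =
          (x ≫ pullback.snd C.vcod Y.dim) ≫ Y.dim := by simp [pullback.condition]
      rw [← Category.assoc, ← Category.assoc, comp_restrict _ _ _ _ e, comp_restrictZero]
      exact restrict_eq_restrictZero_of_succ J θ hθ n ih' _ _ e (by rw [Category.assoc, hx])
  have := congrArg (pullback.lift v y hv ≫ ·) key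
  simp only [← Category.assoc] at this
  rw [comp_restrict _ _ _ _ (by simpa using hv), comp_restrictZero] at this
  refine (congrArg (· ≫ θ) (restrict_congr (pullback.lift_snd v y hv).symm
    (pullback.lift_fst v y hv).symm hv (by simpa using hv))).trans (this.trans ?_)
  rw [pullback.lift_snd]

end Vertices
end
end CubicalReals

/-! ### Every cocut is represented by a family of `Ω`-valued predicates. -/

namespace CubicalReals
noncomputable section

section Classification

variable {E : Type u} [Category.{v} E] [HasFiniteLimits E] {NN : NNO E}
  {C : CubeCategory NN} [LocallyCartesianClosed E] [FinitaryExtensive E]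

attribute [local simp] pullback.lift_fst pullback.lift_snd pullback.lift_fst_assoc
  pullback.lift_snd_assoc prod.lift_fst prod.lift_snd prod.lift_fst_assoc prod.lift_snd_assoc

open CubicalSet

theorem isInitial_of_Δ {L : E} (h : Nonempty (IsInitial ((Δ C).obj L))) :
    Nonempty (IsInitial L) :=
  ⟨((isInitial_iff _).mp h).some.ofStrict (Δel (C := C) (𝟙 L) (NN.zeroAt L))⟩

theorem Δ_hom_ext {A K : E} {f g : (Δ C).obj K ⟶ (Δ C).obj A}
    (h : Δel (𝟙 K) (NN.zeroAt K) ≫ val f = Δel (𝟙 K) (NN.zeroAt K) ≫ val g) : f = g := by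
  refine toΓ_injective (Γel_ext (Δel_ext ?_ ?_))
  · rw [Category.assoc, toΓ_Δval, h, ← toΓ_Δval, Category.assoc]
  · simp

/-- The object `2` with its elements exchanged. -/
def swap : two E ⟶ two E := coprod.desc coprod.inr coprod.inl

theorem right_swap (K : E) : right K ≫ swap = left K := by
  rw [right, Category.assoc, swap, coprod.inr_desc, left]

theorem comp_swap_eq_left_iff {K : E} (e : K ⟶ two E) : e ≫ swap = left K ↔ e = right K := by
  refine ⟨fun h => ?_, fun h => h ▸ right_swap K⟩
  refine eq_right_of_not_left e fun σ hσ => isInitial_of_left_eq_right ?_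
  have := congrArg (σ ≫ ·) h
  simp only [← Category.assoc, hσ, comp_left] at this
  rw [← this, left, Category.assoc, swap, coprod.inl_desc, right]

/-- The subobject defined by a `Π⁰₁` condition exists by universal quantification of an equalizer
over `ℕ`. -/
theorem exists_isPi01 {B : E} (g : B ⨯ NN.N ⟶ two E) : ∃ (D : E) (i : D ⟶ B), IsPi01 NN i ∧
    ∀ {K : E} (b : K ⟶ B), Mem i b ↔ prod.map b (𝟙 NN.N) ≫ g = left _ := by
  obtain ⟨D, i, hi, h⟩ := exists_forall_sub (prod.fst : B ⨯ NN.N ⟶ B) (equalizer.ι g (left _))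
  have h' : ∀ {K : E} (b : K ⟶ B), Mem i b ↔ prod.map b (𝟙 NN.N) ≫ g = left _ := by
    intro K b
    refine (h b).trans ⟨fun H => ?_, fun H L σ a ha => ?_⟩
    · have := (mem_equalizer_iff _ _ _).mp (H prod.fst (prod.map b (𝟙 NN.N)) (by simp))
      rwa [comp_left] at this
    · rw [mem_equalizer_iff, comp_left]
      have e : a = prod.lift σ (a ≫ prod.snd) ≫ prod.map b (𝟙 _) := by
        apply Limits.prod.hom_ext
        · simpa using ha
        · simp
      rw [e, Category.assoc, H, comp_left]
  exact ⟨D, i, ⟨hi, g, fun K b => h' b⟩, h'⟩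

/-- Negations of fibrations are fibrations. -/
theorem KanFibrations.fib_of_isNegation {J : Endpoints C} (M : KanFibrations J)
    {A B N : CubicalSet C} {c : A ⟶ B} {n : N ⟶ B} (hc : M.Fib c) (hn : IsNegation c n) :
    M.Fib n := by
  have := hn.1
  -- The negation is the dependent product along `c` of the empty family, which is a fibration as a
  -- base change of `Δ 0 ⟶ Δ 1`.
  let g := pullback.snd ((Δ C).map (initial.to (⊤_ E))) (toΔTerminal A)
  have hG : Nonempty (IsInitial (pullback ((Δ C).map (initial.to (⊤_ E))) (toΔTerminal A))) := by
    refine isInitial_of_hom (pullback.fst _ _) ((isInitial_iff _).mpr ⟨?_⟩)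
    exact initialIsInitial.ofStrict (Δval (C := C) (⊥_ E))
  have hsw : ∀ {Z : CubicalSet C} (z : Z ⟶ B), Nonempty (IsInitial (pullback c z)) →
      Nonempty (IsInitial (pullback z c)) := fun z =>
    isInitial_of_hom (pullback.lift (pullback.snd _ _) (pullback.fst _ _) pullback.condition.symm)
  have h₀ := hsw n ((hn.2 N n).mp ⟨𝟙 _, Category.id_comp _⟩)
  refine M.pi c g n (h₀.some.to _) hc (M.fib_snd _ (M.constant _))
    ⟨h₀.some.hom_ext _ _, fun {Z} z k hk => ?_⟩
  have hz := isInitial_of_hom k hG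
  obtain ⟨l, hl⟩ := (hn.2 Z z).mpr (isInitial_of_hom
    (pullback.lift (pullback.snd _ _) (pullback.fst _ _) pullback.condition.symm) hz)
  refine ⟨l, ⟨hl, hz.some.hom_ext _ _⟩, ?_⟩
  rintro l' ⟨hl', -⟩
  rw [← cancel_mono n, hl, hl']

theorem isInitial_of_mem_of_mem {A B N Z : CubicalSet C} {c : A ⟶ B} {n : N ⟶ B}
    (hn : IsNegation c n) {z : Z ⟶ B} (h₁ : Mem n z) (h₂ : Mem c z) : Nonempty (IsInitial Z) := by
  obtain ⟨l, hl⟩ := h₂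
  exact isInitial_of_hom (pullback.lift l (𝟙 _) (by rw [hl, Category.id_comp])) ((hn.2 Z z).mp h₁)

section

variable {J : Endpoints C} {M : KanFibrations J} {QQ : Rationals NN} {Y A : CubicalSet C}
  {c : A ⟶ Y ⨯ (Δ C).obj QQ.Q} {N : CubicalSet C} {n : N ⟶ Y ⨯ (Δ C).obj QQ.Q}

variable (M c n) in
/-- Locatedness of a family `c` with negation `n`. -/
def IsLocated : Prop :=
  ∀ {Z : CubicalSet C} (y : Z ⟶ Y) (a b : Z ⟶ (Δ C).obj QQ.Q), RatLt QQ a b →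
    ∃ (S : CubicalSet C) (i : pullback n (prod.lift y a) ⟶ S)
      (j : pullback c (prod.lift y b) ⟶ S) (s : S ⟶ Z),
      Nonempty (IsColimit (BinaryCofan.mk i j)) ∧
      i ≫ s = pullback.snd n (prod.lift y a) ∧ j ≫ s = pullback.snd c (prod.lift y b) ∧
      MerelyInhabited M s

variable (C) in
theorem isColimit_Δ : Nonempty (IsColimit (BinaryCofan.mk
    ((Δ C).map (coprod.inl : ⊤_ E ⟶ two E)) ((Δ C).map coprod.inr))) := by
  have := (ΔΓ C).leftAdjoint_preservesColimits
  exact ⟨isColimitMapCoconeBinaryCofanEquiv (Δ C) _ _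
    (isColimitOfPreserves (Δ C) (coprodIsCoprod (⊤_ E) (⊤_ E)))⟩

/-- Mere locatedness can be decided on global points. -/
theorem IsLocated.exists_decision (hl : IsLocated M c n) (hf : M.Fib c) (hn : IsNegation c n) :
    ∃ dec : (Γ C).obj Y ⨯ QQ.ltObj ⟶ two E,
      (∀ {K : E} (x : K ⟶ (Γ C).obj Y ⨯ QQ.ltObj), x ≫ dec = left K →
        Mem n (prod.lift (ofΓ (x ≫ prod.fst)) ((Δ C).map (x ≫ prod.snd ≫ QQ.ltFst)))) ∧
      (∀ {K : E} (x : K ⟶ (Γ C).obj Y ⨯ QQ.ltObj), x ≫ dec = right K →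
        Mem c (prod.lift (ofΓ (x ≫ prod.fst)) ((Δ C).map (x ≫ prod.snd ≫ QQ.ltSnd)))) := by
  -- Locatedness is used in the constant context of the generic point of `Y` and the generic pair `a
  -- < b`.
  let B := (Γ C).obj Y ⨯ QQ.ltObj
  let y : (Δ C).obj B ⟶ Y := ofΓ prod.fst
  let a : (Δ C).obj B ⟶ (Δ C).obj QQ.Q := (Δ C).map (prod.snd ≫ QQ.ltFst)
  let b : (Δ C).obj B ⟶ (Δ C).obj QQ.Q := (Δ C).map (prod.snd ≫ QQ.ltSnd)
  obtain ⟨S, i, j, s, ⟨hS⟩, hi, hj, hm⟩ := hl y a b (by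
    have := QQ.lt_ltFst_ltSnd.comp (Δval (C := C) B ≫ prod.snd)
    rw [Category.assoc, Category.assoc] at this
    rwa [RatLt, val_map, val_map])
  have hs : HasPathLifting s := HasPathLifting.of_isColimit hS
    (hi ▸ M.hasPathLifting (M.fib_snd _ (M.fib_of_isNegation hf hn)))
    (hj ▸ M.hasPathLifting (M.fib_snd _ hf))
  obtain ⟨σ, hσ⟩ := hm.exists_points hs
  -- The context is constant, so a choice on points extends to a section of `s` itself.
  let v : (Δ C).obj B ⟶ S := ofΓ (toΓ (𝟙 _) ≫ σ)
  have hv : v ≫ s = 𝟙 _ := by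
    rw [ofΓ_comp, Category.assoc, hσ, Category.comp_id, ofΓ_toΓ]
  obtain ⟨e, he₁, he₂⟩ : ∃ e : S ⟶ (Δ C).obj (two E),
      i ≫ e = toΔTerminal _ ≫ (Δ C).map coprod.inl ∧
      j ≫ e = toΔTerminal _ ≫ (Δ C).map coprod.inr :=
    let k := BinaryCofan.IsColimit.desc' hS (toΔTerminal _ ≫ (Δ C).map coprod.inl)
      (toΔTerminal _ ≫ (Δ C).map coprod.inr)
    ⟨k.1, k.2.1, k.2.2⟩
  -- By extensivity the summands of `S` are the fibres of `e` over the two elements of `2`, so the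
  -- value of the decision recovers a witness in the corresponding summand.
  obtain ⟨p₁, p₂⟩ := (isColimit_iff_isPullback (isColimit_Δ C).some he₁ he₂).mp ⟨hS⟩
  have key : ∀ {K : E} (x : K ⟶ B) (k : ⊤_ E ⟶ two E),
      x ≫ Δel (𝟙 B) (NN.zeroAt B) ≫ val (v ≫ e) = terminal.from K ≫ k →
      ((Δ C).map x ≫ v) ≫ e = (Δ C).map (terminal.from K) ≫ (Δ C).map k := by
    intro K x k h
    rw [← Functor.map_comp, ← h, Category.assoc]
    refine Δ_hom_ext ?_
    rw [val_comp, val_map, Δel_val_assoc, Category.id_comp, ← Category.assoc, ← Category.assoc]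
    congr 1
    refine Δel_ext ?_ ?_
    · rw [Category.assoc, Δmap_val, Category.assoc]; simp
    · simp [Hom.dim_eq]
  have key' : ∀ {K : E} {T P : CubicalSet C} (x : K ⟶ B) (w : (Δ C).obj K ⟶ P) (i : P ⟶ S)
      (m : T ⟶ Y ⨯ (Δ C).obj QQ.Q) (f : QQ.ltObj ⟶ QQ.Q) (r : P ⟶ T),
      w ≫ i = (Δ C).map x ≫ v → r ≫ m = i ≫ s ≫ prod.lift y ((Δ C).map (prod.snd ≫ f)) →
      Mem m (prod.lift (ofΓ (x ≫ prod.fst)) ((Δ C).map (x ≫ prod.snd ≫ f))) := by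
    intro K T P x w i m f r hw hr
    refine ⟨w ≫ r, ?_⟩
    rw [Category.assoc, hr, reassoc_of% hw, reassoc_of% hv, prod.comp_lift, map_comp_ofΓ,
      ← Functor.map_comp]
  refine ⟨Δel (𝟙 B) (NN.zeroAt B) ≫ val (v ≫ e), fun x hx => ?_, fun x hx => ?_⟩
  · exact key' x (p₁.lift _ _ (key x _ hx)) i n _ (pullback.fst _ _) (p₁.lift_fst _ _ _)
      (by rw [reassoc_of% hi, pullback.condition])
  · exact key' x (p₂.lift _ _ (key x _ hx)) j c _ (pullback.fst _ _) (p₂.lift_fst _ _ _)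
      (by rw [reassoc_of% hj, pullback.condition])

/-- If `a ∉ c` is impossible, the sum collapses to its second summand, and the truncation can be
eliminated because `b ∈ c` is an h-proposition. -/
theorem IsLocated.of_isInitial (hl : IsLocated M c n) (hf : M.Fib c) (hp : IsHProp J c)
    {Z : CubicalSet C} (y : Z ⟶ Y) {a b : Z ⟶ (Δ C).obj QQ.Q} (hab : RatLt QQ a b)
    (h : Nonempty (IsInitial (pullback n (prod.lift y a)))) : Mem c (prod.lift y b) := by
  obtain ⟨S, i, j, s, ⟨hS⟩, hi, hj, hm⟩ := hl y a b hab
  obtain ⟨k, hk⟩ : ∃ k : S ⟶ pullback c (prod.lift y b), j ≫ k = 𝟙 _ :=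
    let k := BinaryCofan.IsColimit.desc' hS (h.some.to (pullback c (prod.lift y b))) (𝟙 _)
    ⟨k.1, k.2.2⟩
  obtain ⟨w, hw⟩ := hm.exists_section (pullback.snd c (prod.lift y b)) (M.fib_snd _ hf)
    (hp.of_isPullback (IsPullback.of_hasPullback _ _)) k
    (BinaryCofan.IsColimit.hom_ext hS (h.some.hom_ext _ _) (by
      change j ≫ _ = j ≫ _
      rw [reassoc_of% hk, hj]))
  exact ⟨w ≫ pullback.fst _ _, by rw [Category.assoc, pullback.condition, reassoc_of% hw]⟩

/-- Upward closure is not part of the definition; it follows from locatedness, since `a ∈ c`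
excludes `a ∉ c`. -/
theorem IsLocated.mem_of_lt (hl : IsLocated M c n) (hf : M.Fib c) (hp : IsHProp J c)
    (hn : IsNegation c n) {Z : CubicalSet C} (y : Z ⟶ Y) {a b : Z ⟶ (Δ C).obj QQ.Q}
    (hab : RatLt QQ a b) (h : Mem c (prod.lift y a)) : Mem c (prod.lift y b) :=
  hl.of_isInitial hf hp y hab (isInitial_of_mem_of_mem hn
    (z := pullback.snd n (prod.lift y a) ≫ prod.lift y a) ⟨_, pullback.condition⟩ (h.comp _))

/-- The restriction of a cocut to global points is classified by `Ω`. -/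
theorem IsCocut.exists_classifier (hc : IsCocut M QQ c) {Ω : E} {t : ⊤_ E ⟶ Ω}
    (ht : IsPi01Classifier NN t) : ∃ χ₀ : (Γ C).obj Y ⨯ QQ.Q ⟶ Ω,
      ∀ {K : E} (p : K ⟶ (Γ C).obj Y) (q : K ⟶ QQ.Q),
        Mem t (prod.lift p q ≫ χ₀) ↔ Mem c (prod.lift (ofΓ p) ((Δ C).map q)) := by
  obtain ⟨N, n, hn, hl⟩ := hc.located
  replace hl : IsLocated M c n := hl
  obtain ⟨dec, h₁, h₂⟩ := hl.exists_decision hc.fib hn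
  let B := ((Γ C).obj Y ⨯ QQ.Q) ⨯ NN.N
  -- The pair `q < q + 1 / (n + 1)`, as a function of `q` and `n`.
  obtain ⟨l, hl₁, hl₂⟩ := QQ.exists_ltObj
    (QQ.lt_approx ((prod.fst : B ⟶ _) ≫ prod.snd) (prod.snd : B ⟶ NN.N))
  let d : B ⟶ two E := prod.lift (prod.fst ≫ prod.fst) l ≫ dec
  -- The swap is needed because a `Π⁰₁` condition asks for the left value, whereas the decision for
  -- membership is on the right.
  obtain ⟨D, i, hi, hi'⟩ := exists_isPi01 (d ≫ swap)
  obtain ⟨χ₀, hχ₀⟩ := ht.2 i hi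
  have hmem : ∀ {K : E} (x : K ⟶ (Γ C).obj Y ⨯ QQ.Q), Mem t (x ≫ χ₀) ↔ Mem i x := by
    intro K x
    refine ⟨fun ⟨k, hk⟩ => ⟨hχ₀.lift k x hk, hχ₀.lift_snd _ _ _⟩, ?_⟩
    rintro ⟨k, rfl⟩
    exact ⟨k ≫ terminal.from D, by rw [Category.assoc, hχ₀.w, Category.assoc]⟩
  refine ⟨χ₀, fun {K} p q => ?_⟩
  rw [hmem, hi', ← Category.assoc, comp_swap_eq_left_iff]
  let x := prod.map (prod.lift p q) (𝟙 NN.N) ≫ prod.lift ((prod.fst : B ⟶ _) ≫ prod.fst) l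
  have hx : prod.map (prod.lift p q) (𝟙 NN.N) ≫ d = x ≫ dec := (Category.assoc _ _ _).symm
  have hx₁ : x ≫ prod.fst = prod.fst ≫ p := by simp [x]
  have hx₂ : x ≫ prod.snd ≫ QQ.ltFst = prod.fst ≫ q := by simp [x, hl₁]
  have hx₃ : x ≫ prod.snd ≫ QQ.ltSnd = QQ.approx (prod.fst ≫ q) prod.snd := by
    simp [x, hl₂, QQ.comp_approx]
  rw [hx]
  constructor
  · intro H
    have H' := h₂ x H
    rw [hx₁, hx₃] at H'
    -- Each `b > q` lies above `q + 1 / (n + 1)` for `n` given by `index`, so it belongs to `c` by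
    -- upward closure; closedness then gives `q ∈ c`.
    refine hc.closed (ofΓ p) ((Δ C).map q) fun {Z'} ρ b hb => ?_
    rw [RatLt, val_comp_map] at hb
    let m : Z' ⟶ (Δ C).obj NN.N := mkΔ (QQ.index (val ρ ≫ q) (val b)) (fun x s h => by
      rw [QQ.comp_index, QQ.comp_index, ← Category.assoc, act_val, act_val, Category.assoc])
    have H'' := H'.comp (pairΔ ρ m)
    rw [prod.comp_lift, ← map_comp_ofΓ, ← Category.assoc, pairΔ_fst] at H''
    refine hl.mem_of_lt hc.fib hc.hprop hn _ ?_ H''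
    rw [RatLt, val_comp_map, val_pairΔ, QQ.comp_approx, prod.lift_fst_assoc, prod.lift_snd,
      val_mkΔ]
    exact QQ.approx_index_lt hb
  · intro H
    -- A left value of the decision would give `q ∉ c`, which contradicts `H`.
    refine eq_right_of_not_left _ fun {L} σ hσ => isInitial_of_Δ (C := C) ?_
    rw [← Category.assoc] at hσ
    have H' := h₁ _ hσ
    rw [Category.assoc, hx₁, Category.assoc, hx₂] at H'
    refine isInitial_of_mem_of_mem hn H' ?_
    have := H.comp ((Δ C).map (σ ≫ prod.fst))
    rwa [prod.comp_lift, map_comp_ofΓ, ← Functor.map_comp, Category.assoc, Category.assoc] at this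

end

theorem act_intervalι {K : E} (x : K ⟶ (interval C).carrier) (s : K ⟶ C.Mor)
    (h : s ≫ C.cod = x ≫ (interval C).dim) (h' : s ≫ C.cod = (x ≫ intervalι C) ≫ C.dom) :
    (interval C).act x s h ≫ intervalι C = C.comp s (x ≫ intervalι C) h' :=
  pullback.lift_fst _ _ _

section Line

variable {Y : CubicalSet C} {K : E} (y : K ⟶ Y.carrier) (hy : y ≫ Y.dim = NN.oneAt K)

/-- The underlying map of the line determined by elements of dimension `1`. -/
def lineHom : ((Δ C).obj K ⨯ interval C).carrier ⟶ Y.carrier :=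
  Y.act ((prod.fst : (Δ C).obj K ⨯ interval C ⟶ _).hom ≫ Δval K ≫ y)
    ((prod.snd : (Δ C).obj K ⨯ interval C ⟶ _).hom ≫ intervalι C)
    (by rw [Category.assoc, intervalι_cod, Category.assoc, Category.assoc, hy]
        simp [NN.comp_oneAt])

theorem comp_lineHom {L : E} (x : L ⟶ ((Δ C).obj K ⨯ interval C).carrier)
    (a : L ⟶ Y.carrier) (s : L ⟶ C.Mor) (h : s ≫ C.cod = a ≫ Y.dim)
    (ha : (x ≫ (prod.fst : (Δ C).obj K ⨯ interval C ⟶ _).hom) ≫ Δval K ≫ y = a)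
    (hs : (x ≫ (prod.snd : (Δ C).obj K ⨯ interval C ⟶ _).hom) ≫ intervalι C = s) :
    x ≫ lineHom y hy = Y.act a s h := by
  have e : (x ≫ (prod.snd : (Δ C).obj K ⨯ interval C ⟶ _).hom ≫ intervalι C) ≫ C.cod =
      (x ≫ (prod.fst : (Δ C).obj K ⨯ interval C ⟶ _).hom ≫ Δval K ≫ y) ≫ Y.dim := by
    rw [← Category.assoc, hs, ← Category.assoc, ha, h]
  rw [lineHom, Y.act_nat _ _ _ _ e]
  exact Y.act_congr (by rw [← ha, Category.assoc]) (by rw [← hs, Category.assoc]) _ _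

/-- The line in a cubical set determined by elements of dimension `1`. -/
def line : (Δ C).obj K ⨯ interval C ⟶ Y where
  hom := lineHom y hy
  hom_dim := by rw [lineHom, act_dim, Category.assoc, intervalι_dom, Hom.dim_eq]
  act_hom {L} x s h h' := by
    let a := (x ≫ (prod.fst : (Δ C).obj K ⨯ interval C ⟶ _).hom) ≫ Δval K ≫ y
    let r := (x ≫ (prod.snd : (Δ C).obj K ⨯ interval C ⟶ _).hom) ≫ intervalι C
    have e : r ≫ C.cod = a ≫ Y.dim := by
      simp only [a, r]
      rw [Category.assoc, intervalι_cod, Category.assoc, Category.assoc, Category.assoc,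
        Category.assoc, hy]
      simp [NN.comp_oneAt]
    have e₁ : s ≫ C.cod = (x ≫ (prod.snd : (Δ C).obj K ⨯ interval C ⟶ _).hom) ≫
        (interval C).dim := by rw [h, Category.assoc, Hom.dim_eq]
    have e₂ : s ≫ C.cod = r ≫ C.dom := by rw [e₁, ← intervalι_dom, Category.assoc, Category.assoc,
      Category.assoc]
    have hx : x ≫ lineHom y hy = Y.act a r e := comp_lineHom y hy x a r e rfl rfl
    have e₃ : s ≫ C.cod = Y.act a r e ≫ Y.dim := by rw [← hx, h']
    refine (comp_lineHom y hy _ a (C.comp s r e₂) (by rw [C.comp_cod, e]) ?_ ?_).trans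
      ((Y.act_comp a r s e e₃ e₂ (by rw [C.comp_cod, e])).symm.trans
        (Y.act_congr hx.symm rfl _ _))
    · rw [Hom.act_eq, act_Δval_assoc]
    · rw [Hom.act_eq]
      exact act_intervalι _ _ _ _

/-- By the Yoneda lemma an element of dimension `1` is a line; evaluating it at a point of the
interval is restriction to the corresponding vertex. -/
theorem lift_line (v : K ⟶ C.Vert) (hv : v ≫ C.vcod = NN.oneAt K) :
    prod.lift (𝟙 _) (ofΓ (vertPoint v hv)) ≫ line y hy =
      ofΓ (restrict y v (hv.trans hy.symm)) := by
  refine toΓ_injective (Γel_ext ?_)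
  rw [toΓ_ofΓ, restrict_ι, toΓ, Γel_ι, comp_hom, ← Category.assoc]
  refine comp_lineHom y hy _ _ _ _ ?_ ?_
  · rw [Category.assoc, Category.assoc, lift_hom_fst_assoc, id_hom, Category.id_comp, Δel_val_assoc,
      Category.id_comp]
  · rw [Category.assoc, Category.assoc, lift_hom_snd_assoc, ← Category.assoc]
    have := congrArg (· ≫ Γι (interval C)) (toΓ_ofΓ (vertPoint v hv))
    simp only [toΓ, Γel_ι] at this
    rw [this, vertPoint, Γel_ι, intervalEl_ι]

end Line

section

variable {J : Endpoints C} {M : KanFibrations J} {QQ : Rationals NN} {Y A : CubicalSet C}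
  {c : A ⟶ Y ⨯ (Δ C).obj QQ.Q}

/-- Transport along a line with the rational held fixed: the path is lifted starting from the vertex
`v`, and the lift is evaluated at `w`. -/
theorem HasPathLifting.mem_restrict (hc : HasPathLifting c) {K : E} (y : K ⟶ Y.carrier)
    (v w : K ⟶ C.Vert) (hv : v ≫ C.vcod = y ≫ Y.dim) (hw : w ≫ C.vcod = y ≫ Y.dim)
    (hy : y ≫ Y.dim = NN.oneAt K) (q : K ⟶ QQ.Q)
    (h : Mem c (prod.lift (ofΓ (restrict y v hv)) ((Δ C).map q))) :
    Mem c (prod.lift (ofΓ (restrict y w hw)) ((Δ C).map q)) := by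
  have e : ∀ (v : K ⟶ C.Vert) (hv : v ≫ C.vcod = y ≫ Y.dim),
      prod.lift (𝟙 _) (ofΓ (vertPoint v (hv.trans hy))) ≫
        prod.lift (line y hy) (prod.fst ≫ (Δ C).map q) =
      prod.lift (ofΓ (restrict y v hv)) ((Δ C).map q) := by
    intro v hv
    rw [prod.comp_lift, lift_line, prod.lift_fst_assoc, Category.id_comp]
  obtain ⟨l, hl⟩ := h
  obtain ⟨k, hk⟩ := hc (ofΓ (vertPoint v (hv.trans hy))) (𝟙 _) l
    (prod.lift (line y hy) (prod.fst ≫ (Δ C).map q)) (by rw [Category.id_comp, e, hl])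
  rw [← e w hw, ← hk]
  exact ⟨_, (Category.assoc _ _ _)⟩

variable {Ω : E} {t : ⊤_ E ⟶ Ω} (U : PredicateObject QQ.Q t)

/-- Every cocut is represented by a map into the constant cubical set of predicates. -/
theorem IsCocut.exists_represents (hc : IsCocut M QQ c) (ht : IsPi01Classifier NN t) :
    ∃ χ : Y ⟶ (Δ C).obj U.obj, Represents t c (U.uncurry χ) := by
  obtain ⟨χ₀, hχ₀⟩ := hc.exists_classifier ht
  obtain ⟨θ, hθ⟩ := U.exists_app χ₀
  have happ : ∀ {K : E} (p : K ⟶ (Γ C).obj Y) (q : K ⟶ QQ.Q),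
      U.app (p ≫ θ) q = prod.lift p q ≫ χ₀ := by
    intro K p q
    rw [← hθ, U.comp_app]
    simp
  -- By extensionality it suffices that membership in `c` agrees at the two vertices, which is
  -- transport in both directions.
  have hline : ∀ {K : E} (y : K ⟶ Y.carrier) (v w : K ⟶ C.Vert) (hv : v ≫ C.vcod = y ≫ Y.dim)
      (hw : w ≫ C.vcod = y ≫ Y.dim), y ≫ Y.dim = NN.oneAt K →
      restrict y v hv ≫ θ = restrict y w hw ≫ θ := by
    intro K y v w hv hw hy
    refine PredicateObject.hom_ext (ht.1.eq_of_mem_iff fun {L} x => ?_)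
    have e : ∀ (v : K ⟶ C.Vert) (hv : v ≫ C.vcod = y ≫ Y.dim),
        Mem t (x ≫ U.app (prod.fst ≫ restrict y v hv ≫ θ) prod.snd) ↔
        Mem c (prod.lift (ofΓ (restrict ((x ≫ prod.fst) ≫ y) ((x ≫ prod.fst) ≫ v)
          (by rw [Category.assoc, hv]; simp))) ((Δ C).map (x ≫ prod.snd))) := by
      intro v hv
      rw [U.comp_app, ← Category.assoc, ← Category.assoc, happ, hχ₀,
        comp_restrict _ _ _ _ (by rw [Category.assoc, hv]; simp)]
    have hy' : ((x ≫ prod.fst) ≫ y) ≫ Y.dim = NN.oneAt L := by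
      rw [Category.assoc, hy, NN.comp_oneAt]
    rw [e v hv, e w hw]
    have hp : HasPathLifting c := M.hasPathLifting hc.fib
    exact ⟨hp.mem_restrict _ _ _ _ _ hy' _, hp.mem_restrict _ _ _ _ _ hy' _⟩
  -- The predicate of an element is read off at its zero vertex. Invariance holds because the zero
  -- vertex of a restriction is some vertex of the original element, and all vertices give the same
  -- value.
  let χ : Y ⟶ (Δ C).obj U.obj := mkΔ (restrictZero J (𝟙 Y.carrier) ≫ θ) (fun {K} x s h => by
    rw [← Category.assoc, ← Category.assoc, comp_restrictZero, comp_restrictZero, Category.comp_id,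
      Category.comp_id]
    have e := (comp_zeroVert_vcod J (Y.act x s h ≫ Y.dim)).trans (Y.act_dim x s h)
    refine (congrArg (· ≫ θ) (restrict_act x s _ h e _ (by rw [CubeCategory.vcomp_vcod, h]))).trans ?_
    exact restrict_eq_restrictZero J θ hline _ _ _)
  refine ⟨χ, fun {Z} z => ?_⟩
  obtain ⟨y, a, rfl⟩ : ∃ y a, z = prod.lift y a := ⟨_, _, (prod_lift_eta z).symm⟩
  rw [CutData.lift_uncurry, val_comp, val_mkΔ, ← Category.assoc, comp_restrictZero,
    Category.comp_id, happ, hχ₀]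
  obtain ⟨N, n, hn, hl⟩ := hc.located
  replace hl : IsLocated M c n := hl
  -- Lifts can be restricted to the zero vertex. This is used both for `c` and for its negation.
  have hz : ∀ {W B : CubicalSet C} {m : B ⟶ Y ⨯ (Δ C).obj QQ.Q} (y : W ⟶ Y)
      (a : W ⟶ (Δ C).obj QQ.Q), Mem m (prod.lift y a) →
      Mem m (prod.lift (ofΓ (restrictZero J y.hom)) ((Δ C).map (val a))) := by
    intro W B m y a h
    have := h.comp (ofΓ (restrictZero J (𝟙 W.carrier)))
    rw [prod.comp_lift, ofΓ_comp, restrictZero_map, Category.id_comp] at this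
    convert this using 2
    refine Δ_hom_ext ?_
    rw [val_map, Δel_val_assoc, Category.id_comp, ← toΓ_Δval, toΓ_comp, toΓ_ofΓ, Category.assoc,
      Γmap_ι_assoc, ← val_eq, restrictZero, restrict_val, Category.id_comp]
  refine ⟨hz y a, fun h => hc.closed y a fun {Z'} ρ b hb => ?_⟩
  -- The converse recovers membership in all dimensions from one vertex: `a ∉ c` would restrict to
  -- that vertex and contradict `h` there, so locatedness yields `b ∈ c`.
  refine hl.of_isInitial hc.fib hc.hprop _ hb ?_
  let w := pullback.snd n (prod.lift (ρ ≫ y) (ρ ≫ a)) ≫ ρ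
  have h₁ : Mem n (prod.lift (w ≫ y) (w ≫ a)) := by
    refine ⟨pullback.fst _ _, pullback.condition.trans ?_⟩
    rw [prod.comp_lift, Category.assoc, Category.assoc]
  have h₂ := h.comp ((Δ C).map w.hom)
  rw [prod.comp_lift, map_comp_ofΓ, comp_restrictZero, ← Functor.map_comp] at h₂
  have := isInitial_of_Δ (isInitial_of_mem_of_mem hn (hz _ _ h₁) (by rw [val_comp]; exact h₂))
  exact (isInitial_iff _).mpr this

end

end Classification
end
end CubicalReals

/-! ### The type of Dedekind real numbers. -/

theorem mainTheorem5 {E : Type u} [Category.{v} E] [Regular E] [LocallyCartesianClosed E]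
    [FinitaryExtensive E] {NN : NNO E} (QQ : Rationals NN)
    {C : CubeCategory NN} {J : Endpoints C} (M : KanFibrations J)
    {Ω : E} (t : ⊤_ E ⟶ Ω) (ht : IsPi01Classifier NN t) :
    ∃ (P : CubicalSet C) (ev : P ⨯ (Δ C).obj QQ.Q ⟶ (Δ C).obj Ω) (R : CubicalSet C) (ι : R ⟶ P),
      IsExponential ev ∧
      M.Fib (terminal.from R) ∧ M.Fib ι ∧ IsHProp J ι ∧
      (∀ (Y : CubicalSet C) (χ : Y ⟶ P),
        (∃ r : Y ⟶ R, r ≫ ι = χ) ↔ IsCocut M QQ (classified t (prod.map χ (𝟙 _) ≫ ev))) ∧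
      (∀ (Y A : CubicalSet C) (c : A ⟶ Y ⨯ (Δ C).obj QQ.Q), IsCocut M QQ c →
        ∃ r : Y ⟶ R, EquivalentOver J c (classified t (prod.map (r ≫ ι) (𝟙 _) ≫ ev))) ∧
      (∀ (Y : CubicalSet C) (r r' : Y ⟶ R),
        EquivalentOver J (classified t (prod.map (r ≫ ι) (𝟙 _) ≫ ev))
          (classified t (prod.map (r' ≫ ι) (𝟙 _) ≫ ev)) →
        HomotopicOver J (terminal.from R) r r') := by
  obtain ⟨U⟩ := exists_predicateObject QQ.Q t
  obtain ⟨D⟩ := exists_cutData M U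
  refine ⟨(Δ C).obj U.obj, U.evΔ C, D.Reals, D.incl, U.isExponential C, D.fib_reals, D.fib_incl,
    D.isHProp_incl, fun Y χ => D.mem_incl_iff_isCocut, fun Y A c hc => ?_,
    fun Y r r' h => D.homotopicOver_of_equivalentOver ht.1 h⟩
  obtain ⟨χ, hχ⟩ := hc.exists_represents U ht
  exact D.exists_equivalentOver hχ hc
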